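/- Let $M=(M_0,\mathcal O_M)$ be a real smooth supermanifold of dimension $(p,q)$: $M_0$ is a Hausdorff, second countable smooth $p$-manifold, $\mathcal O_M$ is a sheaf of supercommutative real superalgebras on $M_0$ that is locally isomorphic to $C^\infty_{M_0}\otimes\Lambda(\mathbb R^q)$, and $j\colon M_0\to M$ is the canonical embedding. A retraction on $M$ is a morphism $\gamma\colon M\to M_0$ with $\gamma\circ j=\mathrm{id}_{M_0}$. A coordinate system $x=(u,\xi)$ on an open subspace $U$ has $\gamma$ as its associated retraction if $u=\gamma^*(u_0)$, where $u_0=j^*(u)$ is the underlying classical chart; every superfunction on $U$ then has a unique expansion $f=\sum_{\nu\in\{0,1\}^q}\gamma^*(f_\nu)\,\xi^\nu$ with $f_\nu\in C^\infty(U_0)$. A Berezin density $\omega$ on $M$ is a global section of the sheaf $|\mathrm{Ber}|_M$, that is, $\omega=f\,|Dx|$ in each coordinate system $x$, where for coordinate systems $x=(u,\xi)$ and $y=(v,\eta)$ on the same $U$ $$|Dx|=\operatorname{sgn}\bigl(j^*\det R\bigr)\,\det(R-SV^{-1}T)\,\det(V^{-1})\;|Dy|,\qquad \begin{pmatrix}R&S\\T&V\end{pmatrix}=\begin{pmatrix}\partial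 u/\partial v&\partial\xi/\partial v\\ \partial u/\partial\eta&\partial\xi/\partial\eta\end{pmatrix}.$$ Fix a sign convention $(-1)^{s(p,q)}$. The fibre integral of $\omega$ along $\gamma$ is the density $\gamma_!(\omega)$ on $M_0$ given by $\gamma_!(\omega)|_U=(-1)^{s(p,q)}f_{(1,\dots,1)}\,|du_0|$ whenever $x=(u,\xi)$ is a coordinate system on $U$ with associated retraction $\gamma$ and $\omega|_U=f\,|Dx|$. The Berezin density $\omega$ is called integrable with respect to $\gamma$ if $\gamma_!(\omega)$ is integrable on $M_0$, and then $\int_{(M,\gamma)}\omega:=\int_{M_0}\gamma_!(\omega)$. **Statement.** Let $\gamma,\gamma'$ be retractions on $M$ and let $\omega$ be a Berezin density on $M$ with compact support. Then $\omega$ is integrable with respect to $\gamma$ and with respect to $\gamma'$, and $$\int_{(M,\gamma)}\omega=\int_{(M,\gamma')}\omega.$$ -/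

import Mathlib

open scoped Manifold ContDiff
open TopologicalSpace MeasureTheory Opposite CategoryTheory

universe u

noncomputable section

namespace Supergeometry

/-! ### The underlying smooth manifold -/

/-- The model space `ℝ^p` of the underlying manifolds. -/
abbrev Model (p : ℕ) : Type := EuclideanSpace ℝ (Fin p)

section Classical

variable {p : ℕ} {M₀ : Type u} [TopologicalSpace M₀] [ChartedSpace (Model p) M₀]

/-- The `ℝ`-algebra `C^∞(U)` of smooth real functions on an open subset `U` of `M₀`. -/
abbrev Smooth (p : ℕ) {M₀ : Type u} [TopologicalSpace M₀] [ChartedSpace (Model p) M₀]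
    (U : Opens M₀) : Type u :=
  C^∞⟮𝓡 p, U; 𝓘(ℝ), ℝ⟯

/-- A smooth function on `U`, as an element of `C^∞(U)`. -/
def toSmooth {U : Opens M₀} (f : U → ℝ) (hf : ContMDiff (𝓡 p) 𝓘(ℝ) ∞ f) : Smooth p U := ⟨f, hf⟩

theorem toSmooth_apply {U : Opens M₀} (f : U → ℝ) (hf : ContMDiff (𝓡 p) 𝓘(ℝ) ∞ f) (x : U) :
    toSmooth f hf x = f x := rfl

/-- Restriction of smooth functions to a smaller open subset. -/
def smoothRes {U V : Opens M₀} (h : V ≤ U) : Smooth p U →ₐ[ℝ] Smooth p V :=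
  { ContMDiffMap.restrictRingHom (𝓡 p) 𝓘(ℝ) ℝ h with
    commutes' := fun _ => rfl }

/-- The classical charts of `M₀`: the members of its maximal smooth atlas. -/
abbrev charts (p : ℕ) (M₀ : Type u) [TopologicalSpace M₀] [ChartedSpace (Model p) M₀] :
    Set (OpenPartialHomeomorph M₀ (Model p)) :=
  IsManifold.maximalAtlas (𝓡 p) ∞ M₀

/-- The `i`-th coordinate function of a chart with domain `U`. -/
def chartCoord {U : Opens M₀} (e : OpenPartialHomeomorph M₀ (Model p)) (he : e ∈ charts p M₀)
    (hU : e.source = U) (i : Fin p) : Smooth p U :=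
  toSmooth (fun x => e x i) <| by
    intro x
    have hx : (x : M₀) ∈ e.source := by rw [hU]; exact x.2
    have h1 : ContMDiffAt (𝓡 p) (𝓡 p) ∞ e (x : M₀) :=
      contMDiffAt_of_mem_maximalAtlas he hx
    have h2 : ContMDiffAt (𝓡 p) (𝓡 p) ∞ (fun y : U => e y) x := contMDiffAt_subtype_iff.2 h1
    exact ((EuclideanSpace.proj i : Model p →L[ℝ] ℝ).contDiff.contMDiff.contMDiffAt).comp x h2

/-- A function on `U`, read in a chart: `y ↦ g (e⁻¹ y)` on the range of the chart
(and `0` where `e⁻¹ y` is not in `U`). -/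
def inChart {U : Opens M₀} (e : OpenPartialHomeomorph M₀ (Model p)) (g : Smooth p U) :
    Model p → ℝ :=
  fun y => Function.extend (Subtype.val : U → M₀) g 0 (e.symm y)

theorem inChart_contDiffOn {U : Opens M₀} (e : OpenPartialHomeomorph M₀ (Model p))
    (he : e ∈ charts p M₀) (hU : e.source = U) (g : Smooth p U) :
    ContDiffOn ℝ ∞ (inChart e g) e.target := by
  rw [← contMDiffOn_iff_contDiffOn]
  intro y hy
  apply ContMDiffAt.contMDiffWithinAt
  have hmem : e.symm y ∈ (U : Set M₀) := hU ▸ e.map_target hy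
  have h1 : ContMDiffAt (𝓡 p) 𝓘(ℝ) ∞ (Function.extend (Subtype.val : U → M₀) g 0)
      ((⟨e.symm y, hmem⟩ : U) : M₀) := by
    rw [← contMDiffAt_subtype_iff]
    have : (fun x : U => Function.extend (Subtype.val : U → M₀) g 0 (x : M₀)) = g := by
      funext x
      exact Subtype.val_injective.extend_apply _ _ _
    rw [this]
    exact g.contMDiff _
  exact ContMDiffAt.comp y h1 (contMDiffAt_symm_of_mem_maximalAtlas he hy)

/-- The classical partial derivative `∂g/∂e_i` of `g ∈ C^∞(U)` in a chart `e` with domain `U`. -/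
def chartDeriv {U : Opens M₀} (e : OpenPartialHomeomorph M₀ (Model p)) (he : e ∈ charts p M₀)
    (hU : e.source = U) (i : Fin p) (g : Smooth p U) : Smooth p U :=
  toSmooth (fun x => fderiv ℝ (inChart e g) (e x) (EuclideanSpace.single i 1)) <| by
    intro x
    have hx : (x : M₀) ∈ e.source := by rw [hU]; exact x.2
    have h1 : ContMDiffAt (𝓡 p) (𝓡 p) ∞ (fun y : U => e y) x :=
      contMDiffAt_subtype_iff.2 (contMDiffAt_of_mem_maximalAtlas he hx)
    have h2 : ContDiffOn ℝ ∞ (fderiv ℝ (inChart e g)) e.target :=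
      (inChart_contDiffOn e he hU g).fderiv_of_isOpen e.open_target (by simp)
    have h3 : ContDiffAt ℝ ∞
        (fun y => fderiv ℝ (inChart e g) y (EuclideanSpace.single i 1)) (e x) :=
      (h2.contDiffAt (e.open_target.mem_nhds (e.map_source hx))).clm_apply contDiffAt_const
    exact ContMDiffAt.comp x h3.contMDiffAt h1

open Classical in
/-- The function `x ↦ sgn (g x)`, as a smooth function. It is smooth when `g` vanishes nowhere
(see `smoothSign_apply`), which is the only case in which it is used. -/
def smoothSign {U : Opens M₀} (g : Smooth p U) : Smooth p U :=
  if h : ContMDiff (𝓡 p) 𝓘(ℝ) ∞ (fun x : U => Real.sign (g x)) then toSmooth _ h else 0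

theorem smoothSign_apply {U : Opens M₀} (g : Smooth p U) (hg : ∀ x, g x ≠ 0) (x : U) :
    smoothSign g x = Real.sign (g x) := by
  have h : ContMDiff (𝓡 p) 𝓘(ℝ) ∞ (fun x : U => Real.sign (g x)) := by
    intro y
    have hc : ContinuousAt g y := g.contMDiff.continuous.continuousAt
    rcases lt_or_gt_of_ne (hg y) with hy | hy
    · refine (contMDiffAt_const (c := (-1 : ℝ))).congr_of_eventuallyEq ?_
      filter_upwards [hc.eventually (gt_mem_nhds hy)] with z hz
      exact Real.sign_of_neg hz
    · refine (contMDiffAt_const (c := (1 : ℝ))).congr_of_eventuallyEq ?_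
      filter_upwards [hc.eventually (lt_mem_nhds hy)] with z hz
      exact Real.sign_of_pos hz
  rw [smoothSign, dif_pos h, toSmooth_apply]

/-! ### Densities on the underlying manifold and their integral -/

/-- A smooth density `ρ ∈ |Ω^p|M₀`: in each chart `e` it reads `ρ = (val e) · |de|` on the domain
of `e` (the values of `val e` outside of it are irrelevant), and
`|de| = |det (∂e/∂e')| |de'|` on overlaps. -/
structure Density (p : ℕ) (M₀ : Type u) [TopologicalSpace M₀] [ChartedSpace (Model p) M₀] where
  val : OpenPartialHomeomorph M₀ (Model p) → M₀ → ℝ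
  smooth : ∀ e ∈ charts p M₀, ContMDiffOn (𝓡 p) 𝓘(ℝ) ∞ (val e) e.source
  change : ∀ e ∈ charts p M₀, ∀ e' ∈ charts p M₀, ∀ x ∈ e.source ∩ e'.source,
    val e' x = val e x * |(fderiv ℝ (fun y => e (e'.symm y)) (e' x)).det|

/-- A countable partition of `M₀` into Borel sets, each of them contained in the domain of a
chart. -/
structure ChartPartition (p : ℕ) (M₀ : Type u) [TopologicalSpace M₀]
    [ChartedSpace (Model p) M₀] where
  ι : Type u
  countable : Countable ι
  chart : ι → OpenPartialHomeomorph M₀ (Model p)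
  chart_mem : ∀ n, chart n ∈ charts p M₀
  piece : ι → Set M₀
  measurable : ∀ n, MeasurableSet[borel M₀] (piece n)
  subset : ∀ n, piece n ⊆ (chart n).source
  disjoint : Pairwise (Function.onFun Disjoint piece)
  cover : ⋃ n, piece n = Set.univ

/-- Every second countable manifold has such a partition. -/
theorem ChartPartition.nonempty (p : ℕ) (M₀ : Type u) [TopologicalSpace M₀]
    [SecondCountableTopology M₀] [ChartedSpace (Model p) M₀] [IsManifold (𝓡 p) ∞ M₀] :
    Nonempty (ChartPartition p M₀) := by
  obtain ⟨s, hs, hcov⟩ := TopologicalSpace.countable_cover_nhds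
    (f := fun x : M₀ => (chartAt (Model p) x).source) (fun x => chart_source_mem_nhds _ x)
  have : Countable s := hs.to_subtype
  obtain ⟨c, hc⟩ := exists_injective_nat s
  refine ⟨⟨s, this, fun n => chartAt (Model p) (n : M₀),
    fun n => IsManifold.chart_mem_maximalAtlas (n : M₀),
    fun n => (chartAt (Model p) (n : M₀)).source \
      ⋃ m : s, ⋃ _ : c m < c n, (chartAt (Model p) (m : M₀)).source, ?_, ?_, ?_, ?_⟩⟩
  · intro n
    let _ : MeasurableSpace M₀ := borel M₀
    have : BorelSpace M₀ := ⟨rfl⟩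
    have ho : IsOpen (⋃ m : s, ⋃ _ : c m < c n, (chartAt (Model p) (m : M₀)).source) :=
      isOpen_iUnion fun m => isOpen_iUnion fun _ => (chartAt (Model p) (m : M₀)).open_source
    exact (chartAt (Model p) (n : M₀)).open_source.measurableSet.diff ho.measurableSet
  · exact fun n => Set.sdiff_subset
  · have key : ∀ m n : s, c m < c n → Disjoint
        ((chartAt (Model p) (m : M₀)).source \
          ⋃ k : s, ⋃ _ : c k < c m, (chartAt (Model p) (k : M₀)).source)
        ((chartAt (Model p) (n : M₀)).source \
          ⋃ k : s, ⋃ _ : c k < c n, (chartAt (Model p) (k : M₀)).source) := by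
      intro m n hmn
      rw [Set.disjoint_left]
      intro x hx hx'
      exact hx'.2 (Set.mem_iUnion₂.2 ⟨m, hmn, hx.1⟩)
    intro m n hmn
    rcases lt_or_gt_of_ne (fun h => hmn (hc h)) with h | h
    · exact key m n h
    · exact (key n m h).symm
  · rw [Set.eq_univ_iff_forall]
    intro x
    have hx : x ∈ ⋃ y ∈ s, (chartAt (Model p) y).source := hcov ▸ Set.mem_univ x
    obtain ⟨y, hy, hxy⟩ := Set.mem_iUnion₂.1 hx
    have hex : ∃ k, ∃ n : s, c n = k ∧ x ∈ (chartAt (Model p) (n : M₀)).source :=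
      ⟨_, ⟨y, hy⟩, rfl, hxy⟩
    classical
    obtain ⟨n, hn, hxn⟩ := Nat.find_spec hex
    refine Set.mem_iUnion.2 ⟨n, hxn, fun hx' => ?_⟩
    obtain ⟨m, hm, hxm⟩ := Set.mem_iUnion₂.1 hx'
    exact Nat.find_min hex (hn ▸ hm) ⟨m, rfl, hxm⟩

/-- `ρ` is (absolutely) integrable on `M₀` and `∫_{M₀} ρ = I`: for every partition of `M₀` into
countably many Borel sets `A n` that lie in charts `e n`, the Lebesgue integrals of
`ρ = ρ_n |d(e n)|` over the sets `A n` exist and sum up, absolutely, to `I`. -/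
def Density.HasIntegral (ρ : Density p M₀) (I : ℝ) : Prop :=
  ∀ P : ChartPartition p M₀,
    (∀ n, IntegrableOn (fun y => ρ.val (P.chart n) ((P.chart n).symm y))
      (P.chart n '' P.piece n) volume) ∧
    Summable (fun n => ∫ y in P.chart n '' P.piece n,
      |ρ.val (P.chart n) ((P.chart n).symm y)|) ∧
    HasSum (fun n => ∫ y in P.chart n '' P.piece n,
      ρ.val (P.chart n) ((P.chart n).symm y)) I

end Classical

/-! ### Supermanifolds -/

/-- A sheaf of supercommutative real superalgebras on a topological space. -/
structure SuperalgebraSheaf (X : Type u) [TopologicalSpace X] where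
  /-- the sheaf of (ungraded) `ℝ`-algebras -/
  sheaf : TopCat.Sheaf (AlgCat.{u} ℝ) (TopCat.of X)
  /-- the even (`0`) and odd (`1`) sections over an open set -/
  parity : ∀ U : Opens X, ZMod 2 → Submodule ℝ (sheaf.presheaf.obj (op U))
  isCompl : ∀ U, IsCompl (parity U 0) (parity U 1)
  graded : ∀ U, SetLike.GradedMonoid (parity U)
  supercomm : ∀ (U : Opens X) (i j : ZMod 2) (a b : sheaf.presheaf.obj (op U)),
    a ∈ parity U i → b ∈ parity U j → a * b = (-1) ^ (i.val * j.val) * (b * a)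
  map_parity : ∀ {U V : Opens X} (h : V ≤ U) (i : ZMod 2) (a : sheaf.presheaf.obj (op U)),
    a ∈ parity U i → (sheaf.presheaf.map (homOfLE h).op).hom a ∈ parity V i

namespace SuperalgebraSheaf

variable {X : Type u} [TopologicalSpace X] (𝒪 : SuperalgebraSheaf X)

/-- The sections over an open subset. -/
abbrev Sec (U : Opens X) : Type u := 𝒪.sheaf.presheaf.obj (op U)

/-- Restriction of sections. -/
def res {U V : Opens X} (h : V ≤ U) : 𝒪.Sec U →ₐ[ℝ] 𝒪.Sec V :=
  (𝒪.sheaf.presheaf.map (homOfLE h).op).hom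

theorem res_res {U V W : Opens X} (h : V ≤ U) (h' : W ≤ V) (f : 𝒪.Sec U) :
    𝒪.res h' (𝒪.res h f) = 𝒪.res (h'.trans h) f := by
  have : 𝒪.sheaf.presheaf.map (homOfLE (h'.trans h)).op =
      𝒪.sheaf.presheaf.map (homOfLE h).op ≫ 𝒪.sheaf.presheaf.map (homOfLE h').op := by
    rw [← Functor.map_comp]; rfl
  simp only [res, this]
  rfl

end SuperalgebraSheaf

/-- The monomial `ξ^ν = ξ_1^{ν_1} ⋯ ξ_q^{ν_q}`, the factors in increasing order, for
`ν ∈ {0,1}^q`, given as the set of the indices `j` with `ν_j = 1`. -/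
def oddMonomial {R : Type*} [Ring R] {q : ℕ} (ξ : Fin q → R) (ν : Finset (Fin q)) : R :=
  (List.ofFn fun j => if j ∈ ν then ξ j else 1).prod

theorem map_oddMonomial {R S : Type*} [Ring R] [Ring S] [Algebra ℝ R] [Algebra ℝ S] {q : ℕ}
    (φ : R →ₐ[ℝ] S) (ξ : Fin q → R) (ν : Finset (Fin q)) :
    φ (oddMonomial ξ ν) = oddMonomial (fun j => φ (ξ j)) ν := by
  simp only [oddMonomial, map_list_prod, List.map_ofFn]
  congr 2
  funext j
  by_cases h : j ∈ ν <;> simp [h]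

/-- An isomorphism `C^∞_U ⊗ Λ(ℝ^q) ≅ 𝒪|_U` of sheaves of superalgebras over `U`. It is given by an
even morphism of sheaves of algebras `C^∞_U → 𝒪|_U` and by the odd sections `ξ_1, …, ξ_q` over `U`
to which the generators of `Λ(ℝ^q)` go; since even sections are central and odd ones
anticommute, these data amount to a morphism `C^∞_U ⊗ Λ(ℝ^q) → 𝒪|_U`, and it is an
isomorphism if and only if over each open `W ⊆ U` each section `f` has a unique decomposition
`f = ∑_ν pullback(f_ν) ξ^ν`, with `f_ν ∈ C^∞(W)`. -/
structure Splitting {p : ℕ} {M₀ : Type u} [TopologicalSpace M₀] [ChartedSpace (Model p) M₀]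
    (q : ℕ) (𝒪 : SuperalgebraSheaf M₀) (U : Opens M₀) where
  pullback : ∀ W : Opens M₀, W ≤ U → (Smooth p W →ₐ[ℝ] 𝒪.Sec W)
  pullback_even : ∀ W hW g, pullback W hW g ∈ 𝒪.parity W 0
  res_pullback : ∀ {V W : Opens M₀} (hW : W ≤ U) (h : V ≤ W) (g : Smooth p W),
    𝒪.res h (pullback W hW g) = pullback V (h.trans hW) (smoothRes h g)
  odd : Fin q → 𝒪.Sec U
  odd_mem : ∀ j, odd j ∈ 𝒪.parity U 1
  bijective : ∀ (W : Opens M₀) (hW : W ≤ U), Function.Bijective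
    (fun c : Finset (Fin q) → Smooth p W =>
      ∑ ν, pullback W hW (c ν) * oddMonomial (fun j => 𝒪.res hW (odd j)) ν)

/-- A real supermanifold of dimension `(p, q)` with underlying manifold `M₀`: a sheaf `𝒪` of
superalgebras on `M₀` that is locally isomorphic to `C^∞ ⊗ Λ(ℝ^q)`, together with the canonical
embedding `j : M₀ → M`, that is, the morphism `j^* : 𝒪 → C^∞` of sheaves of algebras over the
identity of `M₀` (it is unique: over an open set with a splitting it has to kill the odd sections
and to invert the pullback of functions, see `Supermanifold.body_pullback`). -/
structure Supermanifold (p q : ℕ) (M₀ : Type u) [TopologicalSpace M₀]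
    [ChartedSpace (Model p) M₀] extends SuperalgebraSheaf M₀ where
  body : ∀ U : Opens M₀, toSuperalgebraSheaf.Sec U →ₐ[ℝ] Smooth p U
  body_res : ∀ {U V : Opens M₀} (h : V ≤ U) (f : toSuperalgebraSheaf.Sec U),
    body V (toSuperalgebraSheaf.res h f) = smoothRes h (body U f)
  locally_split : ∀ x : M₀, ∃ U : Opens M₀, x ∈ U ∧
    Nonempty (Splitting (p := p) q toSuperalgebraSheaf U)

namespace Supermanifold

variable {p q : ℕ} {M₀ : Type u} [TopologicalSpace M₀] [ChartedSpace (Model p) M₀]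

/-- The superfunctions on the open subspace `U` of `M`. -/
abbrev Sec (M : Supermanifold p q M₀) (U : Opens M₀) : Type u := M.toSuperalgebraSheaf.Sec U

theorem body_pullback (M : Supermanifold p q M₀) {U : Opens M₀}
    (σ : Splitting (p := p) q M.toSuperalgebraSheaf U) (W : Opens M₀) (hW : W ≤ U)
    (g : Smooth p W) : M.body W (σ.pullback W hW g) = g := by
  ext x
  by_contra hne
  set d : ℝ := M.body W (σ.pullback W hW g) x with hd
  have hopen : IsOpen (Subtype.val '' {y : W | g y ≠ d}) :=
    W.isOpen.isOpenMap_subtype_val _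
      (isOpen_ne_fun g.contMDiff.continuous continuous_const)
  let V : Opens M₀ := ⟨_, hopen⟩
  have hV : V ≤ W := by
    rintro _ ⟨y, _, rfl⟩
    exact y.2
  have hxV : (x : M₀) ∈ V := ⟨x, fun h => hne h.symm, rfl⟩
  let k : Smooth p V := smoothRes hV g - algebraMap ℝ _ d
  have hk : ∀ y, k y ≠ 0 := by
    rintro ⟨_, y, hy, rfl⟩
    exact sub_ne_zero.2 hy
  let l : Smooth p V := ⟨fun y => (k y)⁻¹, fun y => (k.contMDiff y).inv₀ (hk y)⟩
  have hkl : k * l = 1 := by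
    ext y
    exact mul_inv_cancel₀ (hk y)
  have h1 := congrArg (fun a => M.body V (σ.pullback V (hV.trans hW) a)) hkl
  simp only [map_mul, map_one] at h1
  have h2 : M.body V (σ.pullback V (hV.trans hW) k) ⟨x, hxV⟩ = 0 := by
    have : M.body V (σ.pullback V (hV.trans hW) k) =
        smoothRes hV (M.body W (σ.pullback W hW g)) - algebraMap ℝ _ d := by
      simp only [k, map_sub, AlgHom.commutes]
      rw [← σ.res_pullback, M.body_res]
    rw [this]
    exact sub_self _
  have h3 := congrArg (fun a : Smooth p V => a ⟨x, hxV⟩) h1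
  change M.body V (σ.pullback V (hV.trans hW) k) ⟨x, hxV⟩ * _ = (1 : ℝ) at h3
  rw [h2, zero_mul] at h3
  exact zero_ne_one h3

/-- A retraction `γ : M → M₀`, a morphism of supermanifolds with `γ ∘ j = id`. The underlying
map of such a `γ` is the identity of `M₀`, so that `γ` is a morphism `γ^* : C^∞ → 𝒪` of sheaves
of superalgebras on `M₀` (`C^∞` is purely even), with `j^* ∘ γ^* = id`. -/
structure Retraction (M : Supermanifold p q M₀) where
  pullback : ∀ U : Opens M₀, Smooth p U →ₐ[ℝ] M.Sec U
  pullback_even : ∀ U g, pullback U g ∈ M.parity U 0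
  res_pullback : ∀ {U V : Opens M₀} (h : V ≤ U) (g : Smooth p U),
    M.res h (pullback U g) = pullback V (smoothRes h g)
  body_pullback : ∀ U g, M.body U (pullback U g) = g

/-- A coordinate system `x = (u, ξ)` on the open subspace `U`: an isomorphism of `M|_U` with an
open subspace of `ℝ^{p|q}`, given by a classical chart `u₀` with domain `U` and a
splitting. The even coordinates are `u_i = pullback (u₀)_i`, the odd ones `ξ_j = odd j`. -/
structure CoordSystem (M : Supermanifold p q M₀) (U : Opens M₀) extends
    Splitting (p := p) q M.toSuperalgebraSheaf U where
  chart : OpenPartialHomeomorph M₀ (Model p)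
  chart_mem : chart ∈ charts p M₀
  source_eq : chart.source = U

namespace CoordSystem

variable {M : Supermanifold p q M₀} {U : Opens M₀}

/-- The restriction of a coordinate system to a smaller open subspace. -/
def restrict (x : M.CoordSystem U) (V : Opens M₀) (h : V ≤ U) : M.CoordSystem V where
  pullback W hW := x.pullback W (hW.trans h)
  pullback_even W hW g := x.pullback_even W (hW.trans h) g
  res_pullback hW h' g := x.res_pullback (hW.trans h) h' g
  odd j := M.res h (x.odd j)
  odd_mem j := M.map_parity h 1 _ (x.odd_mem j)
  bijective W hW := by
    simp only [SuperalgebraSheaf.res_res]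
    exact x.bijective W (hW.trans h)
  chart := x.chart.restr V
  chart_mem := restr_mem_maximalAtlas (contDiffGroupoid ∞ (𝓡 p)) x.chart_mem V.isOpen
  source_eq := by
    rw [OpenPartialHomeomorph.restr_source' _ _ V.isOpen, x.source_eq]
    exact Set.inter_eq_right.2 h

/-- The even coordinate functions `u_i`. -/
def even (x : M.CoordSystem U) (i : Fin p) : M.Sec U :=
  x.pullback U le_rfl (chartCoord x.chart x.chart_mem x.source_eq i)

/-- The monomial `ξ^ν` in the odd coordinates. -/
def monomial (x : M.CoordSystem U) (ν : Finset (Fin q)) : M.Sec U := oddMonomial x.odd ν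

/-- The coefficients `f_ν` in the decomposition `f = ∑_ν γ^*(f_ν) ξ^ν` of a superfunction on `U`,
where `γ` is the retraction associated with `x`. -/
def coeff (x : M.CoordSystem U) (f : M.Sec U) : Finset (Fin q) → Smooth p U :=
  (Equiv.ofBijective _ (x.bijective U le_rfl)).symm f

theorem sum_coeff (x : M.CoordSystem U) (f : M.Sec U) :
    ∑ ν, x.pullback U le_rfl (x.coeff f ν) * x.monomial ν = f := by
  have h := (Equiv.ofBijective _ (x.bijective U le_rfl)).apply_symm_apply f
  have hid : ∀ a : M.Sec U, M.res (le_refl U) a = a := by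
    intro a
    have : M.sheaf.presheaf.map (homOfLE (le_refl U)).op = 𝟙 _ :=
      M.sheaf.presheaf.map_id (op U)
    simp only [SuperalgebraSheaf.res, this]
    rfl
  have hodd : (fun j => M.res (le_refl U) (x.odd j)) = x.odd := funext fun j => hid _
  refine Eq.trans (Finset.sum_congr rfl fun ν _ => ?_) h
  change _ = x.pullback U le_rfl (x.coeff f ν) *
    oddMonomial (fun j => M.res (le_refl U) (x.odd j)) ν
  rw [hodd]
  rfl

/-- The derivation `∂/∂u_i`: `f ↦ ∑_ν γ^*(∂f_ν/∂(u₀)_i) ξ^ν`. -/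
def derivEven (x : M.CoordSystem U) (i : Fin p) (f : M.Sec U) : M.Sec U :=
  ∑ ν, x.pullback U le_rfl (chartDeriv x.chart x.chart_mem x.source_eq i (x.coeff f ν)) *
    x.monomial ν

/-- The derivation `∂/∂ξ_j`:
`f ↦ ∑_{ν, ν_j = 1} γ^*(f_ν) ξ^{ν - e_j} (-1)^{ν_1 + ⋯ + ν_{j-1}}`. -/
def derivOdd (x : M.CoordSystem U) (j : Fin q) (f : M.Sec U) : M.Sec U :=
  ∑ ν with j ∈ ν, (-1) ^ (ν.filter (· < j)).card *
    (x.pullback U le_rfl (x.coeff f ν) * x.monomial (ν.erase j))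

end CoordSystem

end Supermanifold

/-! ### Berezin densities -/

/-- The determinant of a matrix with pairwise commuting entries in a ring, by the Leibniz
formula. It is applied to matrices of even sections only. -/
def leibnizDet {R : Type*} [Ring R] {n : ℕ} (A : Matrix (Fin n) (Fin n) R) : R :=
  ∑ σ : Equiv.Perm (Fin n),
    ((Equiv.Perm.sign σ : ℤ) : R) * (List.ofFn fun i => A (σ i) i).prod

theorem leibnizDet_eq_det {R : Type*} [CommRing R] {n : ℕ} (A : Matrix (Fin n) (Fin n) R) :
    leibnizDet A = A.det := by
  simp [leibnizDet, Matrix.det_apply', List.prod_ofFn]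

/-- The Berezinian `det (R - S V⁻¹ T) · det V⁻¹` of an even supermatrix with blocks `R, S, T, V`,
where `R` and `V` have even entries, `S` and `T` odd ones, and `V` is invertible. -/
def berezinian {A : Type*} [Ring A] {p q : ℕ} (R : Matrix (Fin p) (Fin p) A)
    (S : Matrix (Fin p) (Fin q) A) (T : Matrix (Fin q) (Fin p) A)
    (V : Matrix (Fin q) (Fin q) A) : A :=
  leibnizDet (R - S * Ring.inverse V * T) * leibnizDet (Ring.inverse V)

namespace Supermanifold

variable {p q : ℕ} {M₀ : Type u} [TopologicalSpace M₀] [ChartedSpace (Model p) M₀]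

namespace CoordSystem

variable {M : Supermanifold p q M₀} {U : Opens M₀}

/-- The block `∂u/∂v` of the matrix `∂x/∂y`, for `x = (u, ξ)` and `y = (v, η)`: rows are indexed
by the coordinates `y`, columns by the coordinates `x`. -/
def jacEvenEven (x y : M.CoordSystem U) : Matrix (Fin p) (Fin p) (M.Sec U) :=
  Matrix.of fun i j => y.derivEven i (x.even j)

/-- The Berezinian `Ber (∂x/∂y)` of the coordinate change, where
`∂x/∂y` has the blocks `∂u/∂v`, `∂ξ/∂v`, `∂u/∂η`, `∂ξ/∂η`. -/
def ber (x y : M.CoordSystem U) : M.Sec U :=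
  berezinian (jacEvenEven x y)
    (Matrix.of fun i b => y.derivEven i (x.odd b))
    (Matrix.of fun a j => y.derivOdd a (x.even j))
    (Matrix.of fun a b => y.derivOdd a (x.odd b))

/-- `|Ber| (∂x/∂y) = sgn (j^* det (∂u/∂v)) · Ber (∂x/∂y)`. -/
def absBer (x y : M.CoordSystem U) : M.Sec U :=
  y.pullback U le_rfl (smoothSign (M.body U (leibnizDet (jacEvenEven x y)))) * ber x y

end CoordSystem

/-- A Berezin density `β` on `M`, that is, a global section of the sheaf `|Ber|_M`: for each
coordinate system `x` on an open subspace `U` it has the form `β|_U = (val U x) |Dx|`, with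
`|Dx| = |Ber| (∂x/∂y) |Dy|`, compatibly with restrictions. -/
structure BerezinDensity (M : Supermanifold p q M₀) where
  val : ∀ U : Opens M₀, M.CoordSystem U → M.Sec U
  val_restrict : ∀ {U V : Opens M₀} (h : V ≤ U) (x : M.CoordSystem U),
    val V (x.restrict V h) = M.res h (val U x)
  change : ∀ {U : Opens M₀} (x y : M.CoordSystem U), val U y = val U x * x.absBer y

/-- The coordinate system `x` on `U` has `γ` as its associated retraction. -/
def CoordSystem.IsAdapted {M : Supermanifold p q M₀} {U : Opens M₀} (x : M.CoordSystem U)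
    (γ : M.Retraction) : Prop :=
  ∀ (W : Opens M₀) (hW : W ≤ U), x.pullback W hW = γ.pullback W

namespace BerezinDensity

variable {M : Supermanifold p q M₀} (β : M.BerezinDensity)

/-- `β` vanishes on the open subspace `W`. -/
def VanishesOn (W : Opens M₀) : Prop :=
  ∀ U : Opens M₀, U ≤ W → ∀ x : M.CoordSystem U, β.val U x = 0

/-- The support of `β`: the points without an open neighbourhood on which `β` vanishes. -/
def support : Set M₀ := {x | ∀ W : Opens M₀, x ∈ W → ¬ β.VanishesOn W}

/-- The density `ρ` on `M₀` is the fibre integral `γ_!(β)`, where the sign convention of the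
Berezin integral in dimension `(p, q)` is `(-1)^{s(p,q)}`: on each coordinate neighbourhood `U`
with a coordinate system `x = (u, ξ)` with associated retraction `γ`, for `β|_U = f |Dx|` one has
`ρ = (-1)^{s(p,q)} f_{(1,…,1)} |du₀|`. -/
def IsFibreIntegral (s : ℕ → ℕ → ℕ) (γ : M.Retraction) (ρ : Density p M₀) : Prop :=
  ∀ (U : Opens M₀) (x : M.CoordSystem U), x.IsAdapted γ → ∀ o : U,
    ρ.val x.chart o = (-1) ^ s p q * x.coeff (β.val U x) Finset.univ o

/-- `β` is integrable with respect to `γ`, with `∫_{(M,γ)} β = ∫_{M₀} γ_!(β) = I`. -/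
def HasIntegral (s : ℕ → ℕ → ℕ) (γ : M.Retraction) (I : ℝ) : Prop :=
  ∃ ρ : Density p M₀, β.IsFibreIntegral s γ ρ ∧ ρ.HasIntegral I

/-- `β` is integrable with respect to `γ`. -/
def IsIntegrable (s : ℕ → ℕ → ℕ) (γ : M.Retraction) : Prop := ∃ I, β.HasIntegral s γ I

open Classical in
/-- The integral `∫_{(M,γ)} β` of a Berezin density that is integrable with respect to `γ`. -/
def integral (s : ℕ → ℕ → ℕ) (γ : M.Retraction) : ℝ :=
  if h : β.IsIntegrable s γ then h.choose else 0

end BerezinDensity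

end Supermanifold

end Supergeometry

end

/-! The support is compact, so a partition of unity reduces the claim to Berezin densities with
compact support in one coordinate neighbourhood. The cut-off functions on `M₀` are made
superfunctions by one fixed retraction `γ₀`, whichever retraction `γ` is used for integration. Hence
the pieces do not depend on `γ`, and it suffices that the integral of each piece is independent of
`γ`. This is `exists_isFibreIntegral_and_hasIntegral`.

Let `x = (u, ξ)` be coordinates on `U`. They become adapted to `γ` by replacing `u_1, …, u_p` one
after the other by the pullbacks of their underlying functions along `γ`, with `ξ` unchanged. Each
step is a shift `u_i ↦ u_i + m` with `m` even and of body zero, hence nilpotent. A function `g` is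
then pulled back to the finite Taylor sum of the terms `(∂_i^n g / n!) m^n`, and the Berezinian of
the shift is `1 + ∂_i m`. The identity `(∑ D^n a / n! · m^n) (1 + D m) = a + D (∑ D^n a / (n+1)! ·
m^(n+1))` (`sum_divPow_mul_pow_mul_one_add`) shows that the top coefficient of the density changes
by a partial derivative of a function with compact support in `U`, which integrates to zero
(`berezinIntegral_shift`). After `p` shifts the even coordinates are pullbacks along `γ`. By
Hadamard's lemma a retraction is determined by the pullbacks of the coordinate functions, so the new
coordinates are adapted to `γ` (`isAdapted_of_even_eq`), and the integral of the fibre integral can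
be read off in them.

The fibre integral must also be shown to exist. For two coordinate systems with the same retraction
the block `∂u/∂η` vanishes, and the Berezinian is the classical Jacobian times `det (∂η/∂ξ)`. So the
claim is that `a ↦ a · det (∂η/∂ξ)` carries the top coefficient in `ξ` to the top coefficient in `η`
(`Compatible.top_mul_det`). The functional on the `η` side kills the derivatives `∂/∂ξ_b`, by an odd
analogue of the Piola identity, and every monomial except the top one is such a derivative. Its
value on the top monomial is a computation with linear parts.

The algebra takes place in `GrassmannFrame`, a ring presented as a Grassmann algebra over a central
subring. The main tools are its degree filtration `fil`, which vanishes beyond degree `q`, and its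
commutative ring of even elements, over which determinants make sense. -/

noncomputable section

namespace Supergeometry

/-! ### Odd monomials -/

section Monomials

variable {A : Type*} [Ring A]

/-- The elements `i` of `ν` that are smaller than `j`. -/
abbrev below {q : ℕ} (ν : Finset (Fin q)) (j : Fin q) : Finset (Fin q) := ν.filter (· < j)

/-- The set of the indices `i` with `i + 1 ∈ ν`. -/
def tailIdx {q : ℕ} (ν : Finset (Fin (q + 1))) : Finset (Fin q) :=
  Finset.univ.filter fun i => i.succ ∈ ν

theorem oddMonomial_succ {q : ℕ} (ξ : Fin (q + 1) → A) (ν : Finset (Fin (q + 1))) :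
    oddMonomial ξ ν =
      (if 0 ∈ ν then ξ 0 else 1) * oddMonomial (fun i => ξ i.succ) (tailIdx ν) := by
  simp [oddMonomial, List.ofFn_succ, tailIdx]

theorem oddMonomial_empty {q : ℕ} (ξ : Fin q → A) : oddMonomial ξ ∅ = 1 := by
  induction q with
  | zero => simp [oddMonomial]
  | succ q ih => simpa [oddMonomial_succ, tailIdx] using ih _

theorem card_below_succ {q : ℕ} (ν : Finset (Fin (q + 1))) (k : Fin q) :
    (below ν k.succ).card = (if 0 ∈ ν then 1 else 0) + (below (tailIdx ν) k).card := by
  have h1 : below ν k.succ = Finset.univ.filter (fun i => i ∈ ν ∧ i < k.succ) := by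
    ext; simp [below]
  have h2 : below (tailIdx ν) k = Finset.univ.filter (fun i => i.succ ∈ ν ∧ i < k) := by
    ext; simp [below, tailIdx]
  rw [h1, h2, Fin.card_filter_univ_succ]
  by_cases h : (0 : Fin (q + 1)) ∈ ν
  · simp [h, add_comm]
  · simp [h]

/-- Left multiplication of a monomial by an anticommuting generator. -/
theorem gen_mul_oddMonomial {q : ℕ} (ξ : Fin q → A) (hc : ∀ i j, ξ i * ξ j = -(ξ j * ξ i))
    (hs : ∀ i, ξ i * ξ i = 0) (j : Fin q) (ν : Finset (Fin q)) :
    ξ j * oddMonomial ξ ν =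
      if j ∈ ν then 0 else (-1 : ℤ) ^ (below ν j).card • oddMonomial ξ (insert j ν) := by
  induction q with
  | zero => exact j.elim0
  | succ q ih =>
    refine Fin.cases ?_ (fun k => ?_) j
    · by_cases h0 : (0 : Fin (q + 1)) ∈ ν
      · rw [oddMonomial_succ]
        simp [h0, ← mul_assoc, hs]
      · have : tailIdx (insert 0 ν) = tailIdx ν := by
          ext i; simp [tailIdx]
        rw [oddMonomial_succ, oddMonomial_succ ξ (insert 0 ν), this]
        simp [h0, below]
    · have hk := ih (fun i => ξ i.succ) (fun i j => hc _ _) (fun i => hs _) k (tailIdx ν)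
      have ht : tailIdx (insert k.succ ν) = insert k (tailIdx ν) := by
        ext i; simp [tailIdx]
      have hm : k ∈ tailIdx ν ↔ k.succ ∈ ν := by simp [tailIdx]
      have h0 : (0 : Fin (q + 1)) ∈ insert k.succ ν ↔ 0 ∈ ν := by
        simp [(Fin.succ_ne_zero k).symm]
      rw [oddMonomial_succ, oddMonomial_succ ξ (insert k.succ ν), ht, card_below_succ]
      simp only [h0]
      simp only [hm] at hk
      by_cases h0 : (0 : Fin (q + 1)) ∈ ν
      · simp only [h0, if_true]
        -- Moving the generator past `ξ 0` costs the sign which the first summand of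
        -- `card_below_succ` counts.
        rw [← mul_assoc, hc, neg_mul, mul_assoc, hk]
        split_ifs
        · simp
        · rw [pow_add, mul_smul_comm]; simp
      · simp only [h0, if_false, one_mul, hk]
        simp

end Monomials

/-! ### Rings with a Grassmann frame -/

/-- A presentation of the ring `A` as the Grassmann algebra over its central subring `C` in the
generators `gen 0, …, gen (q - 1)`. -/
structure GrassmannFrame (q : ℕ) (C A : Type*) [CommRing C] [Ring A] where
  incl : C →+* A
  gen : Fin q → A
  incl_comm : ∀ c a, incl c * a = a * incl c
  gen_anti : ∀ i j, gen i * gen j = -(gen j * gen i)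
  gen_sq : ∀ i, gen i * gen i = 0
  bijective : Function.Bijective fun c : Finset (Fin q) → C =>
    ∑ ν, incl (c ν) * oddMonomial gen ν

namespace GrassmannFrame

variable {q : ℕ} {C A : Type*} [CommRing C] [Ring A] (x : GrassmannFrame q C A)

/-- The monomials in the generators. -/
def mono (ν : Finset (Fin q)) : A := oddMonomial x.gen ν

/-- The expansion `c ↦ ∑_ν c_ν ξ^ν`. -/
def expand : (Finset (Fin q) → C) ≃+ A :=
  AddEquiv.ofBijective
    (AddMonoidHom.mk' (fun c => ∑ ν, x.incl (c ν) * x.mono ν) fun a b => by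
      simp [add_mul, Finset.sum_add_distrib]) x.bijective

theorem expand_apply (c : Finset (Fin q) → C) : x.expand c = ∑ ν, x.incl (c ν) * x.mono ν := rfl

/-- The coefficient of `ξ^ν`. -/
def coeff (ν : Finset (Fin q)) : A →+ C :=
  (Pi.evalAddMonoidHom _ ν).comp (x.expand.symm : A →+ (Finset (Fin q) → C))

theorem coeff_expand (c : Finset (Fin q) → C) (ν : Finset (Fin q)) :
    x.coeff ν (x.expand c) = c ν := by
  simp [coeff]

theorem coeff_sum (c : Finset (Fin q) → C) (ν : Finset (Fin q)) :
    x.coeff ν (∑ μ, x.incl (c μ) * x.mono μ) = c ν := x.coeff_expand c ν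

theorem sum_coeff (a : A) : ∑ ν, x.incl (x.coeff ν a) * x.mono ν = a :=
  x.expand.apply_symm_apply a

theorem ext_coeff {a b : A} (h : ∀ ν, x.coeff ν a = x.coeff ν b) : a = b := by
  rw [← x.sum_coeff a, ← x.sum_coeff b]
  simp [h]

theorem coeff_incl_mul_mono (c : C) (μ ν : Finset (Fin q)) :
    x.coeff ν (x.incl c * x.mono μ) = if ν = μ then c else 0 := by
  have : x.incl c * x.mono μ = x.expand (Pi.single μ c) := by
    rw [expand_apply, Finset.sum_eq_single μ]
    · simp
    · intro b _ hb; simp [Pi.single_eq_of_ne hb]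
    · simp
  rw [this, coeff_expand, Pi.single_apply]

theorem mono_empty : x.mono ∅ = 1 := oddMonomial_empty _

theorem coeff_incl (c : C) (ν : Finset (Fin q)) :
    x.coeff ν (x.incl c) = if ν = ∅ then c else 0 := by
  simpa [mono_empty] using x.coeff_incl_mul_mono c ∅ ν

theorem coeff_mono (μ ν : Finset (Fin q)) :
    x.coeff ν (x.mono μ) = if ν = μ then 1 else 0 := by
  simpa using x.coeff_incl_mul_mono 1 μ ν

theorem coeff_incl_mul (c : C) (a : A) (ν : Finset (Fin q)) :
    x.coeff ν (x.incl c * a) = c * x.coeff ν a := by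
  conv_lhs => rw [← x.sum_coeff a, Finset.mul_sum]
  simp only [← mul_assoc, ← map_mul]
  exact x.coeff_sum (fun μ => c * x.coeff μ a) ν

theorem gen_mul_mono (j : Fin q) (ν : Finset (Fin q)) : x.gen j * x.mono ν =
    if j ∈ ν then 0 else (-1 : ℤ) ^ (below ν j).card • x.mono (insert j ν) :=
  gen_mul_oddMonomial x.gen x.gen_anti x.gen_sq j ν

/-- The factor with the smallest index is the leftmost one, so no sign appears. Inductions on
monomials therefore use `Finset.induction_on_min`. -/
theorem mono_insert_of_lt (j : Fin q) (ν : Finset (Fin q)) (h : ∀ i ∈ ν, j < i) :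
    x.mono (insert j ν) = x.gen j * x.mono ν := by
  have hj : j ∉ ν := fun hj => lt_irrefl _ (h j hj)
  have hb : below ν j = ∅ := Finset.filter_eq_empty_iff.2 fun i hi => not_lt.2 (h i hi).le
  simp [gen_mul_mono, hj, hb]

theorem mono_singleton (j : Fin q) : x.mono {j} = x.gen j := by
  simpa [mono_empty] using x.mono_insert_of_lt j ∅ (by simp)

/-- A property of the elements of `A` holds if it is inherited by sums and by products with
constants and generators. -/
@[elab_as_elim]
theorem induction {P : A → Prop} (h1 : P 1) (hadd : ∀ a b, P a → P b → P (a + b))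
    (hincl : ∀ c a, P a → P (x.incl c * a)) (hgen : ∀ j a, P a → P (x.gen j * a)) (a : A) :
    P a := by
  have hm : ∀ ν, P (x.mono ν) := by
    intro ν
    induction ν using Finset.induction_on_min with
    | empty => rw [mono_empty]; exact h1
    | insert j s hj ih => rw [x.mono_insert_of_lt j s hj]; exact hgen _ _ ih
  have h0 : P 0 := by simpa using hincl 0 1 h1
  rw [← x.sum_coeff a]
  exact Finset.sum_induction _ P hadd h0 fun ν _ => hincl _ _ (hm ν)

/-- The value of the sign does not matter for the filtration: degrees add up unless an index is
repeated, and then the product vanishes. -/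
theorem mono_mul_mono (μ ν : Finset (Fin q)) :
    ∃ ε : ℤ, x.mono μ * x.mono ν = ε • x.mono (μ ∪ ν) ∧ (¬ Disjoint μ ν → ε = 0) := by
  induction μ using Finset.induction_on_min with
  | empty => exact ⟨1, by simp [mono_empty], by simp⟩
  | insert j s hj ih =>
    obtain ⟨ε, h, hε⟩ := ih
    have hjs : j ∉ s := fun h => lt_irrefl _ (hj j h)
    rw [x.mono_insert_of_lt j s hj, mul_assoc, h, mul_smul_comm, gen_mul_mono]
    by_cases hjm : j ∈ s ∪ ν
    · refine ⟨0, by simp [hjm], fun _ => rfl⟩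
    · refine ⟨ε * (-1) ^ (below (s ∪ ν) j).card, by simp [hjm, mul_smul], fun hd => ?_⟩
      have : ¬ Disjoint s ν := by
        intro hd'
        apply hd
        rw [Finset.disjoint_insert_left]
        exact ⟨fun h => hjm (Finset.mem_union_right _ h), hd'⟩
      simp [hε this]

/-! #### The degree filtration -/

/-- The elements all of whose terms have degree at least `k`. -/
def fil (k : ℕ) : AddSubgroup A where
  carrier := {a | ∀ ν : Finset (Fin q), ν.card < k → x.coeff ν a = 0}
  zero_mem' := by simp
  add_mem' := by
    intro a b ha hb ν hν
    simp [ha ν hν, hb ν hν]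
  neg_mem' := by
    intro a ha ν hν
    simp [ha ν hν]

theorem fil_mono {k l : ℕ} (h : k ≤ l) : x.fil l ≤ x.fil k :=
  fun _ ha ν hν => ha ν (hν.trans_le h)

theorem mem_fil_zero (a : A) : a ∈ x.fil 0 := fun _ h => absurd h (Nat.not_lt_zero _)

/-- There are only `q` generators. The nilpotency arguments on the filtration end here. -/
theorem eq_zero_of_mem_fil {k : ℕ} (hk : q < k) {a : A} (h : a ∈ x.fil k) : a = 0 := by
  apply x.ext_coeff
  intro ν
  rw [map_zero]
  refine h ν (lt_of_le_of_lt ?_ hk)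
  simpa using Finset.card_le_univ ν

theorem incl_mul_mem_fil {k : ℕ} (c : C) {a : A} (h : a ∈ x.fil k) : x.incl c * a ∈ x.fil k :=
  fun ν hν => by rw [coeff_incl_mul, h ν hν, mul_zero]

theorem mono_mem_fil {k : ℕ} {ν : Finset (Fin q)} (h : k ≤ ν.card) : x.mono ν ∈ x.fil k := by
  intro μ hμ
  rw [coeff_mono, if_neg]
  rintro rfl
  exact absurd h (not_le.2 hμ)

theorem mul_mem_fil {k l : ℕ} {a b : A} (ha : a ∈ x.fil k) (hb : b ∈ x.fil l) :
    a * b ∈ x.fil (k + l) := by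
  rw [← x.sum_coeff a, ← x.sum_coeff b, Finset.sum_mul_sum]
  refine sum_mem fun μ _ => sum_mem fun ν _ => ?_
  by_cases hμ : μ.card < k
  · simp [ha μ hμ]
  by_cases hν : ν.card < l
  · simp [hb ν hν]
  have : x.incl (x.coeff μ a) * x.mono μ * (x.incl (x.coeff ν b) * x.mono ν) =
      x.incl (x.coeff μ a * x.coeff ν b) * (x.mono μ * x.mono ν) := by
    rw [map_mul, mul_assoc, ← mul_assoc (x.mono μ), ← x.incl_comm]
    simp only [mul_assoc]
  rw [this]
  obtain ⟨ε, h, hε⟩ := x.mono_mul_mono μ ν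
  rw [h]
  by_cases hd : Disjoint μ ν
  · refine x.incl_mul_mem_fil _ (zsmul_mem (x.mono_mem_fil ?_) _)
    rw [Finset.card_union_of_disjoint hd]
    omega
  · simp [hε hd]

theorem mul_mem_fil_left {k : ℕ} {a : A} (b : A) (ha : a ∈ x.fil k) : b * a ∈ x.fil k := by
  simpa using x.mul_mem_fil (x.mem_fil_zero b) ha

theorem mul_mem_fil_right {k : ℕ} {a : A} (b : A) (ha : a ∈ x.fil k) : a * b ∈ x.fil k := by
  simpa using x.mul_mem_fil ha (x.mem_fil_zero b)

theorem pow_mem_fil {a : A} (ha : a ∈ x.fil 1) (n : ℕ) : a ^ n ∈ x.fil n := by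
  induction n with
  | zero => exact x.mem_fil_zero _
  | succ n ih => rw [pow_succ]; exact x.mul_mem_fil ih ha

theorem sub_incl_coeff_empty_mem_fil (a : A) : a - x.incl (x.coeff ∅ a) ∈ x.fil 1 := by
  intro ν hν
  have : ν = ∅ := by simpa using hν
  simp [this, coeff_incl]

/-- The term of degree `0`. -/
def body : A →+* C where
  toFun := x.coeff ∅
  map_one' := by simpa using x.coeff_incl 1 ∅
  map_zero' := map_zero _
  map_add' := map_add _
  map_mul' a b := by
    have h : a * b - x.incl (x.coeff ∅ a * x.coeff ∅ b) ∈ x.fil 1 := by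
      have : a * b - x.incl (x.coeff ∅ a * x.coeff ∅ b) = (a - x.incl (x.coeff ∅ a)) * b +
          x.incl (x.coeff ∅ a) * (b - x.incl (x.coeff ∅ b)) := by
        rw [map_mul]; noncomm_ring
      rw [this]
      exact add_mem (x.mul_mem_fil_right _ (x.sub_incl_coeff_empty_mem_fil a))
        (x.mul_mem_fil_left _ (x.sub_incl_coeff_empty_mem_fil b))
    have := h ∅ (by simp)
    rw [map_sub, coeff_incl, if_pos rfl, sub_eq_zero] at this
    exact this

theorem body_apply (a : A) : x.body a = x.coeff ∅ a := rfl

theorem mem_fil_one_iff {a : A} : a ∈ x.fil 1 ↔ x.body a = 0 := by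
  refine ⟨fun h => h ∅ (by simp), fun h ν hν => ?_⟩
  have : ν = ∅ := by simpa using hν
  rw [this]; exact h

/-! #### The grading involution -/

/-- The grading involution `ξ_j ↦ -ξ_j`. -/
def invol : A →+ A :=
  AddMonoidHom.mk' (fun a => ∑ ν : Finset (Fin q), (-1 : ℤ) ^ ν.card • (x.incl (x.coeff ν a) * x.mono ν))
    fun a b => by simp [add_mul, Finset.sum_add_distrib, smul_add]

theorem invol_apply (a : A) :
    x.invol a = ∑ ν : Finset (Fin q), (-1 : ℤ) ^ ν.card • (x.incl (x.coeff ν a) * x.mono ν) := rfl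

theorem coeff_invol (a : A) (ν : Finset (Fin q)) :
    x.coeff ν (x.invol a) = (-1) ^ ν.card * x.coeff ν a := by
  have : x.invol a = ∑ ν : Finset (Fin q), x.incl ((-1) ^ ν.card * x.coeff ν a) * x.mono ν := by
    rw [invol_apply]
    refine Finset.sum_congr rfl fun ν _ => ?_
    rcases Nat.even_or_odd ν.card with h | h <;> simp [h.neg_one_pow]
  rw [this, coeff_sum]

theorem invol_incl_mul (c : C) (a : A) : x.invol (x.incl c * a) = x.incl c * x.invol a := by
  apply x.ext_coeff
  intro ν
  simp only [coeff_invol, coeff_incl_mul]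
  ring

theorem invol_mono (ν : Finset (Fin q)) : x.invol (x.mono ν) = (-1 : ℤ) ^ ν.card • x.mono ν := by
  apply x.ext_coeff
  intro μ
  rw [coeff_invol, map_zsmul, coeff_mono]
  split_ifs with h
  · subst h; simp
  · simp

theorem invol_one : x.invol 1 = 1 := by
  simpa [mono_empty] using x.invol_mono ∅

/-- Additive maps that are compatible with constants agree if they agree on monomials. -/
theorem addHom_ext {B : Type*} [AddCommGroup B] {f g : A →+ B}
    (h : ∀ c ν, f (x.incl c * x.mono ν) = g (x.incl c * x.mono ν)) (a : A) : f a = g a := by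
  rw [← x.sum_coeff a, map_sum, map_sum]
  exact Finset.sum_congr rfl fun ν _ => h _ ν

theorem gen_mul_incl_mul (j : Fin q) (c : C) (a : A) :
    x.gen j * (x.incl c * a) = x.incl c * (x.gen j * a) := by
  rw [← mul_assoc, ← x.incl_comm, mul_assoc]

theorem invol_gen_mul (j : Fin q) (a : A) : x.invol (x.gen j * a) = -(x.gen j * x.invol a) := by
  refine x.addHom_ext (f := x.invol.comp (AddMonoidHom.mulLeft (x.gen j)))
    (g := -(AddMonoidHom.mulLeft (x.gen j)).comp x.invol) (fun c ν => ?_) a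
  simp only [AddMonoidHom.comp_apply, AddMonoidHom.neg_apply, AddMonoidHom.coe_mulLeft,
    gen_mul_incl_mul, invol_incl_mul, invol_mono, gen_mul_mono, mul_smul_comm]
  split_ifs with h
  · simp
  · simp only [map_zsmul, invol_mono, mul_smul_comm, Finset.card_insert_of_notMem h]
    rw [pow_succ]
    simp only [smul_smul, ← neg_smul]
    congr 1
    ring

theorem invol_mul (a b : A) : x.invol (a * b) = x.invol a * x.invol b := by
  revert b
  refine x.induction ?_ ?_ ?_ ?_ a
  · simp [invol_one]
  · intro a a' h h' b; simp [add_mul, h, h']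
  · intro c a h b; simp only [mul_assoc, invol_incl_mul, h]
  · intro j a h b; simp only [mul_assoc, invol_gen_mul, h, neg_mul]

/-- The Koszul sign rule. With `invol` in place of a sign it also covers inhomogeneous elements. -/
theorem gen_mul (j : Fin q) (a : A) : x.gen j * a = x.invol a * x.gen j := by
  refine x.induction ?_ ?_ ?_ ?_ a
  · simp [invol_one]
  · intro a b h h'; simp [mul_add, add_mul, h, h']
  · intro c a h; rw [gen_mul_incl_mul, h, invol_incl_mul, mul_assoc]
  · intro i a h; rw [invol_gen_mul, ← mul_assoc, x.gen_anti, neg_mul, mul_assoc, h, neg_mul, mul_assoc]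

/-- Moving a generator past `a` replaces `a` by `invol a`. Centrality of the even elements makes
`evenSubring` commutative, so that `Matrix.det` and `adjugate` apply to Jacobian matrices. -/
theorem commute_of_invol_eq {a : A} (ha : x.invol a = a) (b : A) : a * b = b * a := by
  refine x.induction ?_ ?_ ?_ ?_ b
  · simp
  · intro b c h h'; simp [mul_add, add_mul, h, h']
  · intro c b h; rw [← mul_assoc, ← x.incl_comm, mul_assoc, h, mul_assoc]
  · intro j b h; rw [← mul_assoc, ← ha, ← gen_mul, ha, mul_assoc, h, mul_assoc]

/-- The ring of even elements. -/
def evenSubring : Subring A where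
  carrier := {a | x.invol a = a}
  zero_mem' := map_zero _
  one_mem' := x.invol_one
  add_mem' := by intro a b ha hb; simp only [Set.mem_ofPred_eq, map_add] at *; rw [ha, hb]
  neg_mem' := by intro a ha; simp only [Set.mem_ofPred_eq, map_neg] at *; rw [ha]
  mul_mem' := by intro a b ha hb; simp only [Set.mem_ofPred_eq, invol_mul] at *; rw [ha, hb]

instance : CommRing x.evenSubring where
  mul_comm a b := Subtype.ext (x.commute_of_invol_eq a.2 b)

/-! #### Odd derivatives -/

/-- The derivative `∂/∂ξ_j`. -/
def dOdd (j : Fin q) : A →+ A :=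
  AddMonoidHom.mk' (fun a => ∑ ν with j ∈ ν,
    (-1 : ℤ) ^ (below ν j).card • (x.incl (x.coeff ν a) * x.mono (ν.erase j)))
    fun a b => by simp [add_mul, Finset.sum_add_distrib, smul_add]

theorem dOdd_apply (j : Fin q) (a : A) : x.dOdd j a = ∑ ν with j ∈ ν,
    (-1 : ℤ) ^ (below ν j).card • (x.incl (x.coeff ν a) * x.mono (ν.erase j)) := rfl

theorem dOdd_incl_mul (j : Fin q) (c : C) (a : A) :
    x.dOdd j (x.incl c * a) = x.incl c * x.dOdd j a := by
  simp only [dOdd_apply, Finset.mul_sum, coeff_incl_mul, map_mul, mul_assoc, mul_smul_comm]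

theorem dOdd_mono (j : Fin q) (ν : Finset (Fin q)) : x.dOdd j (x.mono ν) =
    if j ∈ ν then (-1 : ℤ) ^ (below ν j).card • x.mono (ν.erase j) else 0 := by
  rw [dOdd_apply]
  simp only [coeff_mono]
  split_ifs with h
  · rw [Finset.sum_eq_single ν]
    · simp
    · intro μ _ hμ; simp [hμ]
    · simp [h]
  · refine Finset.sum_eq_zero fun μ hμ => ?_
    have : μ ≠ ν := by rintro rfl; exact h (by simpa using hμ)
    simp [this]

theorem dOdd_one (j : Fin q) : x.dOdd j 1 = 0 := by
  simpa [mono_empty] using x.dOdd_mono j ∅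

/-- No term of the derivative contains `ξ_j`. This is integration by parts for the Berezin integral
over the odd coordinates. -/
theorem coeff_univ_dOdd (j : Fin q) (a : A) : x.coeff Finset.univ (x.dOdd j a) = 0 := by
  rw [dOdd_apply, map_sum]
  refine Finset.sum_eq_zero fun ν _ => ?_
  rw [map_zsmul, coeff_incl_mul_mono, if_neg, smul_zero]
  intro h
  have := h ▸ Finset.mem_univ j
  simp at this

theorem card_below_insert {i j : Fin q} {ν : Finset (Fin q)} (hi : i ∉ ν) :
    (below (insert i ν) j).card = (below ν j).card + if i < j then 1 else 0 := by
  rw [below, Finset.filter_insert]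
  split_ifs
  · rw [Finset.card_insert_of_notMem (by simp [hi])]
  · rfl

/-- The relation `∂_j ξ_i + ξ_i ∂_j = δ_ij` between operators. The Leibniz rule, the chain rule and
the anticommutation of the `∂_j` follow from it by `induction`, so signs are counted only here. -/
theorem dOdd_gen_mul (i j : Fin q) (a : A) :
    x.dOdd j (x.gen i * a) = (if i = j then a else 0) - x.gen i * x.dOdd j a := by
  refine x.addHom_ext (f := (x.dOdd j).comp (AddMonoidHom.mulLeft (x.gen i)))
    (g := (if i = j then AddMonoidHom.id A else 0) -
      (AddMonoidHom.mulLeft (x.gen i)).comp (x.dOdd j)) (fun c ν => ?_) a |>.trans ?_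
  swap
  · by_cases h : i = j <;> simp [h]
  have key : x.dOdd j (x.gen i * x.mono ν) =
      (if i = j then x.mono ν else 0) - x.gen i * x.dOdd j (x.mono ν) := by
    have hsq : ∀ n : ℕ, ((-1 : ℤ) ^ n) * (-1) ^ n = 1 := fun n => by
      rw [← mul_pow]; simp
    rw [gen_mul_mono, dOdd_mono]
    by_cases hij : i = j
    · subst hij
      by_cases hi : i ∈ ν
      · have h1 := x.gen_mul_mono i (ν.erase i)
        have h2 := card_below_insert (j := i) (Finset.notMem_erase i ν)
        rw [Finset.insert_erase hi] at h1 h2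
        simp only [hi, if_true, map_zero, mul_smul_comm, h1, Finset.mem_erase, ne_eq,
          not_true_eq_false, false_and, if_false, h2, lt_irrefl, add_zero, smul_smul, hsq, one_smul,
          sub_self]
      · have h2 := card_below_insert (j := i) hi
        simp only [hi, if_false, if_true, mul_zero, sub_zero, map_zsmul, dOdd_mono,
          Finset.mem_insert_self, h2, lt_irrefl, add_zero, smul_smul, hsq, one_smul,
          Finset.erase_insert hi]
    · simp only [hij, if_false, zero_sub]
      by_cases hi : i ∈ ν
      · simp only [hi, if_true, map_zero]
        split_ifs
        · rw [mul_smul_comm, gen_mul_mono, if_pos (by simp [hi, hij])]; simp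
        · simp
      · simp only [hi, if_false, map_zsmul, dOdd_mono, Finset.mem_insert]
        by_cases hj : j ∈ ν
        · have h1 : i ∉ ν.erase j := by simp [hi]
          have h2 := card_below_insert (j := j) hi
          have h3 := card_below_insert (j := i) (Finset.notMem_erase j ν)
          rw [Finset.insert_erase hj] at h3
          have h4 : (insert i ν).erase j = insert i (ν.erase j) :=
            Finset.erase_insert_of_ne hij
          rw [if_pos (Or.inr hj), if_pos hj, mul_smul_comm, gen_mul_mono, if_neg h1, h2, h3, h4,
            smul_smul, smul_smul, ← neg_smul]
          congr 1
          -- Inserting `i` changes the count below `j` if `i < j`, and removing `j` changes the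
          -- count below `i` if `j < i`. Exactly one of the two occurs, whence the minus sign.
          rcases lt_or_gt_of_ne hij with h | h
          · simp only [h, if_true, not_lt.2 h.le, if_false]; ring
          · simp only [h, if_true, not_lt.2 h.le, if_false]; ring
        · rw [if_neg hj, if_neg (by rintro (h | h); exacts [hij h.symm, hj h])]; simp
  have := congrArg (fun a => x.incl c * a) key
  simp only [mul_sub] at this
  by_cases h : i = j
  · simp only [h, if_true] at this ⊢
    simpa [gen_mul_incl_mul, dOdd_incl_mul] using this
  · simp only [h, if_false] at this ⊢
    simpa [gen_mul_incl_mul, dOdd_incl_mul] using this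

/-- The Leibniz rule for odd derivatives. -/
theorem dOdd_mul (j : Fin q) (a b : A) :
    x.dOdd j (a * b) = x.dOdd j a * b + x.invol a * x.dOdd j b := by
  revert b
  refine x.induction ?_ ?_ ?_ ?_ a
  · simp [invol_one, dOdd_one]
  · intro a a' h h' b; simp only [add_mul, map_add, h, h']; abel
  · intro c a h b; simp only [mul_assoc, invol_incl_mul, dOdd_incl_mul, h, mul_add]
  · intro i a h b
    simp only [mul_assoc, dOdd_gen_mul, invol_gen_mul, h, sub_mul, neg_mul, mul_add]
    split_ifs
    · abel
    · simp; abel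

theorem dOdd_gen (i j : Fin q) : x.dOdd j (x.gen i) = if i = j then 1 else 0 := by
  simpa [dOdd_one] using x.dOdd_gen_mul i j 1

theorem invol_dOdd (j : Fin q) (a : A) : x.invol (x.dOdd j a) = -x.dOdd j (x.invol a) := by
  refine x.induction ?_ ?_ ?_ ?_ a
  · simp [invol_one, dOdd_one]
  · intro a a' h h'; simp only [map_add, h, h', neg_add]
  · intro c a h; simp only [invol_incl_mul, dOdd_incl_mul, h, mul_neg]
  · intro i a h
    simp only [dOdd_gen_mul, invol_gen_mul, map_sub, map_neg, h, mul_neg]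
    split_ifs
    · abel
    · simp

theorem dOdd_anticomm (i j : Fin q) (a : A) : x.dOdd i (x.dOdd j a) = -x.dOdd j (x.dOdd i a) := by
  refine x.induction ?_ ?_ ?_ ?_ a
  · simp [dOdd_one]
  · intro a a' h h'; simp only [map_add, h, h', neg_add]
  · intro c a h; simp only [dOdd_incl_mul, h, mul_neg]
  · intro k a h
    simp only [dOdd_gen_mul, map_sub, h]
    split_ifs <;> simp; abel

/-- Identifies the body of a Jacobian matrix with the matrix of linear coefficients of the
generators. -/
theorem coeff_empty_dOdd (j : Fin q) (a : A) : x.coeff ∅ (x.dOdd j a) = x.coeff {j} a := by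
  rw [dOdd_apply, map_sum, Finset.sum_eq_single {j}]
  · have h : below {j} j = ∅ := by simp [below]
    rw [h, Finset.card_empty, pow_zero, one_smul, Finset.erase_singleton, coeff_incl_mul_mono,
      if_pos rfl]
  · intro ν hν hne
    rw [map_zsmul, coeff_incl_mul_mono, if_neg, smul_zero]
    intro h
    apply hne
    have hj : j ∈ ν := by simpa using hν
    rw [← Finset.insert_erase hj, ← h]
    rfl
  · simp

/-! #### Even derivatives -/

/-- The extension of an additive map `d` of the coefficients to `A`. -/
def dEven (d : C →+ C) : A →+ A :=
  AddMonoidHom.mk' (fun a => ∑ ν, x.incl (d (x.coeff ν a)) * x.mono ν)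
    fun a b => by simp [add_mul, Finset.sum_add_distrib]

theorem dEven_apply (d : C →+ C) (a : A) :
    x.dEven d a = ∑ ν, x.incl (d (x.coeff ν a)) * x.mono ν := rfl

theorem coeff_dEven (d : C →+ C) (a : A) (ν : Finset (Fin q)) :
    x.coeff ν (x.dEven d a) = d (x.coeff ν a) := x.coeff_sum _ ν

theorem dEven_incl_mul_mono (d : C →+ C) (c : C) (ν : Finset (Fin q)) :
    x.dEven d (x.incl c * x.mono ν) = x.incl (d c) * x.mono ν := by
  apply x.ext_coeff
  intro μ
  rw [coeff_dEven, coeff_incl_mul_mono, coeff_incl_mul_mono]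
  split_ifs <;> simp

theorem dEven_incl (d : C →+ C) (c : C) : x.dEven d (x.incl c) = x.incl (d c) := by
  simpa [mono_empty] using x.dEven_incl_mul_mono d c ∅

theorem dEven_gen_mul (d : C →+ C) (j : Fin q) (a : A) :
    x.dEven d (x.gen j * a) = x.gen j * x.dEven d a := by
  refine x.addHom_ext (f := (x.dEven d).comp (AddMonoidHom.mulLeft (x.gen j)))
    (g := (AddMonoidHom.mulLeft (x.gen j)).comp (x.dEven d)) (fun c ν => ?_) a
  simp only [AddMonoidHom.comp_apply, AddMonoidHom.coe_mulLeft, gen_mul_incl_mul,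
    dEven_incl_mul_mono, gen_mul_mono]
  split_ifs
  · simp
  · simp only [mul_smul_comm, map_zsmul, dEven_incl_mul_mono]

theorem dEven_gen (d : C →+ C) (h1 : d 1 = 0) (j : Fin q) : x.dEven d (x.gen j) = 0 := by
  have h : x.dEven d 1 = 0 := by rw [← map_one x.incl, dEven_incl, h1, map_zero]
  simpa [h] using x.dEven_gen_mul d j 1

theorem dEven_incl_mul (d : C →+ C) (hd : ∀ a b, d (a * b) = a * d b + d a * b) (c : C) (a : A) :
    x.dEven d (x.incl c * a) = x.incl c * x.dEven d a + x.incl (d c) * a := by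
  apply x.ext_coeff
  intro ν
  simp only [coeff_dEven, coeff_incl_mul, map_add, hd]

/-- The Leibniz rule for even derivatives. -/
theorem dEven_mul (d : C →+ C) (hd : ∀ a b, d (a * b) = a * d b + d a * b) (a b : A) :
    x.dEven d (a * b) = a * x.dEven d b + x.dEven d a * b := by
  have h1 : d 1 = 0 := by simpa using hd 1 1
  revert b
  refine x.induction ?_ ?_ ?_ ?_ a
  · have h : x.dEven d 1 = 0 := by rw [← map_one x.incl, dEven_incl, h1, map_zero]
    simp [h]
  · intro a a' h h' b; simp only [add_mul, map_add, h, h']; abel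
  · intro c a h b
    simp only [mul_assoc, x.dEven_incl_mul d hd, h, mul_add, add_mul]
    abel
  · intro j a h b; simp only [mul_assoc, dEven_gen_mul, h, mul_add]

end GrassmannFrame

namespace GrassmannFrame

variable {q : ℕ} {C A : Type*} [CommRing C] [Ring A]

/-! ### Changing the embedding of the constants -/

/-- If `π` agrees with `x.incl` up to terms of positive degree, then `A` is also a Grassmann
algebra over `π C` in the generators of `x`. -/
theorem bijective_of_sub_mem_fil (x : GrassmannFrame q C A) (π : C →+* A)
    (h : ∀ c, π c - x.incl c ∈ x.fil 1) :
    Function.Bijective fun c : Finset (Fin q) → C => ∑ ν, π (c ν) * oddMonomial x.gen ν := by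
  let T : (Finset (Fin q) → C) →ₗ[ℤ] A :=
    (AddMonoidHom.mk' (fun c => ∑ ν, π (c ν) * x.mono ν) fun a b => by
      simp [add_mul, Finset.sum_add_distrib]).toIntLinearMap
  let e : A →ₗ[ℤ] (Finset (Fin q) → C) := (x.expand.symm : A →+ _).toIntLinearMap
  -- Up to `expand`, the new expansion `T` is `1 + N`. As `π` and `x.incl` differ only in positive
  -- degree, `N` raises the filtration by one and is nilpotent, so `1 + N` is invertible.
  let N : Module.End ℤ (Finset (Fin q) → C) := e ∘ₗ T - 1
  have hN : ∀ c, x.expand (N c) = ∑ ν, (π (c ν) - x.incl (c ν)) * x.mono ν := by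
    intro c
    have : N c = x.expand.symm (T c) - c := rfl
    rw [this, map_sub, AddEquiv.apply_symm_apply, expand_apply]
    simp [T, sub_mul]
  have hstep : ∀ k c, x.expand c ∈ x.fil k → x.expand (N c) ∈ x.fil (k + 1) := by
    intro k c hc
    rw [hN]
    refine sum_mem fun ν _ => ?_
    by_cases hν : ν.card < k
    · have := hc ν hν
      rw [coeff_expand] at this
      simp [this]
    · rw [add_comm]
      exact x.mul_mem_fil (h _) (x.mono_mem_fil (not_lt.1 hν))
  have hpow : ∀ k c, x.expand ((N ^ k) c) ∈ x.fil k := by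
    intro k
    induction k with
    | zero => exact fun c => x.mem_fil_zero _
    | succ k ih =>
      intro c
      rw [pow_succ', Module.End.mul_apply]
      exact hstep k _ (ih c)
  have hnil : IsNilpotent N := ⟨q + 1, by
    refine LinearMap.ext fun c => x.expand.injective ?_
    rw [x.eq_zero_of_mem_fil (Nat.lt_succ_self q) (hpow (q + 1) c), LinearMap.zero_apply, map_zero]⟩
  have hT : 1 + N = e ∘ₗ T := add_sub_cancel _ _
  have hb : Function.Bijective (e ∘ₗ T) := by
    rw [← hT]
    exact (Module.End.isUnit_iff _).1 hnil.isUnit_one_add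
  have : (fun c : Finset (Fin q) → C => ∑ ν, π (c ν) * oddMonomial x.gen ν) =
      x.expand ∘ (e ∘ₗ T) := by
    funext c
    exact (x.expand.apply_symm_apply _).symm
  rw [this]
  exact x.expand.bijective.comp hb

end GrassmannFrame

/-! ### Changing the generators -/

theorem map_leibnizDet {R S : Type*} [Ring R] [Ring S] (f : R →+* S) {n : ℕ}
    (M : Matrix (Fin n) (Fin n) R) : f (leibnizDet M) = leibnizDet (M.map f) := by
  simp [leibnizDet, map_list_prod, List.map_ofFn, Function.comp_def]

/-- Jacobi's formula for a derivation with values in a module. -/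
theorem derivation_det {R E B : Type*} [CommRing R] [CommRing E] [Algebra R E] [AddCommGroup B]
    [Module R B] [Module E B] (D : Derivation R E B) {n : ℕ} (M : Matrix (Fin n) (Fin n) E) :
    D M.det = ∑ i, ∑ j, M.adjugate j i • D (M i j) := by
  have hprod : ∀ (s : Finset (Fin n)) (f : Fin n → E),
      D (∏ i ∈ s, f i) = ∑ i ∈ s, (∏ k ∈ s.erase i, f k) • D (f i) := by
    intro s f
    induction s using Finset.induction_on with
    | empty => simp
    | insert a s ha ih =>
      rw [Finset.prod_insert ha, D.leibniz, ih, Finset.sum_insert ha, Finset.erase_insert ha,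
        Finset.smul_sum, add_comm]
      congr 1
      refine Finset.sum_congr rfl fun i hi => ?_
      have hia : a ≠ i := by rintro rfl; exact ha hi
      rw [Finset.erase_insert_of_ne hia, Finset.prod_insert (by simp [ha]), mul_smul]
  -- The cofactor of `M i j` collects the terms of the Leibniz formula with `σ j = i`, with the
  -- factor `M i j` removed.
  have hadj : ∀ i j, M.adjugate j i = ∑ σ : Equiv.Perm (Fin n),
      if σ j = i then (Equiv.Perm.sign σ : ℤ) • ∏ k ∈ Finset.univ.erase j, M (σ k) k else 0 := by
    intro i j
    rw [Matrix.adjugate_apply, Matrix.det_apply]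
    refine Finset.sum_congr rfl fun σ _ => ?_
    split_ifs with h
    · rw [← Finset.mul_prod_erase _ _ (Finset.mem_univ j)]
      have : M.updateRow i (Pi.single j 1) (σ j) j = 1 := by simp [h]
      rw [this, one_mul]
      congr 1
      refine Finset.prod_congr rfl fun k hk => ?_
      have : σ k ≠ i := by
        rw [← h]
        exact fun h' => (Finset.mem_erase.1 hk).1 (σ.injective h')
      rw [Matrix.updateRow_ne this]
    · rw [Finset.prod_eq_zero (Finset.mem_univ (σ.symm i)), smul_zero]
      have : σ.symm i ≠ j := by
        rintro rfl
        simp at h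
      simp [this]
  rw [Matrix.det_apply, map_sum]
  simp only [hadj, Finset.sum_smul]
  have : ∀ i : Fin n, (∑ j, ∑ σ : Equiv.Perm (Fin n), (if σ j = i then
      (Equiv.Perm.sign σ : ℤ) • ∏ k ∈ Finset.univ.erase j, M (σ k) k else 0) • D (M i j)) =
      ∑ σ : Equiv.Perm (Fin n), ∑ j, (if σ j = i then
      (Equiv.Perm.sign σ : ℤ) • ∏ k ∈ Finset.univ.erase j, M (σ k) k else 0) • D (M i j) :=
    fun i => Finset.sum_comm
  simp only [this]
  rw [Finset.sum_comm]
  refine Finset.sum_congr rfl fun σ _ => ?_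
  rw [Finset.sum_comm, Units.smul_def, map_zsmul, hprod, Finset.smul_sum]
  refine Finset.sum_congr rfl fun j _ => ?_
  rw [Finset.sum_eq_single (σ j)]
  · rw [if_pos rfl, smul_assoc]
  · intro i _ hi
    simp [hi.symm]
  · simp

namespace GrassmannFrame

variable {q : ℕ} {C A : Type*} [CommRing C] [Ring A]

/-- All terms of `a` have odd degree. -/
def IsOdd (x : GrassmannFrame q C A) (a : A) : Prop := ∀ ν, Even ν.card → x.coeff ν a = 0

theorem IsOdd.invol_eq {x : GrassmannFrame q C A} {a : A} (h : x.IsOdd a) : x.invol a = -a := by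
  apply x.ext_coeff
  intro ν
  rw [coeff_invol, map_neg]
  rcases Nat.even_or_odd ν.card with h' | h'
  · simp [h ν h']
  · simp [h'.neg_one_pow]

theorem IsOdd.mem_fil {x : GrassmannFrame q C A} {a : A} (h : x.IsOdd a) : a ∈ x.fil 1 :=
  fun ν hν => h ν (by rw [Nat.lt_one_iff.1 hν]; exact Even.zero)

/-- Both involutions are multiplicative, fix the constants and change the sign of the generators of
`x`. Hence parity does not depend on the frame. -/
theorem invol_eq_invol (x y : GrassmannFrame q C A) (hxy : x.incl = y.incl)
    (hodd : ∀ b, y.IsOdd (x.gen b)) (a : A) : x.invol a = y.invol a := by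
  refine x.induction ?_ ?_ ?_ ?_ a
  · rw [invol_one, invol_one]
  · intro a b ha hb; rw [map_add, map_add, ha, hb]
  · intro c a ha; rw [invol_incl_mul, hxy, invol_incl_mul, ha]
  · intro j a ha; rw [invol_gen_mul, invol_mul, ha, (hodd j).invol_eq, neg_mul]

theorem invol_dOdd_of_invol_eq_neg (y : GrassmannFrame q C A) (j : Fin q) {a : A}
    (ha : y.invol a = -a) : y.invol (y.dOdd j a) = y.dOdd j a := by
  rw [invol_dOdd, ha, map_neg, neg_neg]

/-- The chain rule for odd derivatives. -/
theorem dOdd_chain (x y : GrassmannFrame q C A) (hxy : x.incl = y.incl)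
    (hodd : ∀ b, y.invol (x.gen b) = -x.gen b) (j : Fin q) (a : A) :
    y.dOdd j a = ∑ b, y.dOdd j (x.gen b) * x.dOdd b a := by
  refine x.induction ?_ ?_ ?_ ?_ a
  · simp [dOdd_one]
  · intro a b ha hb; simp only [map_add, ha, hb, mul_add, Finset.sum_add_distrib]
  · intro c a ha
    simp only [dOdd_incl_mul]
    rw [hxy, dOdd_incl_mul, ha, Finset.mul_sum]
    refine Finset.sum_congr rfl fun b _ => ?_
    rw [← mul_assoc, ← mul_assoc, y.incl_comm]
  · intro i a ha
    have h : ∀ b, y.dOdd j (x.gen b) * x.dOdd b (x.gen i * a) =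
        (if i = b then y.dOdd j (x.gen b) * a else 0) -
          x.gen i * (y.dOdd j (x.gen b) * x.dOdd b a) := fun b => by
      -- The derivative of an odd generator is even, so it can be moved past `x.gen i` without a
      -- sign.
      have := y.commute_of_invol_eq (y.invol_dOdd_of_invol_eq_neg j (hodd b)) (x.gen i)
      rw [x.dOdd_gen_mul, mul_sub, ← mul_assoc _ (x.gen i), this, mul_assoc]
      split_ifs <;> simp
    rw [Finset.sum_congr rfl fun b _ => h b, y.dOdd_mul, hodd, ha, Finset.sum_sub_distrib, neg_mul, ← sub_eq_add_neg, Finset.mul_sum]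
    simp

/-- The odd derivative, as a derivation of the ring of even elements. -/
def dOddDerivation (y : GrassmannFrame q C A) (j : Fin q) : Derivation ℤ y.evenSubring A :=
  Derivation.mk' ((y.dOdd j).comp y.evenSubring.subtype.toAddMonoidHom).toIntLinearMap <| by
    intro a b
    change y.dOdd j (a * b) = (a : A) * y.dOdd j b + (b : A) * y.dOdd j a
    rw [dOdd_mul, show y.invol a = a from a.2, add_comm, y.commute_of_invol_eq b.2]

theorem dOddDerivation_apply (y : GrassmannFrame q C A) (j : Fin q) (a : y.evenSubring) :
    y.dOddDerivation j a = y.dOdd j a := rfl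

/-- The Jacobian matrix `∂η_a/∂ξ_b` between two systems of odd generators. -/
def jacobian (x y : GrassmannFrame q C A) : Matrix (Fin q) (Fin q) A :=
  Matrix.of fun b a => x.dOdd b (y.gen a)

/-! ### Invariance of the top coefficient under a change of odd generators -/

section Berezin

variable {x y : GrassmannFrame q C A}

/-- The two systems of generators have the same constants and are odd with respect to each
other. -/
structure Compatible (x y : GrassmannFrame q C A) : Prop where
  incl_eq : x.incl = y.incl
  left_odd : ∀ b, y.IsOdd (x.gen b)
  right_odd : ∀ b, x.IsOdd (y.gen b)

theorem Compatible.symm (h : Compatible x y) : Compatible y x :=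
  ⟨h.incl_eq.symm, h.right_odd, h.left_odd⟩

theorem Compatible.invol_eq (h : Compatible x y) (a : A) : x.invol a = y.invol a :=
  invol_eq_invol x y h.incl_eq h.left_odd a

theorem Compatible.chain (h : Compatible x y) (j : Fin q) (a : A) :
    y.dOdd j a = ∑ b, jacobian y x j b * x.dOdd b a :=
  dOdd_chain x y h.incl_eq (fun b => (h.left_odd b).invol_eq) j a

/-- The chain rule, applied to the generators of `x` themselves. -/
theorem Compatible.jacobian_mul (h : Compatible x y) : jacobian x y * jacobian y x = 1 := by
  ext b c
  rw [Matrix.mul_apply]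
  have := h.symm.chain b (x.gen c)
  rw [dOdd_gen] at this
  rw [Matrix.one_apply]
  simp only [eq_comm (a := b)]
  exact this.symm

theorem Compatible.inverse_jacobian (h : Compatible x y) :
    Ring.inverse (jacobian y x) = jacobian x y :=
  Ring.inverse_unit ⟨jacobian y x, jacobian x y, h.symm.jacobian_mul, h.jacobian_mul⟩

/-- The Jacobian matrix over the ring of even elements. -/
def Compatible.evenJacobian (h : Compatible x y) : Matrix (Fin q) (Fin q) x.evenSubring :=
  Matrix.of fun b a => ⟨x.dOdd b (y.gen a),
    x.invol_dOdd_of_invol_eq_neg b (h.right_odd a).invol_eq⟩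

theorem leibnizDet_coe {x : GrassmannFrame q C A} {n : ℕ}
    (M : Matrix (Fin n) (Fin n) x.evenSubring) :
    leibnizDet (M.map x.evenSubring.subtype) = (M.det : A) := by
  rw [← map_leibnizDet, leibnizDet_eq_det]
  rfl

theorem Compatible.leibnizDet_jacobian (h : Compatible x y) :
    leibnizDet (jacobian x y) = (h.evenJacobian.det : A) := by
  have : jacobian x y = h.evenJacobian.map x.evenSubring.subtype := by
    ext b a
    rfl
  rw [this, leibnizDet_coe]

/-- The other Jacobian matrix over the same ring of even elements. -/
def Compatible.evenJacobian' (h : Compatible x y) : Matrix (Fin q) (Fin q) x.evenSubring :=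
  Matrix.of fun b a => ⟨y.dOdd b (x.gen a), (h.invol_eq _).trans <|
    y.invol_dOdd_of_invol_eq_neg b (h.left_odd a).invol_eq⟩

theorem Compatible.evenJacobian_mul (h : Compatible x y) :
    h.evenJacobian * h.evenJacobian' = 1 := by
  ext b c
  have := congrFun (congrFun h.jacobian_mul b) c
  rw [Matrix.mul_apply] at this ⊢
  rw [Matrix.one_apply] at this ⊢
  push_cast
  rw [apply_ite Subtype.val]
  exact this

/-- Turns Jacobi's formula into the logarithmic form `∂w = w · tr (J⁻¹ ∂J)` for `w = det J`. -/
theorem Compatible.adjugate_evenJacobian (h : Compatible x y) :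
    h.evenJacobian.adjugate = h.evenJacobian.det • h.evenJacobian' := by
  calc h.evenJacobian.adjugate
      = h.evenJacobian.adjugate * (h.evenJacobian * h.evenJacobian') := by
        rw [h.evenJacobian_mul, mul_one]
    _ = _ := by rw [← mul_assoc, Matrix.adjugate_mul, Matrix.smul_mul, one_mul]

/-- The divergence of a row of the Jacobian matrix, multiplied with the determinant, vanishes. -/
theorem Compatible.sum_dOdd_jacobian_mul_det (h : Compatible x y) (b : Fin q) :
    ∑ a, y.dOdd a (jacobian x y b a * leibnizDet (jacobian x y)) = 0 := by
  set w : A := leibnizDet (jacobian x y) with hw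
  have hcomm : ∀ b a c, jacobian x y b a * c = c * jacobian x y b a := fun b a c =>
    x.commute_of_invol_eq (h.evenJacobian b a).2 c
  have hcomm' : ∀ b a c, jacobian y x b a * c = c * jacobian y x b a := fun b a c =>
    x.commute_of_invol_eq (h.evenJacobian' b a).2 c
  have hwc : ∀ c, w * c = c * w := fun c => by
    rw [hw, h.leibnizDet_jacobian]
    exact x.commute_of_invol_eq h.evenJacobian.det.2 c
  have h1 : ∀ a, y.dOdd a (jacobian x y b a * w) =
      w * y.dOdd a (jacobian x y b a) + jacobian x y b a * y.dOdd a w := fun a => by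
    rw [dOdd_mul, ← hwc, ← h.invol_eq]
    congr 2
    exact (h.evenJacobian b a).2
  have h2 : ∑ a, jacobian x y b a * y.dOdd a w = x.dOdd b w := (h.symm.chain b w).symm
  have h3 : x.dOdd b w = ∑ i, ∑ j, w * (jacobian y x j i * x.dOdd b (jacobian x y i j)) := by
    rw [hw, h.leibnizDet_jacobian, ← dOddDerivation_apply, derivation_det]
    refine Finset.sum_congr rfl fun i _ => Finset.sum_congr rfl fun j _ => ?_
    rw [h.adjugate_evenJacobian, dOddDerivation_apply, ← mul_assoc]
    rfl
  -- The entry at `(i, j)` is `∂η_j/∂ξ_i`, so anticommuting `∂/∂ξ_b` with `∂/∂ξ_i` exchanges the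
  -- rows `i` and `b` at the cost of a sign. By the chain rule the derivative of the determinant
  -- then becomes `-w` times the divergence of row `b`, which cancels the other summand. In the
  -- Piola identity for even coordinates this sign is absent, and the inverse determinant takes the
  -- place of `w`.
  have h4 : ∀ i j, x.dOdd b (jacobian x y i j) = -x.dOdd i (jacobian x y b j) := fun i j =>
    x.dOdd_anticomm b i _
  simp only [h1, Finset.sum_add_distrib, h2, h3, h4]
  rw [Finset.sum_comm, ← Finset.sum_add_distrib]
  refine Finset.sum_eq_zero fun j _ => ?_
  rw [h.chain j, ← Finset.mul_sum, ← mul_add]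
  simp [mul_neg]

/-- The functional `a ↦` top coefficient of `a · det (∂η/∂ξ)` with respect to `η` vanishes on
derivatives with respect to `ξ`. -/
theorem Compatible.top_dOdd_mul_det (h : Compatible x y) (b : Fin q) (a : A) :
    y.coeff Finset.univ (x.dOdd b a * leibnizDet (jacobian x y)) = 0 := by
  set w : A := leibnizDet (jacobian x y) with hw
  have hev : ∀ a, y.invol (jacobian x y b a * w) = jacobian x y b a * w := fun c => by
    rw [← h.invol_eq, hw, h.leibnizDet_jacobian]
    exact (h.evenJacobian b c * h.evenJacobian.det).2
  have hwc : ∀ c, c * w = w * c := fun c => by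
    rw [hw, h.leibnizDet_jacobian]
    exact (x.commute_of_invol_eq h.evenJacobian.det.2 _).symm
  have h0 : ∀ c, y.dOdd c (jacobian x y b c * w * a) =
      y.dOdd c (jacobian x y b c * w) * a + jacobian x y b c * y.dOdd c a * w := fun c => by
    rw [dOdd_mul, hev, mul_assoc _ w, mul_assoc _ _ w, hwc (y.dOdd c a)]
  -- Since the weighted rows are free of divergence, the product is a sum of derivatives with
  -- respect to the generators of `y`, which have no top coefficient.
  have h1 : x.dOdd b a * w = ∑ c, y.dOdd c (jacobian x y b c * w * a) := by
    rw [Finset.sum_congr rfl fun c _ => h0 c, Finset.sum_add_distrib, ← Finset.sum_mul,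
      ← Finset.sum_mul, h.sum_dOdd_jacobian_mul_det b, zero_mul, zero_add, h.symm.chain b a]
  rw [h1, map_sum]
  exact Finset.sum_eq_zero fun c _ => y.coeff_univ_dOdd c _

theorem prod_ofFn_mem_fil (y : GrassmannFrame q C A) {n : ℕ} (f : Fin n → A)
    (hf : ∀ i, f i ∈ y.fil 1) : (List.ofFn f).prod ∈ y.fil n := by
  induction n with
  | zero => exact y.mem_fil_zero _
  | succ n ih =>
    rw [List.ofFn_succ, List.prod_cons]
    have := y.mul_mem_fil (hf 0) (ih (fun i => f i.succ) fun i => hf _)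
    exact y.fil_mono (by omega) this

/-- Telescoping over the factors. For `n = q` the error lies in `fil (q + 1)`, so a product of `q`
factors of positive degree depends only on their linear parts. -/
theorem prod_ofFn_sub_mem_fil (y : GrassmannFrame q C A) {n : ℕ} (f g : Fin n → A)
    (hf : ∀ i, f i ∈ y.fil 1) (hg : ∀ i, g i ∈ y.fil 1) (hfg : ∀ i, f i - g i ∈ y.fil 2) :
    (List.ofFn f).prod - (List.ofFn g).prod ∈ y.fil (n + 1) := by
  induction n with
  | zero => simp
  | succ n ih =>
    rw [List.ofFn_succ, List.ofFn_succ, List.prod_cons, List.prod_cons]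
    have : ∀ a b c d : A, a * b - c * d = (a - c) * b + c * (b - d) := fun a b c d => by
      noncomm_ring
    rw [this]
    refine add_mem ?_ ?_
    · have := y.mul_mem_fil (hfg 0) (y.prod_ofFn_mem_fil (fun i => f i.succ) fun i => hf _)
      exact y.fil_mono (by omega) this
    · have := y.mul_mem_fil (hg 0) (ih (fun i => f i.succ) (fun i => g i.succ)
        (fun i => hf _) (fun i => hg _) fun i => hfg _)
      exact y.fil_mono (by omega) this

theorem mono_univ (y : GrassmannFrame q C A) : y.mono Finset.univ = (List.ofFn y.gen).prod := by
  simp [mono, oddMonomial]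

/-- The product of linear combinations of the generators. -/
theorem prod_linear (y : GrassmannFrame q C A) (M : Matrix (Fin q) (Fin q) C) :
    (List.ofFn fun b => ∑ c, y.incl (M b c) * y.gen c).prod =
      y.incl M.det * y.mono Finset.univ := by
  let _ : Algebra C A := y.incl.toAlgebra' y.incl_comm
  have hsm : ∀ (c : C) (a : A), c • a = y.incl c * a := fun c a => Algebra.smul_def c a
  let L : (Fin q → C) →ₗ[C] A := Fintype.linearCombination C y.gen
  have hL : ∀ v, L v = ∑ c, y.incl (v c) * y.gen c := fun v => by
    simp [L, Fintype.linearCombination_apply, hsm]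
  have hgen : ∀ j, L (Pi.single j 1) = y.gen j := fun j => by
    rw [hL, Finset.sum_eq_single j]
    · simp
    · intro i _ hi; simp [hi]
    · simp
  -- This is what the universal property of the exterior algebra requires. The mixed terms cancel in
  -- pairs, so no division by `2` in `C` is needed.
  have hsq : ∀ v, L v * L v = 0 := by
    intro v
    have hodd : y.invol (L v) = -L v := by
      rw [hL, map_sum, ← Finset.sum_neg_distrib]
      refine Finset.sum_congr rfl fun c _ => ?_
      have := y.invol_gen_mul c 1
      rw [mul_one, invol_one, mul_one] at this
      rw [invol_incl_mul, this, mul_neg]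
    have hterm : ∀ i j, (v i * v j) • (y.gen i * y.gen j) = -((v j * v i) • (y.gen j * y.gen i)) :=
      fun i j => by rw [y.gen_anti, smul_neg, mul_comm]
    have hLv : L v = ∑ i, v i • y.gen i := by simp [L, Fintype.linearCombination_apply]
    clear_value L
    rw [hLv]
    have : ∀ s : Finset (Fin q), (∑ i ∈ s, v i • y.gen i) * (∑ i ∈ s, v i • y.gen i) = 0 := by
      intro s
      induction s using Finset.induction_on with
      | empty => simp
      | insert a s ha ih =>
        rw [Finset.sum_insert ha, add_mul, mul_add, mul_add, ih, smul_mul_smul_comm, y.gen_sq,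
          smul_zero, zero_add, add_zero, Finset.mul_sum, Finset.sum_mul, ← Finset.sum_add_distrib]
        refine Finset.sum_eq_zero fun i _ => ?_
        rw [smul_mul_smul_comm, smul_mul_smul_comm, hterm a i, neg_add_cancel]
    exact this _
  let Φ := ExteriorAlgebra.lift C ⟨L, hsq⟩
  let F : (Fin q → C) [⋀^Fin q]→ₗ[C] A := Φ.toLinearMap.compAlternatingMap
    (ExteriorAlgebra.ιMulti C q)
  have hF : ∀ v, F v = (List.ofFn fun b => L (v b)).prod := by
    intro v
    change Φ (ExteriorAlgebra.ιMulti C q v) = _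
    rw [ExteriorAlgebra.ιMulti_apply, map_list_prod, List.map_ofFn]
    congr 2
    funext b
    exact ExteriorAlgebra.lift_ι_apply C L hsq (v b)
  let G : (Fin q → C) [⋀^Fin q]→ₗ[C] A :=
    (LinearMap.toSpanSingleton C A (y.mono Finset.univ)).compAlternatingMap Matrix.detRowAlternating
  -- Both sides are alternating in the rows of the matrix, so it suffices to compare them on the
  -- standard basis, where the product is the top monomial and the determinant is `1`.
  have hFG : F = G := by
    refine (Pi.basisFun C (Fin q)).ext_alternating fun v hv => ?_
    let σ : Equiv.Perm (Fin q) := Equiv.ofBijective v (Finite.injective_iff_bijective.1 hv)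
    have h1 : F (fun i => Pi.basisFun C (Fin q) i) = G fun i => Pi.basisFun C (Fin q) i := by
      rw [hF]
      simp only [Pi.basisFun_apply, hgen, G, LinearMap.compAlternatingMap_apply]
      rw [← mono_univ]
      have : Matrix.detRowAlternating (fun i : Fin q => (Pi.single i 1 : Fin q → C)) = 1 := by
        have : (fun i : Fin q => (Pi.single i 1 : Fin q → C)) = (1 : Matrix (Fin q) (Fin q) C) := by
          funext i j
          rw [Matrix.one_apply, Pi.single_apply]
          simp only [eq_comm]
        rw [this]
        exact Matrix.det_one
      rw [this]
      simp
    have h2 := F.map_perm (fun i => Pi.basisFun C (Fin q) i) σ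
    have h3 := G.map_perm (fun i => Pi.basisFun C (Fin q) i) σ
    exact h2.trans ((congrArg _ h1).trans h3.symm)
  have h0 : F (fun b c => M b c) = G fun b c => M b c := by rw [hFG]
  rw [hF] at h0
  simp only [hL] at h0
  rw [h0, ← hsm]
  rfl

/-- In top degree only lowest-order parts survive: `x.mono univ` is `det M` times `y.mono univ`,
where `M` consists of the linear coefficients, and only the body of the weight acts on `y.mono
univ`. Up to transposition `M` is the body of `jacobian y x`, the inverse of `jacobian x y`, so the
two determinants cancel. -/
theorem Compatible.top_mono_mul_det (h : Compatible x y) :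
    y.coeff Finset.univ (x.mono Finset.univ * leibnizDet (jacobian x y)) = 1 := by
  set w : A := leibnizDet (jacobian x y) with hw
  let M : Matrix (Fin q) (Fin q) C := Matrix.of fun b c => y.coeff {c} (x.gen b)
  have hlin : ∀ b, (∑ c, y.incl (M b c) * y.gen c) ∈ y.fil 1 := fun b =>
    sum_mem fun c _ => y.incl_mul_mem_fil _ (by
      rw [← mono_singleton]; exact y.mono_mem_fil (by simp))
  have hsub : ∀ b, x.gen b - ∑ c, y.incl (M b c) * y.gen c ∈ y.fil 2 := by
    intro b ν hν
    have hg : ∀ c, y.coeff ν (y.incl (M b c) * y.gen c) = if ν = {c} then M b c else 0 :=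
      fun c => by rw [← mono_singleton, coeff_incl_mul_mono]
    rw [map_sub, map_sum]
    simp only [hg]
    rcases Nat.lt_or_ge ν.card 1 with h1 | h1
    · rw [(h.left_odd b).mem_fil ν h1]
      rw [Finset.sum_eq_zero, sub_zero]
      intro c _
      rw [if_neg]
      rintro rfl
      simp at h1
    · obtain ⟨d, rfl⟩ := Finset.card_eq_one.1 (show ν.card = 1 by omega)
      rw [Finset.sum_eq_single d]
      · simp [M]
      · intro c _ hc; simp [hc.symm]
      · simp
  have h1 : x.mono Finset.univ = y.incl M.det * y.mono Finset.univ := by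
    rw [← prod_linear, mono_univ, ← sub_eq_zero]
    exact y.eq_zero_of_mem_fil (Nat.lt_succ_self q)
      (y.prod_ofFn_sub_mem_fil _ _ (fun b => (h.left_odd b).mem_fil) hlin hsub)
  -- The part of `w` of positive degree raises the degree beyond `q`.
  have h2 : y.mono Finset.univ * w = y.incl (y.body w) * y.mono Finset.univ := by
    rw [y.incl_comm, ← sub_eq_zero, ← mul_sub]
    refine y.eq_zero_of_mem_fil (Nat.lt_succ_self q) (y.mul_mem_fil (k := q) (l := 1) ?_ ?_)
    · exact y.mono_mem_fil (by simp)
    · exact y.sub_incl_coeff_empty_mem_fil w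
  have h3 : y.body w = ((jacobian x y).map y.body).det := by
    rw [hw, map_leibnizDet, leibnizDet_eq_det]
  have h4 : M = ((jacobian y x).map y.body).transpose := by
    ext b c
    exact (y.coeff_empty_dOdd c (x.gen b)).symm
  have h5 : M.det * y.body w = 1 := by
    rw [h3, h4, Matrix.det_transpose, ← Matrix.det_mul]
    have := congrArg (fun N => N.map y.body) h.symm.jacobian_mul
    simp only [Matrix.map_mul] at this
    rw [this]
    simp
  rw [h1, mul_assoc, h2, ← mul_assoc, ← map_mul, h5]
  simp [coeff_mono]

/-- The invariance of the Berezin integral over the odd coordinates. -/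
theorem Compatible.top_mul_det (h : Compatible x y) (a : A) :
    y.coeff Finset.univ (a * leibnizDet (jacobian x y)) = x.coeff Finset.univ a := by
  refine x.addHom_ext (f := (y.coeff Finset.univ).comp
    (AddMonoidHom.mulRight (leibnizDet (jacobian x y)))) (g := x.coeff Finset.univ)
    (fun c ν => ?_) a
  simp only [AddMonoidHom.comp_apply, AddMonoidHom.coe_mulRight, coeff_incl_mul, coeff_mono]
  rw [mul_assoc, h.incl_eq, coeff_incl_mul]
  congr 1
  split_ifs with hν
  · rw [← hν, h.top_mono_mul_det]
  · obtain ⟨b, hb⟩ : ∃ b, b ∉ ν := by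
      by_contra! hb
      exact hν (Finset.eq_univ_iff_forall.2 hb).symm
    -- A monomial without `ξ_b` is the `ξ_b`-derivative of its product with `ξ_b`, hence is killed
    -- by both functionals.
    have : x.mono ν = x.dOdd b (x.gen b * x.mono ν) := by
      rw [dOdd_gen_mul, dOdd_mono, if_pos rfl, if_neg hb, mul_zero, sub_zero]
    rw [this, h.top_dOdd_mul_det]

end Berezin

end GrassmannFrame

/-! ### Hadamard's lemma -/

section Hadamard

variable {E : Type*} [NormedAddCommGroup E] [NormedSpace ℝ E] [FiniteDimensional ℝ E]

theorem hasFDerivAt_parametric_integral {F : ℝ × E → ℝ} (hF : ContDiff ℝ 1 F) (y : E) :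
    HasFDerivAt (fun y => ∫ t in (0 : ℝ)..1, F (t, y))
      (∫ t in (0 : ℝ)..1, (fderiv ℝ F (t, y)).comp (ContinuousLinearMap.inr ℝ ℝ E)) y := by
  have hc : Continuous fun z : ℝ × E => (fderiv ℝ F z).comp (ContinuousLinearMap.inr ℝ ℝ E) :=
    (hF.continuous_fderiv one_ne_zero).clm_comp continuous_const
  obtain ⟨B, hB⟩ := ((isCompact_Icc (a := (0 : ℝ)) (b := 1)).prod
    (isCompact_closedBall y 1)).exists_bound_of_continuousOn hc.continuousOn
  refine intervalIntegral.hasFDerivAt_integral_of_dominated_of_fderiv_le (bound := fun _ => B)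
    (F := fun y t => F (t, y))
    (F' := fun y t => (fderiv ℝ F (t, y)).comp (ContinuousLinearMap.inr ℝ ℝ E))
    (Metric.closedBall_mem_nhds y one_pos) ?_ ?_ ?_ ?_ ?_ ?_
  · exact Filter.Eventually.of_forall fun z => Continuous.aestronglyMeasurable
      (hF.continuous.comp (by fun_prop))
  · exact Continuous.intervalIntegrable (hF.continuous.comp (by fun_prop)) _ _
  · exact Continuous.aestronglyMeasurable (hc.comp (by fun_prop : Continuous fun t : ℝ => (t, y)))
  · refine Filter.Eventually.of_forall fun t ht z hz => hB (t, z) ⟨?_, hz⟩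
    rw [Set.uIoc_of_le zero_le_one] at ht
    exact ⟨ht.1.le, ht.2⟩
  · exact intervalIntegrable_const
  · refine Filter.Eventually.of_forall fun t _ z _ => ?_
    have h1 : HasFDerivAt F (fderiv ℝ F (t, z)) (t, z) :=
      (hF.differentiable one_ne_zero _).hasFDerivAt
    exact h1.comp z (hasFDerivAt_prodMk_right t z)

/-- A directional derivative in the parameter is again an integral of the same kind, so induction on
the order applies once `F` is allowed to vary. -/
theorem contDiff_parametric_integral {F : ℝ × E → ℝ} (hF : ContDiff ℝ ∞ F) :
    ContDiff ℝ ∞ fun y => ∫ t in (0 : ℝ)..1, F (t, y) := by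
  rw [contDiff_infty]
  intro n
  induction n generalizing F with
  | zero =>
    rw [Nat.cast_zero, contDiff_zero]
    refine intervalIntegral.continuous_parametric_intervalIntegral_of_continuous' ?_ 0 1
    exact hF.continuous.comp (by fun_prop : Continuous fun z : E × ℝ => (z.2, z.1))
  | succ n ih =>
    have hd := hasFDerivAt_parametric_integral (hF.of_le (by simp))
    rw [Nat.cast_succ, contDiff_succ_iff_fderiv_apply]
    refine ⟨fun y => (hd y).differentiableAt, by simp, fun v => ?_⟩
    have hc : ContDiff ℝ ∞ fun z : ℝ × E => fderiv ℝ F z (0, v) :=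
      (hF.fderiv_right (by simp)).clm_apply contDiff_const
    have heq : (fun y => fderiv ℝ (fun y => ∫ t in (0 : ℝ)..1, F (t, y)) y v) =
        fun y => ∫ t in (0 : ℝ)..1, fderiv ℝ F (t, y) (0, v) := by
      funext y
      rw [(hd y).fderiv, ContinuousLinearMap.intervalIntegral_apply]
      · simp
      · apply Continuous.intervalIntegrable
        have := hF.continuous_fderiv (by simp)
        exact (this.comp (by fun_prop : Continuous fun t : ℝ => (t, y))).clm_comp continuous_const
    rw [heq]
    exact ih hc

/-- Hadamard's lemma. -/
theorem exists_eq_add_sum_mul {p : ℕ} {f : Model p → ℝ} (hf : ContDiff ℝ ∞ f) (a : Model p) :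
    ∃ h : Fin p → Model p → ℝ, (∀ i, ContDiff ℝ ∞ (h i)) ∧
      ∀ y, f y = f a + ∑ i, (y i - a i) * h i y := by
  -- The fundamental theorem of calculus along the segment from `a` to `y`.
  refine ⟨fun i y => ∫ t in (0 : ℝ)..1, fderiv ℝ f (a + t • (y - a)) (EuclideanSpace.single i 1),
    fun i => ?_, fun y => ?_⟩
  · refine contDiff_parametric_integral
      (F := fun z : ℝ × Model p => fderiv ℝ f (a + z.1 • (z.2 - a)) (EuclideanSpace.single i 1)) ?_
    have h1 : ContDiff ℝ ∞ (fderiv ℝ f) := hf.fderiv_right (by simp)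
    exact (h1.comp (by fun_prop)).clm_apply contDiff_const
  · have hd : ∀ t : ℝ, HasDerivAt (fun t : ℝ => f (a + t • (y - a)))
        (fderiv ℝ f (a + t • (y - a)) (y - a)) t := by
      intro t
      have h1 : HasFDerivAt f (fderiv ℝ f (a + t • (y - a))) (a + t • (y - a)) :=
        (hf.differentiable (by simp) _).hasFDerivAt
      have h2 : HasDerivAt (fun t : ℝ => a + t • (y - a)) (y - a) t := by
        simpa using ((hasDerivAt_id t).smul_const (y - a)).const_add a
      exact h1.comp_hasDerivAt t h2
    have hcont : ∀ v, Continuous fun t : ℝ => fderiv ℝ f (a + t • (y - a)) v := fun v =>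
      ((hf.continuous_fderiv (by simp)).comp (by fun_prop)).clm_apply continuous_const
    have hint := intervalIntegral.integral_eq_sub_of_hasDerivAt (a := 0) (b := 1)
      (fun t _ => hd t) ((hcont _).intervalIntegrable _ _)
    have hexp : y - a = ∑ i, (y i - a i) • EuclideanSpace.single i (1 : ℝ) := by
      ext j
      simp [Finset.sum_apply, Pi.single_apply]
    have hsum : ∀ t : ℝ, fderiv ℝ f (a + t • (y - a)) (y - a) =
        ∑ i, (y i - a i) * fderiv ℝ f (a + t • (y - a)) (EuclideanSpace.single i 1) := by
      intro t
      generalize fderiv ℝ f (a + t • (y - a)) = L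
      rw [hexp, map_sum]
      simp
    simp only [hsum] at hint
    rw [intervalIntegral.integral_finsetSum] at hint
    · simp only [intervalIntegral.integral_const_mul] at hint
      rw [hint]
      simp
    · intro i _
      exact (continuous_const.mul (hcont _)).intervalIntegrable _ _

end Hadamard

/-- A smooth function on an open set agrees near each point of it with a smooth function on the
whole space. -/
theorem exists_contDiff_eventuallyEq {p : ℕ} {f : Model p → ℝ} {s : Set (Model p)} (hs : IsOpen s)
    (hf : ContDiffOn ℝ ∞ f s) {a : Model p} (ha : a ∈ s) :
    ∃ f' : Model p → ℝ, ContDiff ℝ ∞ f' ∧ f' =ᶠ[nhds a] f := by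
  obtain ⟨r, hr, hrs⟩ := Metric.isOpen_iff.1 hs a ha
  -- The outer radius `r / 2` keeps the closed support inside the ball of radius `r`, hence in `s`.
  let φ : ContDiffBump a := ⟨r / 4, r / 2, by positivity, by linarith⟩
  refine ⟨fun y => φ y * f y, contDiff_iff_contDiffAt.2 fun y => ?_, ?_⟩
  · by_cases hy : y ∈ s
    · exact φ.contDiff.contDiffAt.mul (hf.contDiffAt (hs.mem_nhds hy))
    · have : (fun y => φ y * f y) =ᶠ[nhds y] fun _ => 0 := by
        have h1 : y ∉ tsupport φ := by
          rw [φ.tsupport_eq]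
          intro h
          refine hy (hrs ?_)
          have h2 : dist y a ≤ r / 2 := h
          rw [Metric.mem_ball]
          linarith
        filter_upwards [notMem_tsupport_iff_eventuallyEq.1 h1] with z hz
        simp [hz]
      exact contDiffAt_const.congr_of_eventuallyEq this
  · filter_upwards [φ.eventuallyEq_one] with y hy
    simp [hy]

/-- The integral of a partial derivative of a compactly supported function vanishes. -/
theorem integral_fderiv_apply_eq_zero {p : ℕ} {f : Model p → ℝ} (hf : ContDiff ℝ ∞ f)
    (hc : HasCompactSupport f) (v : Model p) : ∫ y, fderiv ℝ f y v = 0 := by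
  have h1 : Continuous fun y => fderiv ℝ f y v :=
    (hf.continuous_fderiv (by simp)).clm_apply continuous_const
  have h2 : HasCompactSupport fun y => fderiv ℝ f y v := hc.fderiv_apply ℝ v
  -- Integration by parts against the constant function `1`.
  have h := integral_mul_fderiv_eq_neg_fderiv_mul_of_integrable (μ := (volume : Measure (Model p)))
    (f := fun _ => (1 : ℝ)) (g := f) (v := v) (by simp)
    (by simpa using h1.integrable_of_hasCompactSupport h2)
    (by simpa using hf.continuous.integrable_of_hasCompactSupport hc)
    (fun _ _ => differentiableAt_const _) (fun y _ => hf.differentiable (by simp) y)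
  simpa using h

/-! ### Partial derivatives in charts -/

theorem restr_source_eq {p : ℕ} {M₀ : Type u} [TopologicalSpace M₀]
    {e : OpenPartialHomeomorph M₀ (Model p)} {V : Opens M₀}
    (hV : (V : Set M₀) ⊆ e.source) : (e.restr V).source = V := by
  rw [OpenPartialHomeomorph.restr_source' _ _ V.isOpen]
  exact Set.inter_eq_right.2 hV

theorem fderiv_self_transition {p : ℕ} {M₀ : Type u} [TopologicalSpace M₀]
    {e : OpenPartialHomeomorph M₀ (Model p)} {x : M₀}
    (hx : x ∈ e.source) :
    fderiv ℝ (fun y => e (e.symm y)) (e x) = ContinuousLinearMap.id ℝ (Model p) := by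
  have : (fun y => e (e.symm y)) =ᶠ[nhds (e x)] id := by
    filter_upwards [e.open_target.mem_nhds (e.map_source hx)] with y hy
    exact e.right_inv hy
  rw [this.fderiv_eq, fderiv_id]

section ChartCalculus

variable {p : ℕ} {M₀ : Type u} [TopologicalSpace M₀] [ChartedSpace (Model p) M₀]

/-- Evaluation of smooth functions at a point. -/
def evalAt {U : Opens M₀} (x : U) : Smooth p U →+* ℝ where
  toFun f := f x
  map_one' := rfl
  map_zero' := rfl
  map_add' _ _ := rfl
  map_mul' _ _ := rfl

theorem evalAt_apply {U : Opens M₀} (x : U) (f : Smooth p U) : evalAt x f = f x := rfl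

theorem smoothRes_apply {U V : Opens M₀} (h : V ≤ U) (f : Smooth p U) (x : V) :
    smoothRes h f x = f ⟨x, h x.2⟩ := rfl

theorem inChart_of_mem {U : Opens M₀} (e : OpenPartialHomeomorph M₀ (Model p)) (g : Smooth p U)
    {y : Model p} (hy : e.symm y ∈ U) : inChart e g y = g ⟨e.symm y, hy⟩ :=
  Subtype.val_injective.extend_apply g 0 ⟨e.symm y, hy⟩

theorem inChart_of_notMem {U : Opens M₀} (e : OpenPartialHomeomorph M₀ (Model p)) (g : Smooth p U)
    {y : Model p} (hy : e.symm y ∉ U) : inChart e g y = 0 :=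
  Function.extend_apply' _ _ _ fun ⟨x, hx⟩ => hy (hx ▸ x.2)

theorem inChart_apply {U : Opens M₀} {e : OpenPartialHomeomorph M₀ (Model p)}
    (hU : e.source = U) (g : Smooth p U) (x : U) : inChart e g (e x) = g x := by
  have hx : (x : M₀) ∈ e.source := hU ▸ x.2
  have h : e.symm (e x) ∈ U := by rw [e.left_inv hx]; exact x.2
  rw [inChart_of_mem e g h]
  congr 1
  exact Subtype.ext (e.left_inv hx)

theorem inChart_add {U : Opens M₀} (e : OpenPartialHomeomorph M₀ (Model p)) (f g : Smooth p U) :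
    inChart e (f + g) = inChart e f + inChart e g := by
  funext y
  by_cases hy : e.symm y ∈ U
  · simp only [Pi.add_apply, inChart_of_mem e _ hy]; rfl
  · simp only [Pi.add_apply, inChart_of_notMem e _ hy, add_zero]

theorem inChart_mul {U : Opens M₀} (e : OpenPartialHomeomorph M₀ (Model p)) (f g : Smooth p U) :
    inChart e (f * g) = inChart e f * inChart e g := by
  funext y
  by_cases hy : e.symm y ∈ U
  · simp only [Pi.mul_apply, inChart_of_mem e _ hy]; rfl
  · simp only [Pi.mul_apply, inChart_of_notMem e _ hy, mul_zero]

theorem inChart_differentiableAt {U : Opens M₀} {e : OpenPartialHomeomorph M₀ (Model p)}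
    (he : e ∈ charts p M₀) (hU : e.source = U) (g : Smooth p U) (x : U) :
    DifferentiableAt ℝ (inChart e g) (e x) :=
  ((inChart_contDiffOn e he hU g).contDiffAt
    (e.open_target.mem_nhds (e.map_source (hU ▸ x.2 : (x : M₀) ∈ e.source)))).differentiableAt
    (by simp)

theorem chartDeriv_apply {U : Opens M₀} (e : OpenPartialHomeomorph M₀ (Model p))
    (he : e ∈ charts p M₀) (hU : e.source = U) (i : Fin p) (g : Smooth p U) (x : U) :
    chartDeriv e he hU i g x = fderiv ℝ (inChart e g) (e x) (EuclideanSpace.single i 1) := rfl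

theorem chartDeriv_add {U : Opens M₀} (e : OpenPartialHomeomorph M₀ (Model p))
    (he : e ∈ charts p M₀) (hU : e.source = U) (i : Fin p) (f g : Smooth p U) :
    chartDeriv e he hU i (f + g) = chartDeriv e he hU i f + chartDeriv e he hU i g := by
  ext x
  rw [ContMDiffMap.coe_add, Pi.add_apply, chartDeriv_apply, inChart_add,
    fderiv_add (inChart_differentiableAt he hU f x) (inChart_differentiableAt he hU g x)]
  rfl

theorem chartDeriv_mul {U : Opens M₀} (e : OpenPartialHomeomorph M₀ (Model p))
    (he : e ∈ charts p M₀) (hU : e.source = U) (i : Fin p) (f g : Smooth p U) :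
    chartDeriv e he hU i (f * g) = f * chartDeriv e he hU i g + chartDeriv e he hU i f * g := by
  ext x
  rw [ContMDiffMap.coe_add, Pi.add_apply, ContMDiffMap.coe_mul, ContMDiffMap.coe_mul,
    Pi.mul_apply, Pi.mul_apply, chartDeriv_apply, inChart_mul,
    fderiv_mul (inChart_differentiableAt he hU f x) (inChart_differentiableAt he hU g x),
    inChart_apply hU, inChart_apply hU, chartDeriv_apply, chartDeriv_apply,
    mul_comm (fderiv ℝ (inChart e f) (e x) _)]
  rfl

/-- The partial derivative in a chart, as an additive map. -/
def chartDerivHom {U : Opens M₀} (e : OpenPartialHomeomorph M₀ (Model p))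
    (he : e ∈ charts p M₀) (hU : e.source = U) (i : Fin p) : Smooth p U →+ Smooth p U :=
  AddMonoidHom.mk' (chartDeriv e he hU i) (chartDeriv_add e he hU i)

theorem chartDerivHom_apply {U : Opens M₀} (e : OpenPartialHomeomorph M₀ (Model p))
    (he : e ∈ charts p M₀) (hU : e.source = U) (i : Fin p) (g : Smooth p U) :
    chartDerivHom e he hU i g = chartDeriv e he hU i g := rfl

theorem chartDeriv_one {U : Opens M₀} (e : OpenPartialHomeomorph M₀ (Model p))
    (he : e ∈ charts p M₀) (hU : e.source = U) (i : Fin p) :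
    chartDeriv e he hU i 1 = 0 := by
  simpa using chartDeriv_mul e he hU i 1 1

theorem chartDeriv_smul {U : Opens M₀} (e : OpenPartialHomeomorph M₀ (Model p))
    (he : e ∈ charts p M₀) (hU : e.source = U) (i : Fin p) (r : ℝ) (g : Smooth p U) :
    chartDeriv e he hU i (r • g) = r • chartDeriv e he hU i g := by
  have h : inChart e (r • g) = r • inChart e g := by
    funext y
    by_cases hy : e.symm y ∈ U
    · simp only [Pi.smul_apply, inChart_of_mem e _ hy]; rfl
    · simp only [Pi.smul_apply, inChart_of_notMem e _ hy, smul_zero]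
  ext x
  rw [chartDeriv_apply, h, fderiv_const_smul (inChart_differentiableAt he hU g x)]
  rfl

theorem chartDeriv_algebraMap {U : Opens M₀} (e : OpenPartialHomeomorph M₀ (Model p))
    (he : e ∈ charts p M₀) (hU : e.source = U) (i : Fin p) (r : ℝ) :
    chartDeriv e he hU i (algebraMap ℝ _ r) = 0 := by
  rw [Algebra.algebraMap_eq_smul_one, chartDeriv_smul, chartDeriv_one, smul_zero]

/-- The chart `e`, restricted to the open set `V`, is a chart. -/
theorem restr_mem_charts {e : OpenPartialHomeomorph M₀ (Model p)} (he : e ∈ charts p M₀)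
    (V : Opens M₀) : e.restr V ∈ charts p M₀ :=
  restr_mem_maximalAtlas (contDiffGroupoid ∞ (𝓡 p)) he V.isOpen

/-- Partial derivatives are local, and depend on the chart only through its values. -/
theorem chartDeriv_res {U V : Opens M₀} (e e' : OpenPartialHomeomorph M₀ (Model p))
    (he : e ∈ charts p M₀) (hU : e.source = U) (he' : e' ∈ charts p M₀) (hV : e'.source = V)
    (h : V ≤ U) (hee' : ∀ x ∈ V, e x = e' x) (i : Fin p) (g : Smooth p U) :
    chartDeriv e' he' hV i (smoothRes h g) = smoothRes h (chartDeriv e he hU i g) := by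
  ext x
  rw [smoothRes_apply, chartDeriv_apply, chartDeriv_apply]
  have hx : (x : M₀) ∈ e'.source := hV ▸ x.2
  have hex : e x = e' x := hee' x x.2
  change _ = fderiv ℝ (inChart e g) (e x) _
  rw [hex]
  congr 1
  apply Filter.EventuallyEq.fderiv_eq
  filter_upwards [e'.open_target.mem_nhds (e'.map_source hx)] with y hy
  have h1 : e'.symm y ∈ V := by
    have := e'.map_target hy
    rw [hV] at this
    exact this
  have h2 : e.symm y = e'.symm y := by
    have h3 : e (e'.symm y) = y := by rw [hee' _ h1, e'.right_inv hy]
    conv_lhs => rw [← h3]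
    exact e.left_inv (hU ▸ h h1)
  have h4 : e.symm y ∈ U := h2 ▸ h h1
  rw [inChart_of_mem _ _ h1, inChart_of_mem _ _ h4, smoothRes_apply]
  congr 1
  exact Subtype.ext h2.symm

theorem chartCoord_apply {U : Opens M₀} (e : OpenPartialHomeomorph M₀ (Model p))
    (he : e ∈ charts p M₀) (hU : e.source = U) (i : Fin p) (x : U) :
    chartCoord e he hU i x = e x i := rfl

theorem contDiffAt_transition {e e' : OpenPartialHomeomorph M₀ (Model p)} (he : e ∈ charts p M₀)
    (he' : e' ∈ charts p M₀) {x : M₀} (hx : x ∈ e.source) (hx' : x ∈ e'.source) :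
    ContDiffAt ℝ ∞ (fun y => e (e'.symm y)) (e' x) := by
  rw [← contMDiffAt_iff_contDiffAt]
  have h1 := contMDiffAt_symm_of_mem_maximalAtlas he' (e'.map_source hx')
  have h2 : ContMDiffAt (𝓡 p) (𝓡 p) ∞ e (e'.symm (e' x)) := by
    rw [e'.left_inv hx']
    exact contMDiffAt_of_mem_maximalAtlas he hx
  exact h2.comp (e' x) h1

theorem chartDeriv_chartCoord {U : Opens M₀} (e e' : OpenPartialHomeomorph M₀ (Model p))
    (he : e ∈ charts p M₀) (hU : e.source = U) (he' : e' ∈ charts p M₀) (hU' : e'.source = U)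
    (i j : Fin p) (x : U) :
    chartDeriv e' he' hU' i (chartCoord e he hU j) x =
      (fderiv ℝ (fun y => e (e'.symm y)) (e' x) (EuclideanSpace.single i 1)) j := by
  have hx : (x : M₀) ∈ e.source := hU ▸ x.2
  have hx' : (x : M₀) ∈ e'.source := hU' ▸ x.2
  have h1 : inChart e' (chartCoord e he hU j) =ᶠ[nhds (e' x)] fun y => e (e'.symm y) j := by
    filter_upwards [e'.open_target.mem_nhds (e'.map_source hx')] with y hy
    have h1 : e'.symm y ∈ U := by
      have := e'.map_target hy
      rw [hU'] at this
      exact this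
    rw [inChart_of_mem _ _ h1, chartCoord_apply]
  rw [chartDeriv_apply, h1.fderiv_eq]
  have h2 := (contDiffAt_transition he he' hx hx').differentiableAt (by simp)
  have h3 := ((EuclideanSpace.proj j : Model p →L[ℝ] ℝ).hasFDerivAt.comp (e' x) h2.hasFDerivAt)
  exact DFunLike.congr_fun h3.fderiv _

theorem chartDeriv_chartCoord_self {U : Opens M₀} (e : OpenPartialHomeomorph M₀ (Model p))
    (he : e ∈ charts p M₀) (hU : e.source = U) (i j : Fin p) :
    chartDeriv e he hU i (chartCoord e he hU j) = if i = j then 1 else 0 := by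
  ext x
  rw [chartDeriv_chartCoord, fderiv_self_transition (hU ▸ x.2 : (x : M₀) ∈ e.source)]
  by_cases h : i = j
  · subst h; simp
  · simp [h, Ne.symm h]

/-- The determinant of the matrix of partial derivatives is that of the derivative. -/
theorem det_chartDeriv {U : Opens M₀} (e e' : OpenPartialHomeomorph M₀ (Model p))
    (he : e ∈ charts p M₀) (hU : e.source = U) (he' : e' ∈ charts p M₀) (hU' : e'.source = U)
    (x : U) :
    (Matrix.of fun i j => chartDeriv e' he' hU' i (chartCoord e he hU j)).det x =
      (fderiv ℝ (fun y => e (e'.symm y)) (e' x)).det := by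
  change evalAt x (Matrix.det _) = _
  -- The transposition arises because the rows of `∂u/∂v` are indexed by the variables of
  -- differentiation.
  rw [RingHom.map_det, ContinuousLinearMap.det,
    ← LinearMap.det_toMatrix (EuclideanSpace.basisFun (Fin p) ℝ).toBasis, ← Matrix.det_transpose]
  congr 1
  ext j i
  rw [LinearMap.toMatrix_apply]
  simp only [Matrix.transpose_apply, RingHom.mapMatrix_apply, Matrix.map_apply, Matrix.of_apply]
  refine (chartDeriv_chartCoord e e' he hU he' hU' i j x).trans ?_
  simp

/-- The chain rule for mutually inverse transition maps. It shows that the Jacobian vanishes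
nowhere, as `smoothSign_apply` requires. -/
theorem det_transition_mul {e e' : OpenPartialHomeomorph M₀ (Model p)} (he : e ∈ charts p M₀)
    (he' : e' ∈ charts p M₀) {x : M₀} (hx : x ∈ e.source) (hx' : x ∈ e'.source) :
    (fderiv ℝ (fun y => e' (e.symm y)) (e x)).det *
      (fderiv ℝ (fun y => e (e'.symm y)) (e' x)).det = 1 := by
  have h1 := (contDiffAt_transition he he' hx hx').differentiableAt (by simp)
  have h2 := (contDiffAt_transition he' he hx' hx).differentiableAt (by simp)
  have hee : e (e'.symm (e' x)) = e x := by rw [e'.left_inv hx']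
  have h3 : HasFDerivAt (fun y => e' (e.symm y)) (fderiv ℝ (fun y => e' (e.symm y)) (e x))
      (e (e'.symm (e' x))) := by rw [hee]; exact h2.hasFDerivAt
  have h4 := h3.comp (e' x) h1.hasFDerivAt
  have h5 : (fun y => e' (e.symm y)) ∘ (fun y => e (e'.symm y)) =ᶠ[nhds (e' x)] id := by
    have hc : ContinuousAt e'.symm (e' x) := e'.continuousAt_symm (e'.map_source hx')
    have hs : e.source ∈ nhds (e'.symm (e' x)) := by
      rw [e'.left_inv hx']; exact e.open_source.mem_nhds hx
    filter_upwards [hc hs, e'.open_target.mem_nhds (e'.map_source hx')] with y hy hy'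
    change e' (e.symm (e (e'.symm y))) = y
    rw [e.left_inv hy, e'.right_inv hy']
  have h6 := (h4.congr_of_eventuallyEq h5.symm).unique (hasFDerivAt_id (e' x))
  rw [ContinuousLinearMap.det, ContinuousLinearMap.det, ← LinearMap.det_comp]
  have h8 := congrArg (fun L : Model p →L[ℝ] Model p => LinearMap.det (L : Model p →ₗ[ℝ] Model p)) h6
  simpa using h8

/-- Hadamard's lemma on a manifold. -/
theorem exists_smoothRes_eq_add_sum_mul {W : Opens M₀} (g : Smooth p W)
    (e : OpenPartialHomeomorph M₀ (Model p)) (he : e ∈ charts p M₀) (a : W)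
    (ha : (a : M₀) ∈ e.source) :
    ∃ (V : Opens M₀) (_ : V ≤ W) (_ : (a : M₀) ∈ V) (h : Fin p → Smooth p V),
      (V : Set M₀) ⊆ e.source ∧
      ∀ y (hy : y ∈ W) (hyV : y ∈ V), g ⟨y, hy⟩ = g a + ∑ i, (e y i - e a i) * h i ⟨y, hyV⟩ := by
  let V₀ : Opens M₀ := W ⊓ ⟨e.source, e.open_source⟩
  have hV₀ : (V₀ : Set M₀) ⊆ e.source := fun _ h => h.2
  let e₀ := e.restr V₀
  have hs : e₀.source = V₀ := restr_source_eq hV₀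
  let g₀ : Smooth p V₀ := smoothRes inf_le_left g
  have haV₀ : (a : M₀) ∈ V₀ := ⟨a.2, ha⟩
  have hat : e a ∈ e₀.target := e₀.map_source (by rw [hs]; exact haV₀)
  -- The target of the chart need not contain the segments from `e a`. Hadamard's lemma is therefore
  -- applied to a function on the whole model space that agrees with `g₀` near `e a`.
  obtain ⟨f, hf, hfg⟩ := exists_contDiff_eventuallyEq e₀.open_target
    (inChart_contDiffOn e₀ (restr_mem_charts he V₀) hs g₀) hat
  obtain ⟨h, hh, hfh⟩ := exists_eq_add_sum_mul hf (e a)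
  obtain ⟨t, ht, hto, hta⟩ := eventually_nhds_iff.1 hfg
  let V : Opens M₀ := ⟨e₀.source ∩ e₀ ⁻¹' t, e₀.isOpen_inter_preimage hto⟩
  have hVV₀ : V ≤ V₀ := fun y hy => by
    have := hy.1
    rw [hs] at this
    exact this
  have hval : ∀ y (hy : y ∈ V₀), y ∈ V → f (e y) = g₀ ⟨y, hy⟩ := fun y hy hyV => by
    rw [ht (e y) hyV.2]
    exact inChart_apply hs g₀ ⟨y, hy⟩
  have haV : (a : M₀) ∈ V := ⟨by rw [hs]; exact haV₀, hta⟩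
  refine ⟨V, hVV₀.trans inf_le_left, haV,
    fun i => toSmooth (fun y : V => h i (e y)) fun y => ?_, fun y hy => hV₀ (hVV₀ hy), ?_⟩
  · have h1 : ContMDiffAt (𝓡 p) (𝓡 p) ∞ (fun y : V => e y) y := contMDiffAt_subtype_iff.2
      (contMDiffAt_of_mem_maximalAtlas he (hV₀ (hVV₀ y.2)))
    exact ((hh i).contMDiff.contMDiffAt).comp y h1
  · intro y hy hyV
    have h1 := hval y (hVV₀ hyV) hyV
    have h2 := hval a haV₀ haV
    change f (e y) = g ⟨y, hy⟩ at h1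
    change f (e a) = g a at h2
    rw [← h1, ← h2]
    exact hfh (e y)

/-- The integral of a partial derivative of a function with compact support in the domain of the
chart vanishes. -/
theorem integral_chartDeriv_eq_zero [T2Space M₀] {U : Opens M₀}
    (e : OpenPartialHomeomorph M₀ (Model p))
    (he : e ∈ charts p M₀) (hU : e.source = U) (i : Fin p) (h : Smooth p U) (K : Set M₀)
    (hK : IsCompact K) (hKU : K ⊆ U) (hh : ∀ x : U, (x : M₀) ∉ K → h x = 0) :
    ∫ y in e.target, inChart e (chartDeriv e he hU i h) y = 0 := by
  -- Extension by zero. It is smooth since it vanishes on the open complement of the compact set `e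
  -- '' K`, which lies inside the target.
  let f : Model p → ℝ := e.target.indicator (inChart e h)
  have hKe : IsCompact (e '' K) :=
    hK.image_of_continuousOn (e.continuousOn.mono (hU ▸ hKU : K ⊆ e.source))
  have hf0 : ∀ y, y ∉ e '' K → f y = 0 := by
    intro y hy
    by_cases hyt : y ∈ e.target
    · have h1 : e.symm y ∈ U := by
        have := e.map_target hyt
        rw [hU] at this
        exact this
      simp only [f, Set.indicator_of_mem hyt]
      rw [inChart_of_mem _ _ h1]
      refine hh _ fun h2 => hy ⟨_, h2, e.right_inv hyt⟩
    · exact Set.indicator_of_notMem hyt _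
  have hft : ∀ y ∈ e.target, f =ᶠ[nhds y] inChart e h := fun y hy => by
    filter_upwards [e.open_target.mem_nhds hy] with z hz
    exact Set.indicator_of_mem hz _
  have hfn : ∀ y, y ∉ e '' K → f =ᶠ[nhds y] fun _ => 0 := fun y hy => by
    filter_upwards [hKe.isClosed.isOpen_compl.mem_nhds hy] with z hz
    exact hf0 z hz
  have hsub : e '' K ⊆ e.target := by
    rintro _ ⟨x, hx, rfl⟩
    exact e.map_source (hU ▸ hKU hx)
  have hfs : ContDiff ℝ ∞ f := contDiff_iff_contDiffAt.2 fun y => by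
    by_cases hy : y ∈ e '' K
    · exact ((inChart_contDiffOn e he hU h).contDiffAt
        (e.open_target.mem_nhds (hsub hy))).congr_of_eventuallyEq (hft y (hsub hy))
    · exact contDiffAt_const.congr_of_eventuallyEq (hfn y hy)
  have hfc : HasCompactSupport f := HasCompactSupport.intro hKe hf0
  have := integral_fderiv_apply_eq_zero hfs hfc (EuclideanSpace.single i 1)
  rw [← this, ← integral_indicator e.open_target.measurableSet]
  congr 1
  funext y
  by_cases hy : y ∈ e.target
  · have h1 : e.symm y ∈ U := by
      have := e.map_target hy
      rw [hU] at this
      exact this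
    rw [Set.indicator_of_mem hy, inChart_of_mem _ _ h1, chartDeriv_apply, (hft y hy).fderiv_eq,
      e.right_inv hy]
  · have : y ∉ e '' K := fun h => hy (hsub h)
    rw [Set.indicator_of_notMem hy, (hfn y this).fderiv_eq]
    simp

end ChartCalculus

/-! ### Integration of densities -/

section Integration

theorem measurableSet_image_inter_source {X Y : Type*} [TopologicalSpace X] [MeasurableSpace X]
    [BorelSpace X] [TopologicalSpace Y] [MeasurableSpace Y] [BorelSpace Y]
    (e : OpenPartialHomeomorph X Y) {B : Set X} (hB : MeasurableSet B) :
    MeasurableSet (e '' (e.source ∩ B)) := by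
  rw [e.image_source_inter_eq']
  have h : Continuous (e.target.domRestrict e.symm) :=
    continuousOn_iff_continuous_domRestrict.1 e.continuousOn_symm
  have h1 : e.target ∩ e.symm ⁻¹' B = Subtype.val '' (e.target.domRestrict e.symm ⁻¹' B) := by
    ext y
    constructor
    · rintro ⟨h1, h2⟩
      exact ⟨⟨y, h1⟩, h2, rfl⟩
    · rintro ⟨z, h1, rfl⟩
      exact ⟨z.2, h1⟩
  rw [h1]
  exact e.open_target.measurableSet.subtype_image (h.measurable hB)

variable {p : ℕ} {M₀ : Type u} [TopologicalSpace M₀] [ChartedSpace (Model p) M₀]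

/-- The coefficient function of a density in a chart, as a function on the model space. -/
def Density.reading (ρ : Density p M₀) (e : OpenPartialHomeomorph M₀ (Model p)) (y : Model p) : ℝ :=
  ρ.val e (e.symm y)

theorem Density.reading_continuousOn (ρ : Density p M₀) {e : OpenPartialHomeomorph M₀ (Model p)}
    (he : e ∈ charts p M₀) : ContinuousOn (ρ.reading e) e.target :=
  (ρ.smooth e he).continuousOn.comp e.continuousOn_symm fun _ hy => e.map_target hy

/-- The density `ρ` vanishes outside of `K`. -/
def Density.VanishesOff (ρ : Density p M₀) (K : Set M₀) : Prop :=
  ∀ e ∈ charts p M₀, ∀ x ∈ e.source, x ∉ K → ρ.val e x = 0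

theorem Density.VanishesOff.integrableOn {ρ : Density p M₀}
    {e : OpenPartialHomeomorph M₀ (Model p)} (he : e ∈ charts p M₀) {K : Set M₀}
    (hK : IsCompact K) (hKe : K ⊆ e.source) (hρ : ρ.VanishesOff K) :
    IntegrableOn (ρ.reading e) e.target volume := by
  have hK' : IsCompact (e '' K) := hK.image_of_continuousOn (e.continuousOn.mono hKe)
  have hsub : e '' K ⊆ e.target := by
    rintro _ ⟨x, hx, rfl⟩
    exact e.map_source (hKe hx)
  refine IntegrableOn.of_forall_sdiff_eq_zero
    (((ρ.reading_continuousOn he).mono hsub).integrableOn_compact hK')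
    e.open_target.measurableSet fun y hy => ?_
  refine hρ e he _ (e.map_target hy.1) fun h => hy.2 ⟨_, h, e.right_inv hy.1⟩

/-- The change of variables formula for densities. -/
theorem Density.setIntegral_change (ρ : Density p M₀) {e e' : OpenPartialHomeomorph M₀ (Model p)}
    (he : e ∈ charts p M₀) (he' : e' ∈ charts p M₀) {B : Set M₀} (hB : MeasurableSet[borel M₀] B)
    (hBe : B ⊆ e.source) (hBe' : B ⊆ e'.source) (F : ℝ → ℝ) (hF : ∀ a b, F (|a| * b) = |a| * F b) :
    (IntegrableOn (fun y => F (ρ.reading e y)) (e '' B) volume ↔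
      IntegrableOn (fun y => F (ρ.reading e' y)) (e' '' B) volume) ∧
    ∫ y in e '' B, F (ρ.reading e y) = ∫ y in e' '' B, F (ρ.reading e' y) := by
  let _ : MeasurableSpace M₀ := borel M₀
  have _ : BorelSpace M₀ := ⟨rfl⟩
  have hs : MeasurableSet (e' '' B) := by
    rw [← Set.inter_eq_right.2 hBe']
    exact measurableSet_image_inter_source e' hB
  let φ : Model p → Model p := fun y => e (e'.symm y)
  have hφ : φ '' (e' '' B) = e '' B := by
    rw [Set.image_image]
    exact Set.image_congr fun x hx => by simp only [φ, e'.left_inv (hBe' hx)]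
  have hd : ∀ y ∈ e' '' B, HasFDerivWithinAt φ (fderiv ℝ φ y) (e' '' B) y := by
    rintro _ ⟨x, hx, rfl⟩
    exact ((contDiffAt_transition he he' (hBe hx) (hBe' hx)).differentiableAt
      (by simp)).hasFDerivAt.hasFDerivWithinAt
  have hinj : Set.InjOn φ (e' '' B) := by
    rintro _ ⟨x, hx, rfl⟩ _ ⟨z, hz, rfl⟩ h
    simp only [φ, e'.left_inv (hBe' hx), e'.left_inv (hBe' hz)] at h
    rw [e.injOn (hBe hx) (hBe hz) h]
  have hval : ∀ y ∈ e' '' B,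
      |(fderiv ℝ φ y).det| • F (ρ.reading e (φ y)) = F (ρ.reading e' y) := by
    rintro _ ⟨x, hx, rfl⟩
    simp only [φ, Density.reading, e'.left_inv (hBe' hx), e.left_inv (hBe hx), smul_eq_mul]
    rw [ρ.change e he e' he' x ⟨hBe hx, hBe' hx⟩, mul_comm (ρ.val e x), hF]
  have h1 := integrableOn_image_iff_integrableOn_abs_det_fderiv_smul volume hs hd hinj
    (fun y => F (ρ.reading e y))
  have h2 := integral_image_eq_integral_abs_det_fderiv_smul volume hs hd hinj
    (fun y => F (ρ.reading e y))
  rw [hφ] at h1 h2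
  refine ⟨h1.trans (integrableOn_congr_fun hval hs), h2.trans (setIntegral_congr_fun hs hval)⟩

/-- A density with compact support in the domain of a chart is integrable, and its integral can be
computed in that chart. -/
theorem Density.VanishesOff.hasIntegral {ρ : Density p M₀}
    {e : OpenPartialHomeomorph M₀ (Model p)} (he : e ∈ charts p M₀) {K : Set M₀}
    (hK : IsCompact K) (hKe : K ⊆ e.source) (hρ : ρ.VanishesOff K) :
    ρ.HasIntegral (∫ y in e.target, ρ.reading e y) := by
  intro P
  let _ : MeasurableSpace M₀ := borel M₀
  have _ : BorelSpace M₀ := ⟨rfl⟩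
  have : Countable P.ι := P.countable
  -- The part of each piece that is visible in `e`. On the rest of the piece the density vanishes,
  -- because `K` lies in the domain of `e`.
  let B : P.ι → Set M₀ := fun n => e.source ∩ P.piece n
  have hB : ∀ n, MeasurableSet (B n) := fun n =>
    e.open_source.measurableSet.inter (P.measurable n)
  have hBe : ∀ n, B n ⊆ e.source := fun n => Set.inter_subset_left
  have hBn : ∀ n, B n ⊆ (P.chart n).source := fun n =>
    Set.inter_subset_right.trans (P.subset n)
  have hs : ∀ n, MeasurableSet (e '' B n) := fun n =>
    measurableSet_image_inter_source e (P.measurable n)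
  have hs' : ∀ n, MeasurableSet (P.chart n '' P.piece n) := fun n => by
    rw [← Set.inter_eq_right.2 (P.subset n)]
    exact measurableSet_image_inter_source _ (P.measurable n)
  have hsub : ∀ n, P.chart n '' B n ⊆ P.chart n '' P.piece n := fun n =>
    Set.image_mono Set.inter_subset_right
  have hzero : ∀ n, ∀ y ∈ (P.chart n '' P.piece n) \ (P.chart n '' B n),
      ρ.reading (P.chart n) y = 0 := by
    rintro n _ ⟨⟨x, hx, rfl⟩, hy⟩
    rw [Density.reading, (P.chart n).left_inv (P.subset n hx)]
    refine hρ _ (P.chart_mem n) x (P.subset n hx) fun hxK => hy ⟨x, ⟨hKe hxK, hx⟩, rfl⟩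
  have hint := hρ.integrableOn he hK hKe
  have hunion : ⋃ n, e '' B n = e.target := by
    rw [← Set.image_iUnion, ← Set.inter_iUnion, P.cover, Set.inter_univ, e.image_source_eq_target]
  have hdisj : Pairwise (Function.onFun Disjoint fun n => e '' B n) := by
    intro m n hmn
    refine Set.disjoint_left.2 ?_
    rintro _ ⟨x, hx, rfl⟩ ⟨z, hz, h⟩
    rw [e.injOn (hBe n hz) (hBe m hx) h] at hz
    exact Set.disjoint_left.1 (P.disjoint hmn) hx.2 hz.2
  -- With `F = id` this yields the integral, and with `F = |·|` the absolute summability.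
  have key : ∀ F : ℝ → ℝ, (∀ a b, F (|a| * b) = |a| * F b) → F 0 = 0 →
      IntegrableOn (fun y => F (ρ.reading e y)) e.target volume →
      (∀ n, IntegrableOn (fun y => F (ρ.reading (P.chart n) y)) (P.chart n '' P.piece n) volume) ∧
      HasSum (fun n => ∫ y in P.chart n '' P.piece n, F (ρ.reading (P.chart n) y))
        (∫ y in e.target, F (ρ.reading e y)) := by
    intro F hF hF0 hi
    have hc := fun n => ρ.setIntegral_change he (P.chart_mem n) (hB n) (hBe n) (hBn n) F hF
    rw [← hunion] at hi ⊢
    constructor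
    · intro n
      refine IntegrableOn.of_forall_sdiff_eq_zero ((hc n).1.1 (hi.mono_set ?_)) (hs' n) ?_
      · exact Set.subset_iUnion (fun n => e '' B n) n
      · intro y hy
        simp only [hzero n y hy, hF0]
    · refine (hasSum_integral_iUnion hs hdisj hi).congr_fun fun n => ?_
      rw [(hc n).2]
      refine setIntegral_eq_of_subset_of_forall_sdiff_eq_zero (hs' n) (hsub n) ?_
      intro y hy
      simp only [hzero n y hy, hF0]
  have h1 := key id (by simp) rfl hint
  have h2 := key (fun a => |a|) (by simp [abs_mul]) abs_zero hint.abs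
  exact ⟨h1.1, h2.2.summable, h1.2⟩

/-- `HasIntegral` quantifies over all chart partitions, so uniqueness rests on the existence of one.
-/
theorem Density.HasIntegral.unique [SecondCountableTopology M₀] [IsManifold (𝓡 p) ∞ M₀]
    {ρ : Density p M₀} {I J : ℝ} (hI : ρ.HasIntegral I) (hJ : ρ.HasIntegral J) : I = J := by
  obtain ⟨P⟩ := ChartPartition.nonempty p M₀
  exact (hI P).2.2.unique (hJ P).2.2

/-- A finite sum of integrable densities is integrable, and the integral is additive. -/
theorem Density.hasIntegral_of_eq_sum {ι : Type*} (s : Finset ι) {ρ : Density p M₀}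
    {τ : ι → Density p M₀} {I : ι → ℝ} (hτ : ∀ i ∈ s, (τ i).HasIntegral (I i))
    (h : ∀ e ∈ charts p M₀, ∀ x ∈ e.source, ρ.val e x = ∑ i ∈ s, (τ i).val e x) :
    ρ.HasIntegral (∑ i ∈ s, I i) := by
  intro P
  let _ : MeasurableSpace M₀ := borel M₀
  have _ : BorelSpace M₀ := ⟨rfl⟩
  have hs' : ∀ n, MeasurableSet (P.chart n '' P.piece n) := fun n => by
    rw [← Set.inter_eq_right.2 (P.subset n)]
    exact measurableSet_image_inter_source _ (P.measurable n)
  have heq : ∀ n, ∀ y ∈ P.chart n '' P.piece n, ρ.val (P.chart n) ((P.chart n).symm y) =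
      ∑ i ∈ s, (τ i).val (P.chart n) ((P.chart n).symm y) := by
    rintro n _ ⟨x, hx, rfl⟩
    rw [(P.chart n).left_inv (P.subset n hx)]
    exact h _ (P.chart_mem n) x (P.subset n hx)
  have hi : ∀ n, IntegrableOn (fun y => ∑ i ∈ s, (τ i).val (P.chart n) ((P.chart n).symm y))
      (P.chart n '' P.piece n) volume := fun n =>
    integrable_finsetSum _ fun i hi => (hτ i hi P).1 n
  refine ⟨fun n => (hi n).congr_fun (fun y hy => (heq n y hy).symm) (hs' n), ?_, ?_⟩
  · refine Summable.of_nonneg_of_le (fun n => integral_nonneg fun _ => abs_nonneg _) (fun n => ?_)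
      (summable_sum fun i hi => (hτ i hi P).2.1)
    rw [← integral_finsetSum _ fun i hi => ((hτ i hi P).1 n).abs]
    refine setIntegral_mono_on ?_ (integrable_finsetSum _ fun i hi => ((hτ i hi P).1 n).abs)
      (hs' n) fun y hy => ?_
    · exact ((hi n).congr_fun (fun y hy => (heq n y hy).symm) (hs' n)).abs
    · rw [heq n y hy]
      exact Finset.abs_sum_le_sum_abs _ _
  · convert hasSum_sum fun i hi => (hτ i hi P).2.2 using 2 with n
    rw [← integral_finsetSum _ fun i hi => (hτ i hi P).1 n]
    exact setIntegral_congr_fun (hs' n) (heq n)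

end Integration

/-! ### Grassmann frames of a supermanifold -/

section Frames

namespace SuperalgebraSheaf

variable {X : Type u} [TopologicalSpace X] (𝒪 : SuperalgebraSheaf X)

theorem res_self {U : Opens X} (h : U ≤ U) (a : 𝒪.Sec U) : 𝒪.res h a = a := by
  have : 𝒪.sheaf.presheaf.map (homOfLE h).op = 𝟙 _ := 𝒪.sheaf.presheaf.map_id (op U)
  simp only [SuperalgebraSheaf.res, this]
  rfl

theorem parity_induction {U : Opens X} {P : 𝒪.Sec U → Prop} (h0 : ∀ a ∈ 𝒪.parity U 0, P a)
    (h1 : ∀ a ∈ 𝒪.parity U 1, P a) (hadd : ∀ a b, P a → P b → P (a + b)) (a : 𝒪.Sec U) : P a := by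
  have : a ∈ 𝒪.parity U 0 ⊔ 𝒪.parity U 1 := by
    rw [(𝒪.isCompl U).sup_eq_top]; exact Submodule.mem_top
  obtain ⟨b, hb, c, hc, rfl⟩ := Submodule.mem_sup.1 this
  exact hadd _ _ (h0 b hb) (h1 c hc)

theorem even_comm {U : Opens X} {a : 𝒪.Sec U} (ha : a ∈ 𝒪.parity U 0) (b : 𝒪.Sec U) :
    a * b = b * a := by
  refine 𝒪.parity_induction (P := fun b => a * b = b * a) ?_ ?_ ?_ b
  · intro b hb; simpa using 𝒪.supercomm U 0 0 a b ha hb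
  · intro b hb; simpa using 𝒪.supercomm U 0 1 a b ha hb
  · intro b c hb hc; rw [mul_add, add_mul, hb, hc]

theorem odd_anticomm {U : Opens X} {a b : 𝒪.Sec U} (ha : a ∈ 𝒪.parity U 1)
    (hb : b ∈ 𝒪.parity U 1) : a * b = -(b * a) := by
  simpa [ZMod.val_one] using 𝒪.supercomm U 1 1 a b ha hb

theorem odd_sq {U : Opens X} {a : 𝒪.Sec U} (ha : a ∈ 𝒪.parity U 1) : a * a = 0 := by
  have h := 𝒪.odd_anticomm ha ha
  have h2 : (2 : ℝ) • (a * a) = 0 := by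
    rw [two_smul]
    nth_rewrite 1 [h]
    exact neg_add_cancel _
  exact (smul_eq_zero.1 h2).resolve_left two_ne_zero

theorem mul_mem_parity {U : Opens X} {i j : ZMod 2} {a b : 𝒪.Sec U} (ha : a ∈ 𝒪.parity U i)
    (hb : b ∈ 𝒪.parity U j) : a * b ∈ 𝒪.parity U (i + j) :=
  (𝒪.graded U).mul_mem ha hb

theorem one_mem_parity (U : Opens X) : (1 : 𝒪.Sec U) ∈ 𝒪.parity U 0 := (𝒪.graded U).one_mem

end SuperalgebraSheaf

variable {p q : ℕ} {M₀ : Type u} [TopologicalSpace M₀] [ChartedSpace (Model p) M₀]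

namespace Splitting

variable {𝒪 : SuperalgebraSheaf M₀} {U : Opens M₀}

/-- The presentation of the sections over `W` as a Grassmann algebra over `C^∞(W)`. -/
def frame (σ : Splitting (p := p) q 𝒪 U) (W : Opens M₀) (hW : W ≤ U) :
    GrassmannFrame q (Smooth p W) (𝒪.Sec W) where
  incl := (σ.pullback W hW : Smooth p W →+* 𝒪.Sec W)
  gen j := 𝒪.res hW (σ.odd j)
  incl_comm c a := 𝒪.even_comm (σ.pullback_even W hW c) a
  gen_anti i j := 𝒪.odd_anticomm (𝒪.map_parity hW 1 _ (σ.odd_mem i))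
    (𝒪.map_parity hW 1 _ (σ.odd_mem j))
  gen_sq i := 𝒪.odd_sq (𝒪.map_parity hW 1 _ (σ.odd_mem i))
  bijective := σ.bijective W hW

theorem frame_incl (σ : Splitting (p := p) q 𝒪 U) (W : Opens M₀) (hW : W ≤ U) (c : Smooth p W) :
    (σ.frame W hW).incl c = σ.pullback W hW c := rfl

theorem gen_mem_parity (σ : Splitting (p := p) q 𝒪 U) (W : Opens M₀) (hW : W ≤ U) (j : Fin q) :
    (σ.frame W hW).gen j ∈ 𝒪.parity W 1 := 𝒪.map_parity hW 1 _ (σ.odd_mem j)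

theorem mono_mem_parity (σ : Splitting (p := p) q 𝒪 U) (W : Opens M₀) (hW : W ≤ U)
    (ν : Finset (Fin q)) : (σ.frame W hW).mono ν ∈ 𝒪.parity W (ν.card : ZMod 2) := by
  induction ν using Finset.induction_on_min with
  | empty =>
    rw [GrassmannFrame.mono_empty, Finset.card_empty, Nat.cast_zero]
    exact 𝒪.one_mem_parity W
  | insert j s hj ih =>
    rw [GrassmannFrame.mono_insert_of_lt _ j s hj,
      Finset.card_insert_of_notMem fun h => lt_irrefl _ (hj j h), Nat.cast_add, Nat.cast_one,
      add_comm]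
    exact 𝒪.mul_mem_parity (σ.gen_mem_parity W hW j) ih

/-- The terms of the wrong parity add up to a section `b` of parity `i + 1`. Being the difference of
`a` and the remaining terms, `b` also has parity `i`, so it vanishes. Thus the grading of the sheaf
is the one by the degree in the odd coordinates. -/
theorem coeff_eq_zero_of_mem_parity (σ : Splitting (p := p) q 𝒪 U) (W : Opens M₀) (hW : W ≤ U)
    {i : ZMod 2} {a : 𝒪.Sec W} (ha : a ∈ 𝒪.parity W i) {ν : Finset (Fin q)}
    (hν : (ν.card : ZMod 2) ≠ i) : (σ.frame W hW).coeff ν a = 0 := by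
  set x := σ.frame W hW
  have hmem : ∀ μ, x.incl (x.coeff μ a) * x.mono μ ∈ 𝒪.parity W (μ.card : ZMod 2) := fun μ => by
    have := 𝒪.mul_mem_parity (σ.pullback_even W hW (x.coeff μ a)) (σ.mono_mem_parity W hW μ)
    rwa [zero_add] at this
  have htwo : ∀ j k : ZMod 2, j ≠ k → j = k + 1 := by decide
  let b : 𝒪.Sec W := ∑ μ with ¬(μ.card : ZMod 2) = i, x.incl (x.coeff μ a) * x.mono μ
  let c : 𝒪.Sec W := ∑ μ with (μ.card : ZMod 2) = i, x.incl (x.coeff μ a) * x.mono μ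
  have hcb : c + b = a := by
    simp only [c, b]
    rw [Finset.sum_filter_add_sum_filter_not]
    exact x.sum_coeff a
  have hc : c ∈ 𝒪.parity W i := by
    refine sum_mem fun μ hμ => ?_
    have := hmem μ
    rwa [(Finset.mem_filter.1 hμ).2] at this
  have hb : b ∈ 𝒪.parity W (i + 1) := by
    refine sum_mem fun μ hμ => ?_
    have := hmem μ
    rwa [htwo _ _ (Finset.mem_filter.1 hμ).2] at this
  have hb' : b ∈ 𝒪.parity W i := by
    have : b = a - c := by rw [← hcb]; abel
    rw [this]
    exact sub_mem ha hc
  have hb0 : b = 0 := by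
    have hd := (𝒪.isCompl W).disjoint
    have hcase : ∀ i : ZMod 2, (i = 0 ∧ i + 1 = 1) ∨ (i = 1 ∧ i + 1 = 0) := by decide
    rcases hcase i with ⟨h1, h2⟩ | ⟨h1, h2⟩
    · rw [h1] at hb'; rw [h2] at hb
      exact Submodule.disjoint_def.1 hd b hb' hb
    · rw [h1] at hb'; rw [h2] at hb
      exact Submodule.disjoint_def.1 hd b hb hb'
  have h1 : x.coeff ν a = x.coeff ν c := by rw [← hcb, hb0, add_zero]
  rw [h1, map_sum]
  refine Finset.sum_eq_zero fun μ hμ => ?_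
  rw [x.coeff_incl_mul_mono, if_neg]
  rintro rfl
  exact hν (Finset.mem_filter.1 hμ).2

theorem isOdd_of_mem_parity (σ : Splitting (p := p) q 𝒪 U) (W : Opens M₀) (hW : W ≤ U)
    {a : 𝒪.Sec W} (ha : a ∈ 𝒪.parity W 1) : (σ.frame W hW).IsOdd a := by
  intro ν hν
  refine σ.coeff_eq_zero_of_mem_parity W hW ha ?_
  rw [(ZMod.natCast_eq_zero_iff_even).2 hν]
  decide

end Splitting

namespace Supermanifold

variable (M : Supermanifold p q M₀) {U : Opens M₀}

/-- An odd section has square zero, and a real function with square zero vanishes. -/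
theorem body_of_mem_parity_one {W : Opens M₀} {a : M.Sec W} (ha : a ∈ M.parity W 1) :
    M.body W a = 0 := by
  have h := congrArg (M.body W) (M.odd_sq ha)
  rw [map_mul, map_zero] at h
  ext x
  have := congrArg (fun f : Smooth p W => f x) h
  exact mul_self_eq_zero.1 this

/-- The term of degree zero is `j^*`, whatever the splitting. Hence `fil 1` is the kernel of `j^*`
and does not depend on the splitting. -/
theorem frame_body (σ : Splitting (p := p) q M.toSuperalgebraSheaf U) (W : Opens M₀) (hW : W ≤ U)
    (a : M.Sec W) : (σ.frame W hW).body a = M.body W a := by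
  have key : ∀ (c : Smooth p W) (ν : Finset (Fin q)),
      (σ.frame W hW).body ((σ.frame W hW).incl c * (σ.frame W hW).mono ν) =
        M.body W ((σ.frame W hW).incl c * (σ.frame W hW).mono ν) := by
    intro c ν
    rw [GrassmannFrame.body_apply, GrassmannFrame.coeff_incl_mul_mono, map_mul,
      Splitting.frame_incl, M.body_pullback]
    split_ifs with h
    · rw [← h, GrassmannFrame.mono_empty, map_one, mul_one]
    · obtain ⟨j, hj⟩ := Finset.nonempty_iff_ne_empty.2 (Ne.symm h)
      have : M.body W ((σ.frame W hW).mono ν) = 0 := by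
        rw [GrassmannFrame.mono, map_oddMonomial, oddMonomial]
        refine List.prod_eq_zero ?_
        rw [List.mem_ofFn]
        exact ⟨j, by rw [if_pos hj]; exact M.body_of_mem_parity_one (σ.gen_mem_parity W hW j)⟩
      rw [this, mul_zero]
  exact (σ.frame W hW).addHom_ext
    (f := ((σ.frame W hW).body : M.Sec W →+ Smooth p W)) (g := (M.body W : M.Sec W →+ Smooth p W))
    key a

theorem mem_fil_one_iff (σ : Splitting (p := p) q M.toSuperalgebraSheaf U) (W : Opens M₀)
    (hW : W ≤ U) (a : M.Sec W) : a ∈ (σ.frame W hW).fil 1 ↔ M.body W a = 0 := by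
  rw [GrassmannFrame.mem_fil_one_iff, frame_body]

variable {M}

/-- The splitting with the same odd sections and another pullback of functions. -/
def withPullback (σ : Splitting (p := p) q M.toSuperalgebraSheaf U)
    (π : ∀ W : Opens M₀, W ≤ U → (Smooth p W →ₐ[ℝ] M.Sec W))
    (heven : ∀ W hW g, π W hW g ∈ M.parity W 0)
    (hres : ∀ {V W : Opens M₀} (hW : W ≤ U) (h : V ≤ W) (g : Smooth p W),
      M.res h (π W hW g) = π V (h.trans hW) (smoothRes h g))
    (hbody : ∀ W hW g, M.body W (π W hW g) = g) :
    Splitting (p := p) q M.toSuperalgebraSheaf U where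
  pullback := π
  pullback_even := heven
  res_pullback := hres
  odd := σ.odd
  odd_mem := σ.odd_mem
  -- Both pullbacks are right inverses of `j^*`, so they differ by elements of its kernel, which is
  -- `fil 1`.
  bijective W hW := (σ.frame W hW).bijective_of_sub_mem_fil (π W hW : Smooth p W →+* M.Sec W)
    fun c => by
      rw [mem_fil_one_iff, map_sub, Splitting.frame_incl, M.body_pullback]
      change M.body W (π W hW c) - c = 0
      rw [hbody, sub_self]

/-- The coordinate system given by a splitting and a chart. -/
def coordSystemOfSplitting (σ : Splitting (p := p) q M.toSuperalgebraSheaf U)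
    (e : OpenPartialHomeomorph M₀ (Model p)) (he : e ∈ charts p M₀) (V : Opens M₀) (hV : V ≤ U)
    (hVe : e.source = V) : M.CoordSystem V where
  pullback W hW := σ.pullback W (hW.trans hV)
  pullback_even W hW g := σ.pullback_even W (hW.trans hV) g
  res_pullback hW h' g := σ.res_pullback (hW.trans hV) h' g
  odd j := M.res hV (σ.odd j)
  odd_mem j := M.map_parity hV 1 _ (σ.odd_mem j)
  bijective W hW := by
    simp only [SuperalgebraSheaf.res_res]
    exact σ.bijective W (hW.trans hV)
  chart := e
  chart_mem := he
  source_eq := hVe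

/-- Every retraction is, locally, the retraction associated with a coordinate system. -/
theorem Retraction.exists_isAdapted (γ : M.Retraction) {e : OpenPartialHomeomorph M₀ (Model p)}
    (he : e ∈ charts p M₀) {o : M₀} (ho : o ∈ e.source) :
    ∃ (V : Opens M₀) (x : M.CoordSystem V), o ∈ V ∧ x.IsAdapted γ ∧ (V : Set M₀) ⊆ e.source ∧
      x.chart = e.restr V := by
  obtain ⟨U, hoU, ⟨σ⟩⟩ := M.locally_split o
  let V : Opens M₀ := U ⊓ ⟨e.source, e.open_source⟩
  have hV : (V : Set M₀) ⊆ e.source := fun _ h => h.2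
  let τ := withPullback σ (fun W _ => γ.pullback W) (fun W _ => γ.pullback_even W)
    (fun _ h g => γ.res_pullback h g) (fun W _ => γ.body_pullback W)
  exact ⟨V, coordSystemOfSplitting τ (e.restr V) (restr_mem_charts he V) V inf_le_left
    (restr_source_eq hV), ⟨hoU, ho⟩, fun W hW => rfl, hV, rfl⟩

namespace CoordSystem

/-- The presentation of the sections over `U` as a Grassmann algebra over `C^∞(U)`. -/
def frame (x : M.CoordSystem U) : GrassmannFrame q (Smooth p U) (M.Sec U) :=
  x.toSplitting.frame U le_rfl

theorem frame_incl (x : M.CoordSystem U) (c : Smooth p U) :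
    x.frame.incl c = x.pullback U le_rfl c := rfl

theorem frame_gen (x : M.CoordSystem U) (j : Fin q) : x.frame.gen j = x.odd j :=
  M.res_self le_rfl _

theorem frame_mono (x : M.CoordSystem U) (ν : Finset (Fin q)) : x.frame.mono ν = x.monomial ν := by
  rw [GrassmannFrame.mono, funext x.frame_gen]
  rfl

theorem frame_coeff (x : M.CoordSystem U) (f : M.Sec U) (ν : Finset (Fin q)) :
    x.frame.coeff ν f = x.coeff f ν := by
  conv_lhs => rw [← x.sum_coeff f]
  simp only [← frame_mono, ← frame_incl]
  exact x.frame.coeff_sum _ ν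

theorem derivEven_eq (x : M.CoordSystem U) (i : Fin p) (f : M.Sec U) :
    x.derivEven i f = x.frame.dEven (chartDerivHom x.chart x.chart_mem x.source_eq i) f := by
  simp only [derivEven, GrassmannFrame.dEven_apply, frame_mono, frame_coeff]
  rfl

theorem derivOdd_eq (x : M.CoordSystem U) (j : Fin q) (f : M.Sec U) :
    x.derivOdd j f = x.frame.dOdd j f := by
  simp only [derivOdd, GrassmannFrame.dOdd_apply, frame_mono, frame_coeff, frame_incl]
  refine Finset.sum_congr rfl fun ν _ => ?_
  rw [zsmul_eq_mul]
  push_cast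
  rfl

theorem compatible {x y : M.CoordSystem U} (h : ∀ c, x.frame.incl c = y.frame.incl c) :
    GrassmannFrame.Compatible x.frame y.frame :=
  ⟨RingHom.ext h,
    fun b => y.toSplitting.isOdd_of_mem_parity U le_rfl (x.toSplitting.gen_mem_parity U le_rfl b),
    fun b => x.toSplitting.isOdd_of_mem_parity U le_rfl (y.toSplitting.gen_mem_parity U le_rfl b)⟩

theorem coeff_restrict (x : M.CoordSystem U) (V : Opens M₀) (h : V ≤ U) (f : M.Sec U)
    (ν : Finset (Fin q)) :
    (x.restrict V h).coeff (M.res h f) ν = smoothRes h (x.coeff f ν) := by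
  rw [← frame_coeff]
  conv_lhs => rw [← x.sum_coeff f]
  rw [map_sum]
  have : ∀ μ, M.res h (x.pullback U le_rfl (x.coeff f μ) * x.monomial μ) =
      (x.restrict V h).frame.incl (smoothRes h (x.coeff f μ)) * (x.restrict V h).frame.mono μ := by
    intro μ
    rw [map_mul, x.res_pullback, frame_mono, monomial, map_oddMonomial]
    rfl
  simp only [this]
  exact (x.restrict V h).frame.coeff_sum _ ν

theorem IsAdapted.restrict {x : M.CoordSystem U} {γ : M.Retraction} (hx : x.IsAdapted γ)
    (V : Opens M₀) (h : V ≤ U) : (x.restrict V h).IsAdapted γ :=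
  fun W hW => hx W (hW.trans h)

end CoordSystem

end Supermanifold

end Frames

/-! ### The fibre integral -/

theorem abs_det_fderiv_restr {p : ℕ} {M₀ : Type u} [TopologicalSpace M₀]
    {e : OpenPartialHomeomorph M₀ (Model p)} {V : Opens M₀} {o : M₀}
    (ho : o ∈ e.source) :
    |(fderiv ℝ (fun z => e.restr V (e.symm z)) (e o)).det| = 1 := by
  have := fderiv_self_transition ho
  change |(fderiv ℝ (fun z => e (e.symm z)) (e o)).det| = 1
  rw [this]
  simp [ContinuousLinearMap.det]

section FibreIntegral

variable {p q : ℕ} {M₀ : Type u} [TopologicalSpace M₀] [ChartedSpace (Model p) M₀]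

namespace Supermanifold

variable {M : Supermanifold p q M₀} {U : Opens M₀}

theorem smoothSign_mul_self_apply (g : Smooth p U) (hg : ∀ x, g x ≠ 0) (x : U) :
    (smoothSign g * g) x = |g x| := by
  rw [ContMDiffMap.coe_mul, Pi.mul_apply, smoothSign_apply g hg]
  rcases lt_or_gt_of_ne (hg x) with h | h
  · rw [Real.sign_of_neg h, abs_of_neg h, neg_one_mul]
  · rw [Real.sign_of_pos h, abs_of_pos h, one_mul]

namespace CoordSystem

/-- For two coordinate systems with the same associated retraction, the Berezinian is the product
of the classical Jacobian and of the Jacobian of the odd coordinates. -/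
theorem absBer_of_incl_eq {x y : M.CoordSystem U} (h : ∀ c, x.frame.incl c = y.frame.incl c) :
    x.absBer y = y.frame.incl
      (smoothSign (Matrix.of fun i j => chartDeriv y.chart y.chart_mem y.source_eq i
          (chartCoord x.chart x.chart_mem x.source_eq j)).det *
        (Matrix.of fun i j => chartDeriv y.chart y.chart_mem y.source_eq i
          (chartCoord x.chart x.chart_mem x.source_eq j)).det) *
      leibnizDet (GrassmannFrame.jacobian x.frame y.frame) := by
  have hc := compatible h
  set D : Matrix (Fin p) (Fin p) (Smooth p U) :=
    Matrix.of fun i j => chartDeriv y.chart y.chart_mem y.source_eq i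
      (chartCoord x.chart x.chart_mem x.source_eq j) with hD
  have heven : ∀ j, x.even j = y.frame.incl (chartCoord x.chart x.chart_mem x.source_eq j) :=
    fun j => h _
  have hR : jacEvenEven x y = D.map y.frame.incl := by
    ext i j
    rw [jacEvenEven, Matrix.of_apply, heven, derivEven_eq, GrassmannFrame.dEven_incl]
    rfl
  -- The even coordinates of `x` are constants for the frame of `y`. So this block vanishes, and
  -- `∂u/∂v` is the classical Jacobian matrix.
  have hT : (Matrix.of fun a j => y.derivOdd a (x.even j)) = 0 := by
    ext a j
    rw [Matrix.of_apply, heven, derivOdd_eq]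
    have := y.frame.dOdd_incl_mul a (chartCoord x.chart x.chart_mem x.source_eq j) 1
    rw [mul_one, GrassmannFrame.dOdd_one, mul_zero] at this
    rw [this]
    rfl
  have hV : (Matrix.of fun a b => y.derivOdd a (x.odd b)) =
      GrassmannFrame.jacobian y.frame x.frame := by
    ext a b
    rw [Matrix.of_apply, derivOdd_eq, GrassmannFrame.jacobian, Matrix.of_apply, frame_gen]
  have hdet : leibnizDet (jacEvenEven x y) = y.frame.incl D.det := by
    rw [hR, ← map_leibnizDet, leibnizDet_eq_det]
  rw [absBer, ber, berezinian, hT, hV, Matrix.mul_zero, sub_zero, hc.inverse_jacobian, hdet, map_mul,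
    frame_incl, frame_incl, M.body_pullback, mul_assoc]

/-- The transformation law for the top coefficients of a Berezin density in coordinate systems
with the same associated retraction. -/
theorem coeff_univ_change (β : M.BerezinDensity) {x y : M.CoordSystem U}
    (h : ∀ c, x.frame.incl c = y.frame.incl c) (o : U) :
    y.coeff (β.val U y) Finset.univ o = x.coeff (β.val U x) Finset.univ o *
      |(fderiv ℝ (fun z => x.chart (y.chart.symm z)) (y.chart o)).det| := by
  have hc := compatible h
  have hdet : ∀ o : U, (Matrix.of fun i j => chartDeriv y.chart y.chart_mem y.source_eq i
      (chartCoord x.chart x.chart_mem x.source_eq j)).det o =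
      (fderiv ℝ (fun z => x.chart (y.chart.symm z)) (y.chart o)).det :=
    det_chartDeriv _ _ x.chart_mem x.source_eq y.chart_mem y.source_eq
  have hne : ∀ o : U, (Matrix.of fun i j => chartDeriv y.chart y.chart_mem y.source_eq i
      (chartCoord x.chart x.chart_mem x.source_eq j)).det o ≠ 0 := fun o => by
    rw [hdet]
    refine right_ne_zero_of_mul_eq_one (det_transition_mul x.chart_mem y.chart_mem ?_ ?_)
    · rw [x.source_eq]; exact o.2
    · rw [y.source_eq]; exact o.2
  -- The sign times the classical determinant is its absolute value, and the factor `det (∂η/∂ξ)` is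
  -- absorbed by `top_mul_det`.
  rw [← hdet, ← smoothSign_mul_self_apply _ hne, β.change x y, absBer_of_incl_eq h,
    ← frame_coeff, ← frame_coeff, ← mul_assoc, ← y.frame.incl_comm, mul_assoc,
    GrassmannFrame.coeff_incl_mul, hc.top_mul_det, mul_comm (x.frame.coeff _ _ o)]
  rfl

theorem IsAdapted.incl_eq {γ : M.Retraction} {x y : M.CoordSystem U} (hx : x.IsAdapted γ)
    (hy : y.IsAdapted γ) (c : Smooth p U) : x.frame.incl c = y.frame.incl c := by
  rw [frame_incl, frame_incl, hx, hy]

theorem coeff_univ_restrict (β : M.BerezinDensity) (x : M.CoordSystem U) (V : Opens M₀)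
    (h : V ≤ U) (o : V) :
    (x.restrict V h).coeff (β.val V (x.restrict V h)) Finset.univ o =
      x.coeff (β.val U x) Finset.univ ⟨o, h o.2⟩ := by
  rw [β.val_restrict, coeff_restrict]
  rfl

/-- The transformation law on the intersection of the domains. -/
theorem IsAdapted.coeff_univ_change (β : M.BerezinDensity) {γ : M.Retraction} {V : Opens M₀}
    {x : M.CoordSystem U} {y : M.CoordSystem V} (hx : x.IsAdapted γ) (hy : y.IsAdapted γ) {o : M₀}
    (hoU : o ∈ U) (hoV : o ∈ V) :
    y.coeff (β.val V y) Finset.univ ⟨o, hoV⟩ = x.coeff (β.val U x) Finset.univ ⟨o, hoU⟩ *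
      |(fderiv ℝ (fun z => x.chart (y.chart.symm z)) (y.chart o)).det| := by
  have h := CoordSystem.coeff_univ_change β
    ((hx.restrict (U ⊓ V) inf_le_left).incl_eq (hy.restrict (U ⊓ V) inf_le_right)) ⟨o, hoU, hoV⟩
  rw [coeff_univ_restrict, coeff_univ_restrict] at h
  exact h

end CoordSystem

namespace BerezinDensity

variable (β : M.BerezinDensity)

/-- The values of a fibre integral. -/
theorem IsFibreIntegral.val_eq {β : M.BerezinDensity} {s : ℕ → ℕ → ℕ} {γ : M.Retraction}
    {ρ : Density p M₀} (hρ : β.IsFibreIntegral s γ ρ) {x : M.CoordSystem U} (hx : x.IsAdapted γ)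
    {e : OpenPartialHomeomorph M₀ (Model p)} (he : e ∈ charts p M₀) (o : U)
    (ho : (o : M₀) ∈ e.source) :
    ρ.val e o = (-1) ^ s p q * x.coeff (β.val U x) Finset.univ o *
      |(fderiv ℝ (fun z => x.chart (e.symm z)) (e o)).det| := by
  rw [ρ.change x.chart x.chart_mem e he o ⟨by rw [x.source_eq]; exact o.2, ho⟩, hρ U x hx o]

open Classical in
/-- The fibre integral exists. -/
theorem exists_isFibreIntegral (s : ℕ → ℕ → ℕ) (γ : M.Retraction) :
    ∃ ρ : Density p M₀, β.IsFibreIntegral s γ ρ := by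
  -- The value of the fibre integral at a point does not depend on the adapted coordinates. The
  -- witness comes from coordinates whose chart is a restriction of `e`.
  have hex : ∀ (e : OpenPartialHomeomorph M₀ (Model p)) (o : M₀), e ∈ charts p M₀ ∧ o ∈ e.source →
      ∃ r : ℝ, ∀ (U : Opens M₀) (x : M.CoordSystem U), x.IsAdapted γ → ∀ ho : o ∈ U,
        r = (-1) ^ s p q * x.coeff (β.val U x) Finset.univ ⟨o, ho⟩ *
          |(fderiv ℝ (fun z => x.chart (e.symm z)) (e o)).det| := by
    rintro e o ⟨he, ho⟩
    obtain ⟨V, y, hoV, hy, hVe, hye⟩ := γ.exists_isAdapted he ho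
    refine ⟨(-1) ^ s p q * y.coeff (β.val V y) Finset.univ ⟨o, hoV⟩, fun U x hx hoU => ?_⟩
    rw [CoordSystem.IsAdapted.coeff_univ_change β hx hy hoU hoV, mul_assoc, hye]
    rfl
  choose! r hr using hex
  -- The value `0` is immaterial: a density is constrained only on the domains of charts.
  refine ⟨⟨fun e o => if e ∈ charts p M₀ ∧ o ∈ e.source then r e o else 0, ?_, ?_⟩, ?_⟩
  · intro e he o ho
    obtain ⟨V, y, hoV, hy, hVe, hye⟩ := γ.exists_isAdapted he ho
    apply ContMDiffAt.contMDiffWithinAt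
    have h1 : ContMDiffAt (𝓡 p) 𝓘(ℝ) ∞ (fun z : V =>
        (fun o => if e ∈ charts p M₀ ∧ o ∈ e.source then r e o else 0) (z : M₀)) ⟨o, hoV⟩ := by
      have h2 : ContMDiffAt (𝓡 p) 𝓘(ℝ) ∞
          ((-1 : ℝ) ^ s p q • y.coeff (β.val V y) Finset.univ) ⟨o, hoV⟩ :=
        ContMDiffMap.contMDiff _ _
      refine h2.congr_of_eventuallyEq (Filter.Eventually.of_forall fun z => ?_)
      have hz : (z : M₀) ∈ e.source := hVe z.2
      change (if e ∈ charts p M₀ ∧ (z : M₀) ∈ e.source then r e z else 0) = _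
      rw [if_pos ⟨he, hz⟩, hr e z ⟨he, hz⟩ V y hy z.2, hye, abs_det_fderiv_restr hz, mul_one]
      rfl
    exact (contMDiffAt_subtype_iff
      (f := fun o => if e ∈ charts p M₀ ∧ o ∈ e.source then r e o else 0)).1 h1
  · intro e he e' he' o ho
    obtain ⟨V, y, hoV, hy, hVe, hye⟩ := γ.exists_isAdapted he ho.1
    rw [if_pos ⟨he', ho.2⟩, if_pos ⟨he, ho.1⟩, hr e' o ⟨he', ho.2⟩ V y hy hoV,
      hr e o ⟨he, ho.1⟩ V y hy hoV, hye, abs_det_fderiv_restr ho.1, mul_one]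
    rfl
  · intro U x hx o
    have ho : (o : M₀) ∈ x.chart.source := by rw [x.source_eq]; exact o.2
    change (if x.chart ∈ charts p M₀ ∧ (o : M₀) ∈ x.chart.source then r x.chart o else 0) = _
    rw [if_pos ⟨x.chart_mem, ho⟩, hr x.chart o ⟨x.chart_mem, ho⟩ U x hx o.2,
      fderiv_self_transition ho]
    simp [ContinuousLinearMap.det]

/-- The fibre integrals of Berezin densities depend linearly on the latter. -/
theorem IsFibreIntegral.val_eq_sum {ι : Type*} {t : Finset ι} {β : M.BerezinDensity}
    {α : ι → M.BerezinDensity} {s : ℕ → ℕ → ℕ} {γ : M.Retraction} {ρ : Density p M₀}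
    {τ : ι → Density p M₀} (hρ : β.IsFibreIntegral s γ ρ)
    (hτ : ∀ i, (α i).IsFibreIntegral s γ (τ i))
    (hsum : ∀ (U : Opens M₀) (x : M.CoordSystem U), β.val U x = ∑ i ∈ t, (α i).val U x)
    {e : OpenPartialHomeomorph M₀ (Model p)} (he : e ∈ charts p M₀) {o : M₀} (ho : o ∈ e.source) :
    ρ.val e o = ∑ i ∈ t, (τ i).val e o := by
  obtain ⟨V, y, hoV, hy, hVe, hye⟩ := γ.exists_isAdapted he ho
  have h1 := hρ.val_eq hy he ⟨o, hoV⟩ ho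
  have h2 := fun i => (hτ i).val_eq hy he ⟨o, hoV⟩ ho
  dsimp only at h1 h2
  have h3 : y.coeff (β.val V y) Finset.univ ⟨o, hoV⟩ =
      ∑ i ∈ t, y.coeff ((α i).val V y) Finset.univ ⟨o, hoV⟩ := by
    simp only [← CoordSystem.frame_coeff, ← evalAt_apply]
    rw [hsum, map_sum, map_sum]
  rw [h1, h3, Finset.mul_sum, Finset.sum_mul]
  exact Finset.sum_congr rfl fun i _ => (h2 i).symm

end BerezinDensity

end Supermanifold

end FibreIntegral

/-! ### Taylor expansion in a nilpotent element -/

/-- The Cauchy product of truncated power series in `m`; the products beyond the truncation vanish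
with `m ^ N`. It makes the Taylor substitution multiplicative. -/
theorem sum_range_mul_pow {A : Type*} [Ring A] {m : A} {N : ℕ} (hm : ∀ a, m * a = a * m) (hN : m ^ N = 0)
    (a b : ℕ → A) :
    (∑ k ∈ Finset.range N, a k * m ^ k) * ∑ k ∈ Finset.range N, b k * m ^ k =
      ∑ n ∈ Finset.range N, (∑ k ∈ Finset.HasAntidiagonal.antidiagonal n, a k.1 * b k.2) * m ^ n := by
  have hpow : ∀ k c, m ^ k * c = c * m ^ k := fun k c => Commute.pow_left (hm c) k
  rw [Finset.sum_mul_sum, ← Finset.sum_product']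
  have h1 : ∀ k : ℕ × ℕ, a k.1 * m ^ k.1 * (b k.2 * m ^ k.2) = a k.1 * b k.2 * m ^ (k.1 + k.2) := by
    intro k
    rw [mul_assoc, ← mul_assoc (m ^ k.1), hpow, mul_assoc (b k.2), ← pow_add, mul_assoc]
  simp only [h1]
  rw [← Finset.sum_filter_add_sum_filter_not _ (fun k : ℕ × ℕ => k.1 + k.2 < N)]
  have h2 : ∑ k ∈ (Finset.range N ×ˢ Finset.range N).filter (fun k => ¬k.1 + k.2 < N),
      a k.1 * b k.2 * m ^ (k.1 + k.2) = 0 := by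
    refine Finset.sum_eq_zero fun k hk => ?_
    obtain ⟨r, hr⟩ := Nat.exists_eq_add_of_le (not_lt.1 (Finset.mem_filter.1 hk).2)
    rw [hr, pow_add, hN, zero_mul, mul_zero]
  rw [h2, add_zero, ← Finset.sum_fiberwise_of_maps_to (t := Finset.range N)
    (g := fun k : ℕ × ℕ => k.1 + k.2)
    (fun k hk => Finset.mem_range.2 (Finset.mem_filter.1 hk).2)]
  refine Finset.sum_congr rfl fun n hn => ?_
  rw [Finset.sum_mul]
  have h3 : ((Finset.range N ×ˢ Finset.range N).filter fun k => k.1 + k.2 < N).filter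
      (fun k => k.1 + k.2 = n) = Finset.HasAntidiagonal.antidiagonal n := by
    ext k
    simp only [Finset.mem_filter, Finset.mem_product, Finset.mem_range, Finset.HasAntidiagonal.mem_antidiagonal]
    have := Finset.mem_range.1 hn
    omega
  rw [h3]
  refine Finset.sum_congr rfl fun k hk => ?_
  rw [Finset.HasAntidiagonal.mem_antidiagonal.1 hk]

section Taylor

variable {C A : Type*} [CommRing C] [Algebra ℝ C] [Ring A] [Algebra ℝ A]

/-- The divided powers `d^n / n!` of an additive map `d`. -/
def divPow (d : C →+ C) (n : ℕ) (c : C) : C := (n.factorial : ℝ)⁻¹ • d^[n] c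

theorem divPow_zero (d : C →+ C) (c : C) : divPow d 0 c = c := by simp [divPow]

theorem divPow_add (d : C →+ C) (n : ℕ) (a b : C) :
    divPow d n (a + b) = divPow d n a + divPow d n b := by
  simp [divPow, iterate_map_add]

theorem divPow_succ {d : C →+ C} (hs : ∀ (r : ℝ) c, d (r • c) = r • d c) (n : ℕ) (c : C) :
    ((n + 1 : ℕ) : ℝ) • divPow d (n + 1) c = d (divPow d n c) := by
  rw [divPow, divPow, hs, Function.iterate_succ_apply', smul_smul, Nat.factorial_succ]
  congr 1
  have : ((n + 1 : ℕ) : ℝ) ≠ 0 := Nat.cast_ne_zero.2 (Nat.succ_ne_zero n)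
  push_cast at this ⊢
  field_simp

/-- The Leibniz rule for divided powers of a derivation. -/
theorem divPow_mul {d : C →+ C} (hs : ∀ (r : ℝ) c, d (r • c) = r • d c)
    (hd : ∀ a b, d (a * b) = a * d b + d a * b) (n : ℕ) (a b : C) :
    divPow d n (a * b) = ∑ k ∈ Finset.HasAntidiagonal.antidiagonal n, divPow d k.1 a * divPow d k.2 b := by
  induction n with
  | zero => simp [divPow_zero]
  | succ n ih =>
    have hne : ((n + 1 : ℕ) : ℝ) ≠ 0 := Nat.cast_ne_zero.2 (Nat.succ_ne_zero n)
    apply smul_right_injective C hne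
    change ((n + 1 : ℕ) : ℝ) • divPow d (n + 1) (a * b) = ((n + 1 : ℕ) : ℝ) • _
    -- The factor `n + 1` is written as `k.1 + k.2`, and each half absorbs the denominator of one
    -- divided power.
    have h1 : ∑ k ∈ Finset.HasAntidiagonal.antidiagonal (n + 1),
        (k.1 : ℝ) • (divPow d k.1 a * divPow d k.2 b) =
        ∑ k ∈ Finset.HasAntidiagonal.antidiagonal n, d (divPow d k.1 a) * divPow d k.2 b := by
      rw [Finset.Nat.sum_antidiagonal_succ]
      simp only [Nat.cast_zero, zero_smul, zero_mul, zero_add, ← smul_mul_assoc, divPow_succ hs]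
    have h2 : ∑ k ∈ Finset.HasAntidiagonal.antidiagonal (n + 1),
        (k.2 : ℝ) • (divPow d k.1 a * divPow d k.2 b) =
        ∑ k ∈ Finset.HasAntidiagonal.antidiagonal n, divPow d k.1 a * d (divPow d k.2 b) := by
      rw [Finset.Nat.sum_antidiagonal_succ']
      simp only [Nat.cast_zero, zero_smul, mul_zero, zero_add, ← mul_smul_comm, divPow_succ hs]
    rw [divPow_succ hs, ih, map_sum, Finset.smul_sum]
    simp only [hd]
    rw [Finset.sum_add_distrib, ← h1, ← h2, ← Finset.sum_add_distrib]
    refine Finset.sum_congr rfl fun k hk => ?_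
    rw [← add_smul, ← Finset.HasAntidiagonal.mem_antidiagonal.1 hk, Nat.cast_add, add_comm]

/-- The homomorphism `c ↦ ∑_n π (d^n c / n!) m^n` for a derivation `d` and a central nilpotent
element `m`. -/
def taylorHom (π : C →ₐ[ℝ] A) (d : C →+ C) (hs : ∀ (r : ℝ) c, d (r • c) = r • d c)
    (hd : ∀ a b, d (a * b) = a * d b + d a * b) (m : A) (hm : ∀ a, m * a = a * m) (N : ℕ)
    (hN0 : 0 < N) (hN : m ^ N = 0) : C →ₐ[ℝ] A :=
  AlgHom.ofLinearMap
    { toFun := fun c => ∑ n ∈ Finset.range N, π (divPow d n c) * m ^ n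
      map_add' := fun a b => by simp [divPow_add, add_mul, Finset.sum_add_distrib]
      map_smul' := fun r c => by
        have : ∀ n, d^[n] (r • c) = r • d^[n] c := fun n => by
          induction n with
          | zero => rfl
          | succ n ih => rw [Function.iterate_succ_apply', Function.iterate_succ_apply', ih, hs]
        simp only [divPow, this, map_smul, smul_mul_assoc, Finset.smul_sum, RingHom.id_apply]
        refine Finset.sum_congr rfl fun n _ => ?_
        rw [smul_comm] }
    (by
      have h1 : d 1 = 0 := by simpa using hd 1 1
      have h2 : ∀ n, divPow d (n + 1) (1 : C) = 0 := fun n => by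
        rw [divPow, Function.iterate_succ_apply, h1, iterate_map_zero, smul_zero]
      obtain ⟨N, rfl⟩ := Nat.exists_eq_succ_of_ne_zero hN0.ne'
      change ∑ n ∈ Finset.range (N + 1), π (divPow d n 1) * m ^ n = 1
      rw [Finset.sum_range_succ']
      simp [h2, divPow_zero])
    (fun a b => by
      change ∑ n ∈ Finset.range N, π (divPow d n (a * b)) * m ^ n = _ * _
      simp only [divPow_mul hs hd, map_sum, map_mul]
      exact (sum_range_mul_pow hm hN (fun n => π (divPow d n a)) fun n => π (divPow d n b)).symm)

/-- The Jacobian `1 + D m` of the substitution `a ↦ ∑_n D^n a / n! m^n` makes it the identity up to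
a total derivative. -/
theorem sum_divPow_mul_pow_mul_one_add {D : A →+ A} (hs : ∀ (r : ℝ) a, D (r • a) = r • D a)
    (hD : ∀ a b, D (a * b) = a * D b + D a * b) {m : A} (hm : ∀ a, m * a = a * m) {N : ℕ}
    (hN : m ^ N = 0) (a : A) :
    (∑ n ∈ Finset.range N, ((n.factorial : ℝ)⁻¹ • D^[n] a) * m ^ n) * (1 + D m) =
      a + D (∑ n ∈ Finset.range N, (((n + 1).factorial : ℝ)⁻¹ • D^[n] a) * m ^ (n + 1)) := by
  have hpow : ∀ k c, m ^ k * c = c * m ^ k := fun k c => Commute.pow_left (hm c) k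
  have h1 : D 1 = 0 := by simpa using hD 1 1
  have hDm : ∀ n, D (m ^ (n + 1)) = ((n + 1 : ℕ) : ℝ) • (m ^ n * D m) := by
    intro n
    induction n with
    | zero => simp
    | succ n ih =>
      rw [pow_succ, hD, ih, smul_mul_assoc, mul_assoc, ← hm (D m), ← mul_assoc, ← pow_succ,
        Nat.cast_succ (n + 1), add_smul, one_smul, add_comm]
  -- The derivative of the `n`-th summand on the right is the Taylor term of index `n + 1` plus `D
  -- m` times the Taylor term of index `n`.
  have hterm : ∀ n, D ((((n + 1).factorial : ℝ)⁻¹ • D^[n] a) * m ^ (n + 1)) =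
      (((n + 1).factorial : ℝ)⁻¹ • D^[n + 1] a) * m ^ (n + 1) +
      ((n.factorial : ℝ)⁻¹ • D^[n] a) * m ^ n * D m := by
    intro n
    have hfac : ((n + 1).factorial : ℝ)⁻¹ * ((n + 1 : ℕ) : ℝ) = (n.factorial : ℝ)⁻¹ := by
      have : ((n + 1 : ℕ) : ℝ) ≠ 0 := Nat.cast_ne_zero.2 (Nat.succ_ne_zero n)
      rw [Nat.factorial_succ]
      push_cast at this ⊢
      field_simp
    rw [hD, hs, ← Function.iterate_succ_apply' D n a, hDm, add_comm]
    congr 1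
    rw [smul_mul_smul_comm, hfac, smul_mul_assoc, smul_mul_assoc, mul_assoc]
  rw [map_sum]
  simp only [hterm]
  rw [Finset.sum_add_distrib, ← Finset.sum_mul, mul_add, mul_one, ← add_assoc]
  congr 1
  -- Shifting the index loses the term `a` of index `0` and gains the term of index `N`, which
  -- vanishes with `m ^ N`.
  have h2 := Finset.sum_range_succ' (fun n => ((n.factorial : ℝ)⁻¹ • D^[n] a) * m ^ n) N
  rw [Finset.sum_range_succ, hN, mul_zero, add_zero] at h2
  rw [h2, add_comm]
  simp

end Taylor

/-! ### Shifting one even coordinate -/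

section Shift

variable {p q : ℕ} {M₀ : Type u} [TopologicalSpace M₀] [ChartedSpace (Model p) M₀]

namespace Supermanifold

variable {M : Supermanifold p q M₀} {U : Opens M₀}

theorem pow_eq_zero_of_body_eq_zero (σ : Splitting (p := p) q M.toSuperalgebraSheaf U)
    {W : Opens M₀} (hW : W ≤ U) {m : M.Sec W} (hm : M.body W m = 0) {n : ℕ} (hn : q < n) :
    m ^ n = 0 :=
  (σ.frame W hW).eq_zero_of_mem_fil hn
    ((σ.frame W hW).pow_mem_fil ((M.mem_fil_one_iff σ W hW m).2 hm) n)

namespace CoordSystem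

theorem restr_chart_source (x : M.CoordSystem U) {W : Opens M₀} (hW : W ≤ U) :
    (x.chart.restr W).source = W :=
  restr_source_eq (by rw [x.source_eq]; exact hW)

/-- The partial derivative over an open subset of the domain of a coordinate system. -/
def partialDeriv (x : M.CoordSystem U) (i : Fin p) (W : Opens M₀) (hW : W ≤ U) :
    Smooth p W →+ Smooth p W :=
  chartDerivHom (x.chart.restr W) (restr_mem_charts x.chart_mem W) (x.restr_chart_source hW) i

theorem partialDeriv_smul (x : M.CoordSystem U) (i : Fin p) (W : Opens M₀) (hW : W ≤ U) (r : ℝ)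
    (g : Smooth p W) : x.partialDeriv i W hW (r • g) = r • x.partialDeriv i W hW g :=
  chartDeriv_smul _ (restr_mem_charts x.chart_mem W) (x.restr_chart_source hW) _ _ _

theorem partialDeriv_mul (x : M.CoordSystem U) (i : Fin p) (W : Opens M₀) (hW : W ≤ U)
    (f g : Smooth p W) : x.partialDeriv i W hW (f * g) =
      f * x.partialDeriv i W hW g + x.partialDeriv i W hW f * g :=
  chartDeriv_mul _ (restr_mem_charts x.chart_mem W) (x.restr_chart_source hW) _ _ _

theorem partialDeriv_res (x : M.CoordSystem U) (i : Fin p) {V W : Opens M₀} (hW : W ≤ U)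
    (h : V ≤ W) (g : Smooth p W) : x.partialDeriv i V (h.trans hW) (smoothRes h g) =
      smoothRes h (x.partialDeriv i W hW g) :=
  chartDeriv_res _ _ (restr_mem_charts x.chart_mem W) (x.restr_chart_source hW)
    (restr_mem_charts x.chart_mem V) (x.restr_chart_source (h.trans hW)) h (fun _ _ => rfl) i g

theorem partialDeriv_self (x : M.CoordSystem U) (i : Fin p) :
    x.partialDeriv i U le_rfl = chartDerivHom x.chart x.chart_mem x.source_eq i := by
  ext1 g
  have h := chartDeriv_res x.chart (x.chart.restr U) x.chart_mem x.source_eq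
    (restr_mem_charts x.chart_mem U) (restr_source_eq (by rw [x.source_eq])) le_rfl
    (fun _ _ => rfl) i g
  exact h

theorem divPow_partialDeriv_res (x : M.CoordSystem U) (i : Fin p) {V W : Opens M₀} (hW : W ≤ U)
    (h : V ≤ W) (n : ℕ) (g : Smooth p W) :
    divPow (x.partialDeriv i V (h.trans hW)) n (smoothRes h g) =
      smoothRes h (divPow (x.partialDeriv i W hW) n g) := by
  have : (x.partialDeriv i V (h.trans hW))^[n] (smoothRes h g) =
      smoothRes h ((x.partialDeriv i W hW)^[n] g) := by
    induction n with
    | zero => rfl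
    | succ n ih =>
      rw [Function.iterate_succ_apply', ih, x.partialDeriv_res, Function.iterate_succ_apply']
  rw [divPow, this, divPow, map_smul]

/-- The pullback of functions along the retraction for which the `i`-th even coordinate is shifted
by the even nilpotent superfunction `m`. -/
def shiftPullback (x : M.CoordSystem U) (i : Fin p) (m : M.Sec U) (hm : m ∈ M.parity U 0)
    (hm0 : M.body U m = 0) (W : Opens M₀) (hW : W ≤ U) : Smooth p W →ₐ[ℝ] M.Sec W :=
  -- The power `q + 1` of the section already vanishes. One further term ensures that the terms of
  -- index `0` and `1` can be split off for every `q`, as in `shift_even`.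
  taylorHom (x.pullback W hW) (x.partialDeriv i W hW) (x.partialDeriv_smul i W hW)
    (x.partialDeriv_mul i W hW) (M.res hW m) (M.even_comm (M.map_parity hW 0 m hm)) (q + 2)
    (Nat.succ_pos _) (pow_eq_zero_of_body_eq_zero x.toSplitting hW (by
      rw [M.body_res, hm0, map_zero]) (by omega))

theorem shiftPullback_apply (x : M.CoordSystem U) (i : Fin p) (m : M.Sec U)
    (hm : m ∈ M.parity U 0) (hm0 : M.body U m = 0) (W : Opens M₀) (hW : W ≤ U) (g : Smooth p W) :
    x.shiftPullback i m hm hm0 W hW g = ∑ n ∈ Finset.range (q + 2),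
      x.pullback W hW (divPow (x.partialDeriv i W hW) n g) * M.res hW m ^ n := rfl

/-- The coordinate system whose `i`-th even coordinate is shifted by `m`. -/
def shift (x : M.CoordSystem U) (i : Fin p) (m : M.Sec U) (hm : m ∈ M.parity U 0)
    (hm0 : M.body U m = 0) : M.CoordSystem U where
  toSplitting := withPullback x.toSplitting (x.shiftPullback i m hm hm0)
    (fun W hW g => by
      rw [shiftPullback_apply]
      refine sum_mem fun n _ => ?_
      have h1 : ∀ n, M.res hW m ^ n ∈ M.parity W 0 := fun n => by
        induction n with
        | zero => rw [pow_zero]; exact M.one_mem_parity W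
        | succ n ih =>
          rw [pow_succ]
          have := M.mul_mem_parity ih (M.map_parity hW 0 m hm)
          rwa [add_zero] at this
      have := M.mul_mem_parity (x.pullback_even W hW (divPow (x.partialDeriv i W hW) n g)) (h1 n)
      rwa [add_zero] at this)
    (fun {V W} hW h g => by
      rw [shiftPullback_apply, shiftPullback_apply, map_sum]
      refine Finset.sum_congr rfl fun n _ => ?_
      rw [map_mul, map_pow, M.res_res, x.res_pullback, x.divPow_partialDeriv_res])
    (fun W hW g => by
      rw [shiftPullback_apply, map_sum, Finset.sum_eq_single 0]
      · rw [pow_zero, mul_one, divPow_zero, M.body_pullback]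
      · intro n _ hn
        rw [map_mul, map_pow, M.body_res, hm0, map_zero, zero_pow hn, mul_zero]
      · simp)
  chart := x.chart
  chart_mem := x.chart_mem
  source_eq := x.source_eq

section

variable (x : M.CoordSystem U) (i : Fin p) (m : M.Sec U) (hm : m ∈ M.parity U 0)
  (hm0 : M.body U m = 0)

theorem shift_odd : (x.shift i m hm hm0).odd = x.odd := rfl

theorem shift_monomial (ν : Finset (Fin q)) :
    (x.shift i m hm hm0).monomial ν = x.monomial ν := rfl

theorem shift_incl (c : Smooth p U) : (x.shift i m hm hm0).frame.incl c =
    ∑ n ∈ Finset.range (q + 2), x.frame.incl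
      (divPow (chartDerivHom x.chart x.chart_mem x.source_eq i) n c) * m ^ n := by
  change x.shiftPullback i m hm hm0 U le_rfl c = _
  rw [shiftPullback_apply, partialDeriv_self, M.res_self]
  rfl

/-- The Taylor series of a coordinate function stops after the linear term, whose coefficient is `1`
or `0`. -/
theorem shift_even (j : Fin p) :
    (x.shift i m hm hm0).even j = x.even j + if i = j then m else 0 := by
  have h0 := x.shift_incl i m hm hm0 (chartCoord x.chart x.chart_mem x.source_eq j)
  refine h0.trans ?_
  have h1 : chartDerivHom x.chart x.chart_mem x.source_eq i
      (chartCoord x.chart x.chart_mem x.source_eq j) = if i = j then 1 else 0 :=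
    chartDeriv_chartCoord_self _ _ _ _ _
  have h2 : chartDerivHom x.chart x.chart_mem x.source_eq i (if i = j then 1 else 0) = 0 := by
    split_ifs
    · exact chartDeriv_one _ x.chart_mem x.source_eq _
    · exact map_zero _
  have h3 : ∀ n, divPow (chartDerivHom x.chart x.chart_mem x.source_eq i) (n + 2)
      (chartCoord x.chart x.chart_mem x.source_eq j) = 0 := fun n => by
    rw [divPow, Function.iterate_succ_apply, Function.iterate_succ_apply, h1, h2,
      iterate_map_zero, smul_zero]
  rw [Finset.sum_range_succ', Finset.sum_range_succ']
  simp only [h3, map_zero, zero_mul, Finset.sum_const_zero, zero_add, divPow_zero, pow_zero,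
    mul_one, pow_one]
  rw [divPow, Function.iterate_succ_apply, h1, add_comm]
  congr 1
  split_ifs <;> simp

end

theorem prod_ofFn_ite_eq {R : Type*} [Monoid R] {n : ℕ} (i : Fin n) (r : R) :
    (List.ofFn fun j => if j = i then r else 1).prod = r := by
  induction n with
  | zero => exact i.elim0
  | succ n ih =>
    rw [List.ofFn_succ, List.prod_cons]
    refine Fin.cases ?_ (fun i => ?_) i
    · simp
    · simp [(Fin.succ_ne_zero i).symm, ih i]

theorem leibnizDet_of_column {R : Type*} [Ring R] {n : ℕ} (A : Matrix (Fin n) (Fin n) R)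
    (i : Fin n) (h : ∀ a j, j ≠ i → A a j = if a = j then 1 else 0) :
    leibnizDet A = A i i := by
  rw [leibnizDet, Finset.sum_eq_single 1]
  · have : (List.ofFn fun j => A ((1 : Equiv.Perm (Fin n)) j) j) =
        List.ofFn (fun j => if j = i then A i i else 1) := by
      congr 1
      funext j
      by_cases hj : j = i
      · subst hj; simp
      · simp [hj, h]
    rw [this]
    simp only [Equiv.Perm.sign_one, Units.val_one, Int.cast_one, one_mul]
    exact prod_ofFn_ite_eq i _
  · intro σ _ hσ
    -- A permutation other than the identity moves at least two indices, hence one different from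
    -- `i`, where the entry of `A` off the diagonal is zero.
    obtain ⟨j, hj, hji⟩ : ∃ j, σ j ≠ j ∧ j ≠ i := by
      by_contra! hc
      refine hσ (Equiv.ext fun j => ?_)
      by_contra hj
      have h1 := hc j hj
      have h2 : σ (σ j) ≠ σ j := fun h => hj (σ.injective h)
      have h3 := hc (σ j) h2
      exact hj (h3.trans h1.symm)
    rw [List.prod_eq_zero, mul_zero]
    rw [List.mem_ofFn]
    exact ⟨j, by rw [h _ _ hji, if_neg hj]⟩
  · simp

end CoordSystem

end Supermanifold

end Shift

/-! ### Effect of a shift on Berezin densities; determination of a retraction by coordinates -/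

section ShiftLaw

variable {p q : ℕ} {M₀ : Type u} [TopologicalSpace M₀] [ChartedSpace (Model p) M₀]

theorem chartDeriv_eq_zero_of_eq_zero {U : Opens M₀} {e : OpenPartialHomeomorph M₀ (Model p)}
    (he : e ∈ charts p M₀) (hU : e.source = U) (i : Fin p) {K : Set M₀} (hK : IsClosed K)
    {g : Smooth p U} (hg : ∀ o : U, (o : M₀) ∉ K → g o = 0) (o : U) (ho : (o : M₀) ∉ K) :
    chartDeriv e he hU i g o = 0 := by
  have hs : (o : M₀) ∈ e.source := hU ▸ o.2
  have hopen : IsOpen (e.target ∩ e.symm ⁻¹' Kᶜ) :=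
    e.isOpen_inter_preimage_symm hK.isOpen_compl
  have h : inChart e g =ᶠ[nhds (e o)] fun _ => 0 := by
    have hmem : e o ∈ e.target ∩ e.symm ⁻¹' Kᶜ := by
      refine ⟨e.map_source hs, ?_⟩
      rw [Set.mem_preimage, e.left_inv hs]
      exact ho
    filter_upwards [hopen.mem_nhds hmem] with y hy
    have h1 : e.symm y ∈ U := by
      have := e.map_target hy.1
      rw [hU] at this
      exact this
    rw [inChart_of_mem e g h1]
    exact hg _ hy.2
  rw [chartDeriv_apply, h.fderiv_eq]
  simp

namespace GrassmannFrame

variable {C A : Type*} [CommRing C] [Ring A]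

/-- An ideal of coefficients that contains those of `a` contains those of `a * b`. -/
theorem coeff_mul_mem (x : GrassmannFrame q C A) (J : Ideal C) {a : A}
    (ha : ∀ ν, x.coeff ν a ∈ J) (b : A) (ν : Finset (Fin q)) : x.coeff ν (a * b) ∈ J := by
  conv in x.coeff ν (a * b) => rw [← x.sum_coeff a]
  rw [Finset.sum_mul, map_sum]
  refine sum_mem fun μ _ => ?_
  rw [mul_assoc, coeff_incl_mul]
  exact J.mul_mem_right _ (ha μ)

end GrassmannFrame

/-- The ideal of the smooth functions on `U` that vanish outside of `K`. -/
def vanishingIdeal (p : ℕ) {M₀ : Type u} [TopologicalSpace M₀] [ChartedSpace (Model p) M₀]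
    (U : Opens M₀) (K : Set M₀) : Ideal (Smooth p U) where
  carrier := {g | ∀ o : U, (o : M₀) ∉ K → g o = 0}
  zero_mem' _ _ := rfl
  add_mem' := by
    intro f g hf hg o ho
    rw [ContMDiffMap.coe_add, Pi.add_apply, hf o ho, hg o ho, add_zero]
  smul_mem' := by
    intro c g hg o ho
    rw [smul_eq_mul, ContMDiffMap.coe_mul, Pi.mul_apply, hg o ho, mul_zero]

theorem smul_mem_vanishingIdeal {U : Opens M₀} {K : Set M₀} {g : Smooth p U} (r : ℝ)
    (h : g ∈ vanishingIdeal p U K) : r • g ∈ vanishingIdeal p U K := by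
  rw [Algebra.smul_def]
  exact Ideal.mul_mem_left _ _ h

namespace Supermanifold

variable {M : Supermanifold p q M₀} {U : Opens M₀}

namespace CoordSystem

theorem dEven_chartDerivHom_smul (x : M.CoordSystem U) (i : Fin p) (r : ℝ) (a : M.Sec U) :
    x.frame.dEven (chartDerivHom x.chart x.chart_mem x.source_eq i) (r • a) =
      r • x.frame.dEven (chartDerivHom x.chart x.chart_mem x.source_eq i) a := by
  have h : ∀ b : M.Sec U, r • b = x.frame.incl (algebraMap ℝ _ r) * b := fun b => by
    rw [frame_incl, AlgHom.commutes, Algebra.smul_def]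
  rw [h, x.frame.dEven_incl_mul _ (chartDeriv_mul x.chart x.chart_mem x.source_eq i), h,
    chartDerivHom_apply, chartDeriv_algebraMap, map_zero, zero_mul, add_zero]

/-- The Berezinian of the shift of an even coordinate. -/
theorem absBer_shift (x : M.CoordSystem U) (i : Fin p) (m : M.Sec U) (hm : m ∈ M.parity U 0)
    (hm0 : M.body U m = 0) : (x.shift i m hm hm0).absBer x =
      1 + x.frame.dEven (chartDerivHom x.chart x.chart_mem x.source_eq i) m := by
  set y := x.shift i m hm hm0 with hy
  have hR : ∀ a j, jacEvenEven y x a j = (if a = j then 1 else 0) + if i = j then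
      x.frame.dEven (chartDerivHom x.chart x.chart_mem x.source_eq a) m else 0 := by
    intro a j
    rw [jacEvenEven, Matrix.of_apply, hy, shift_even, derivEven_eq, map_add]
    congr 1
    · have : x.even j = x.frame.incl (chartCoord x.chart x.chart_mem x.source_eq j) := rfl
      rw [this, GrassmannFrame.dEven_incl, chartDerivHom_apply, chartDeriv_chartCoord_self]
      split_ifs <;> simp
    · split_ifs <;> simp
  have hdet : leibnizDet (jacEvenEven y x) =
      1 + x.frame.dEven (chartDerivHom x.chart x.chart_mem x.source_eq i) m := by
    rw [leibnizDet_of_column _ i fun a j hj => by rw [hR, if_neg (Ne.symm hj), add_zero], hR,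
      if_pos rfl, if_pos rfl]
  have hS : (Matrix.of fun i b => x.derivEven i (y.odd b)) = 0 := by
    ext a b
    rw [Matrix.of_apply, hy, shift_odd, derivEven_eq, ← frame_gen, GrassmannFrame.dEven_gen]
    · rfl
    · exact chartDeriv_one _ x.chart_mem x.source_eq _
  have hV : (Matrix.of fun a b => x.derivOdd a (y.odd b)) = 1 := by
    ext a b
    rw [Matrix.of_apply, hy, shift_odd, derivOdd_eq, ← frame_gen, GrassmannFrame.dOdd_gen,
      Matrix.one_apply]
    simp only [eq_comm]
  have hone : leibnizDet (1 : Matrix (Fin q) (Fin q) (M.Sec U)) = 1 := by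
    have h := map_leibnizDet (Int.castRingHom (M.Sec U)) (1 : Matrix (Fin q) (Fin q) ℤ)
    rw [leibnizDet_eq_det, Matrix.det_one, map_one] at h
    rw [h]
    congr 1
    ext a b
    rw [Matrix.map_apply, Matrix.one_apply, Matrix.one_apply]
    split_ifs <;> simp
  -- The body of `∂_i m` is the partial derivative of the body of `m`, hence zero, and the sign
  -- factor is `1`.
  have hbody : M.body U (leibnizDet (jacEvenEven y x)) = 1 := by
    rw [hdet, map_add, map_one, ← M.frame_body x.toSplitting U le_rfl]
    change 1 + x.frame.coeff ∅ _ = 1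
    have : x.frame.coeff ∅ m = M.body U m := M.frame_body x.toSplitting U le_rfl m
    rw [GrassmannFrame.coeff_dEven, this, hm0, map_zero, add_zero]
  have hsign : smoothSign (1 : Smooth p U) = 1 := by
    ext o
    rw [smoothSign_apply _ fun _ => one_ne_zero]
    exact Real.sign_one
  rw [absBer, ber, berezinian, hS, hV, Matrix.zero_mul, Matrix.zero_mul, sub_zero,
    Ring.inverse_one, hone, mul_one, hbody, hsign, map_one, one_mul, hdet]

/-- A shift of an even coordinate changes the top coefficient of a Berezin density by a partial
derivative. -/
theorem exists_coeff_univ_shift (β : M.BerezinDensity) (x : M.CoordSystem U) (i : Fin p)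
    (m : M.Sec U) (hm : m ∈ M.parity U 0) (hm0 : M.body U m = 0) {K : Set M₀} (hK : IsClosed K)
    (hβ : ∀ ν, (x.shift i m hm hm0).coeff (β.val U (x.shift i m hm hm0)) ν ∈
      vanishingIdeal p U K) :
    ∃ h ∈ vanishingIdeal p U K, x.coeff (β.val U x) Finset.univ =
      (x.shift i m hm hm0).coeff (β.val U (x.shift i m hm hm0)) Finset.univ +
        chartDeriv x.chart x.chart_mem x.source_eq i h := by
  set y := x.shift i m hm hm0 with hy
  set d := chartDerivHom x.chart x.chart_mem x.source_eq i with hd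
  set D := x.frame.dEven d with hD
  set g := y.coeff (β.val U y) with hg
  -- The coefficients belong to the shifted coordinates `y`, but they are pulled back by `x`. The
  -- Taylor substitution applied to `G` gives back `β.val U y`.
  let G : M.Sec U := ∑ ν, x.frame.incl (g ν) * x.frame.mono ν
  have hGc : ∀ ν, x.frame.coeff ν G = g ν := x.frame.coeff_sum g
  have hdK : ∀ f ∈ vanishingIdeal p U K, d f ∈ vanishingIdeal p U K := fun f hf =>
    chartDeriv_eq_zero_of_eq_zero x.chart_mem x.source_eq i hK hf
  have hDn : ∀ n ν, x.frame.coeff ν (D^[n] G) = d^[n] (g ν) := by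
    intro n ν
    induction n with
    | zero => exact hGc ν
    | succ n ih =>
      rw [Function.iterate_succ_apply', Function.iterate_succ_apply', hD,
        GrassmannFrame.coeff_dEven, ← hD, ih]
  have hDK : ∀ n ν, x.frame.coeff ν (D^[n] G) ∈ vanishingIdeal p U K := by
    intro n ν
    rw [hDn]
    induction n with
    | zero => exact hβ ν
    | succ n ih => rw [Function.iterate_succ_apply']; exact hdK _ ih
  have hsmul : ∀ (r : ℝ) (a : M.Sec U) ν, x.frame.coeff ν (r • a) = r • x.frame.coeff ν a := by
    intro r a ν
    have h : r • a = x.frame.incl (algebraMap ℝ _ r) * a := by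
      rw [frame_incl, AlgHom.commutes, Algebra.smul_def]
    rw [h, GrassmannFrame.coeff_incl_mul, ← Algebra.smul_def]
  -- The substitution acts on the coefficients and leaves the odd monomials alone, because the shift
  -- does not change the odd coordinates.
  have hval : β.val U y = ∑ n ∈ Finset.range (q + 2), ((n.factorial : ℝ)⁻¹ • D^[n] G) * m ^ n := by
    have hcomm : ∀ n (a : M.Sec U), m ^ n * a = a * m ^ n := fun n a =>
      Commute.pow_left (M.even_comm hm a) n
    have h1 : ∀ n, (n.factorial : ℝ)⁻¹ • D^[n] G =
        ∑ ν, x.frame.incl (divPow d n (g ν)) * x.frame.mono ν := fun n => by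
      rw [← x.frame.sum_coeff ((n.factorial : ℝ)⁻¹ • D^[n] G)]
      refine Finset.sum_congr rfl fun ν _ => ?_
      rw [hsmul, hDn]
      rfl
    simp only [h1, Finset.sum_mul]
    rw [Finset.sum_comm, ← y.sum_coeff (β.val U y)]
    refine Finset.sum_congr rfl fun ν _ => ?_
    rw [← frame_incl, hy, shift_incl, shift_monomial, ← frame_mono, Finset.sum_mul]
    refine Finset.sum_congr rfl fun n _ => ?_
    rw [mul_assoc, hcomm, mul_assoc]
  have hmN : m ^ (q + 2) = 0 :=
    pow_eq_zero_of_body_eq_zero x.toSplitting le_rfl hm0 (by omega)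
  have key := sum_divPow_mul_pow_mul_one_add (D := D) (x.dEven_chartDerivHom_smul i)
    (x.frame.dEven_mul d (chartDeriv_mul x.chart x.chart_mem x.source_eq i)) (M.even_comm hm) hmN G
  rw [← hval, ← x.absBer_shift i m hm hm0, ← hy, ← β.change y x] at key
  set H := ∑ n ∈ Finset.range (q + 2),
    ((((n + 1).factorial : ℝ)⁻¹ • D^[n] G) * m ^ (n + 1)) with hH
  refine ⟨x.frame.coeff Finset.univ H, ?_, ?_⟩
  · rw [hH, map_sum]
    refine sum_mem fun n _ => x.frame.coeff_mul_mem _ (fun ν => ?_) _ _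
    rw [hsmul]
    exact smul_mem_vanishingIdeal _ (hDK n ν)
  · rw [← frame_coeff, key, map_add, hGc, hD, GrassmannFrame.coeff_dEven]
    rfl

end CoordSystem

/-- A coordinate system whose even coordinates are the pullbacks of the coordinates of its chart
along a retraction has that retraction as its associated retraction. -/
theorem CoordSystem.isAdapted_of_even_eq (x : M.CoordSystem U) (γ : M.Retraction)
    (hx : ∀ j, γ.pullback U (chartCoord x.chart x.chart_mem x.source_eq j) = x.even j) :
    x.IsAdapted γ := by
  have hres : ∀ {V W : Opens M₀} (hW : W ≤ U) (h : V ≤ W) (ν : Finset (Fin q)) (a : M.Sec W),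
      (x.toSplitting.frame V (h.trans hW)).coeff ν (M.res h a) =
        smoothRes h ((x.toSplitting.frame W hW).coeff ν a) := by
    intro V W hW h ν a
    conv_lhs => rw [← (x.toSplitting.frame W hW).sum_coeff a]
    rw [map_sum]
    have : ∀ μ, M.res h ((x.toSplitting.frame W hW).incl ((x.toSplitting.frame W hW).coeff μ a) *
        (x.toSplitting.frame W hW).mono μ) = (x.toSplitting.frame V (h.trans hW)).incl
          (smoothRes h ((x.toSplitting.frame W hW).coeff μ a)) *
        (x.toSplitting.frame V (h.trans hW)).mono μ := by
      intro μ
      rw [map_mul, Splitting.frame_incl, x.res_pullback, GrassmannFrame.mono, map_oddMonomial]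
      congr 2
      funext j
      exact M.res_res hW h _
    simp only [this]
    exact (x.toSplitting.frame V (h.trans hW)).coeff_sum _ ν
  -- The two pullbacks are compared degree by degree. If they agree up to degree `k`, each
  -- coefficient `δ` of degree `k + 1` of their difference is a derivation on functions that kills
  -- constants and coordinates, hence is zero by Hadamard's lemma.
  have key : ∀ (k : ℕ) (W : Opens M₀) (hW : W ≤ U) (g : Smooth p W),
      γ.pullback W g - x.pullback W hW g ∈ (x.toSplitting.frame W hW).fil (k + 1) := by
    intro k
    induction k with
    | zero =>
      intro W hW g
      rw [zero_add, M.mem_fil_one_iff, map_sub, γ.body_pullback, M.body_pullback, sub_self]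
    | succ k ih =>
      intro W hW g ν hν
      rcases Nat.lt_or_ge ν.card (k + 1) with hlt | hge
      · exact ih W hW g ν hlt
      have hcard : ν.card = k + 1 := by omega
      let δ : ∀ V : Opens M₀, V ≤ U → Smooth p V → Smooth p V := fun V hV f =>
        (x.toSplitting.frame V hV).coeff ν (γ.pullback V f - x.pullback V hV f)
      have hadd : ∀ V hV f f', δ V hV (f + f') = δ V hV f + δ V hV f' := by
        intro V hV f f'
        change (x.toSplitting.frame V hV).coeff ν _ = (x.toSplitting.frame V hV).coeff ν _ +
          (x.toSplitting.frame V hV).coeff ν _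
        rw [map_add (γ.pullback V), map_add (x.pullback V hV), add_sub_add_comm, map_add]
      have hsum : ∀ V hV (f : Fin p → Smooth p V), δ V hV (∑ i, f i) = ∑ i, δ V hV (f i) := by
        intro V hV f
        change (x.toSplitting.frame V hV).coeff ν _ = ∑ i, (x.toSplitting.frame V hV).coeff ν _
        rw [map_sum (γ.pullback V), map_sum (x.pullback V hV), ← Finset.sum_sub_distrib, map_sum]
      have hconst : ∀ V hV (r : ℝ), δ V hV (algebraMap ℝ _ r) = 0 := by
        intro V hV r
        simp only [δ, AlgHom.commutes, sub_self, map_zero]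
      have hmul : ∀ V hV f f', δ V hV (f * f') = f * δ V hV f' + δ V hV f * f' := by
        intro V hV f f'
        set F := x.toSplitting.frame V hV with hF
        have h1 : γ.pullback V (f * f') - x.pullback V hV (f * f') =
            F.incl f * (γ.pullback V f' - x.pullback V hV f') +
            F.incl f' * (γ.pullback V f - x.pullback V hV f) +
            (γ.pullback V f - x.pullback V hV f) * (γ.pullback V f' - x.pullback V hV f') := by
          rw [map_mul, map_mul, F.incl_comm f', hF, Splitting.frame_incl, Splitting.frame_incl]
          noncomm_ring
        -- The product of the two differences has degree at least `2 * (k + 1)`, which exceeds `k +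
        -- 1`, so it does not disturb the Leibniz rule.
        have h2 : F.coeff ν ((γ.pullback V f - x.pullback V hV f) *
            (γ.pullback V f' - x.pullback V hV f')) = 0 :=
          F.mul_mem_fil (ih V hV f) (ih V hV f') ν (by omega)
        change F.coeff ν _ = f * F.coeff ν _ + F.coeff ν _ * f'
        rw [h1, map_add, map_add, h2, F.coeff_incl_mul, F.coeff_incl_mul, add_zero,
          mul_comm f' (F.coeff ν _)]
      have hδres : ∀ {V V' : Opens M₀} (hV : V ≤ U) (h : V' ≤ V) (f : Smooth p V),
          δ V' (h.trans hV) (smoothRes h f) = smoothRes h (δ V hV f) := by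
        intro V V' hV h f
        simp only [δ]
        rw [← hres hV h, map_sub (M.res h), γ.res_pullback, x.res_pullback]
      have hcoord : ∀ V (hV : V ≤ U) j,
          δ V hV (smoothRes hV (chartCoord x.chart x.chart_mem x.source_eq j)) = 0 := by
        intro V hV j
        rw [hδres le_rfl hV]
        have : δ U le_rfl (chartCoord x.chart x.chart_mem x.source_eq j) = 0 := by
          simp only [δ]
          rw [hx, even, sub_self, map_zero]
        rw [this, map_zero]
      change δ W hW g = 0
      ext a
      have ha : (a : M₀) ∈ x.chart.source := by rw [x.source_eq]; exact hW a.2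
      obtain ⟨V, hVW, haV, h, hVe, hVg⟩ :=
        exists_smoothRes_eq_add_sum_mul g x.chart x.chart_mem a ha
      have hg : smoothRes hVW g = algebraMap ℝ _ (g a) + ∑ i,
          (smoothRes (hVW.trans hW) (chartCoord x.chart x.chart_mem x.source_eq i) +
            algebraMap ℝ _ (-x.chart a i)) * h i := by
        ext y
        change _ = evalAt y (algebraMap ℝ _ (g a) + ∑ i,
          (smoothRes (hVW.trans hW) (chartCoord x.chart x.chart_mem x.source_eq i) +
            algebraMap ℝ _ (-x.chart a i)) * h i)
        rw [smoothRes_apply, hVg y (hVW y.2) y.2, map_add, map_sum]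
        congr 1
      have h1 : δ W hW g a = δ V (hVW.trans hW) (smoothRes hVW g) ⟨a, haV⟩ := by
        rw [hδres hW hVW]
        rfl
      rw [h1, hg, hadd, hconst, zero_add, hsum, ← evalAt_apply, map_sum]
      refine Finset.sum_eq_zero fun i _ => ?_
      -- In the Leibniz rule for `(u_i - u_i(a)) h_i` one summand vanishes because `δ` kills the
      -- first factor, the other because that factor is zero at `a`.
      rw [hmul, hadd, hcoord, hconst, add_zero, zero_mul, add_zero, map_mul]
      have h2 : evalAt (⟨a, haV⟩ : V) (smoothRes (hVW.trans hW)
          (chartCoord x.chart x.chart_mem x.source_eq i) + algebraMap ℝ _ (-x.chart a i)) = 0 :=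
        add_neg_cancel (x.chart a i)
      rw [h2, zero_mul]
  intro W hW
  ext1 g
  exact (sub_eq_zero.1 ((x.toSplitting.frame W hW).eq_zero_of_mem_fil (Nat.lt_succ_self q)
    (key q W hW g))).symm

end Supermanifold

end ShiftLaw

/-! ### Independence of the retraction in a coordinate neighbourhood -/

section LocalIndependence

variable {p q : ℕ} {M₀ : Type u} [TopologicalSpace M₀] [ChartedSpace (Model p) M₀]

theorem integrableOn_inChart {U : Opens M₀} {e : OpenPartialHomeomorph M₀ (Model p)}
    (he : e ∈ charts p M₀) (hU : e.source = U) {K : Set M₀} (hK : IsCompact K) (hKU : K ⊆ U)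
    {f : Smooth p U} (hf : f ∈ vanishingIdeal p U K) :
    IntegrableOn (inChart e f) e.target volume := by
  have hKe : K ⊆ e.source := hU ▸ hKU
  have hK' : IsCompact (e '' K) := hK.image_of_continuousOn (e.continuousOn.mono hKe)
  have hsub : e '' K ⊆ e.target := by
    rintro _ ⟨x, hx, rfl⟩
    exact e.map_source (hKe hx)
  refine IntegrableOn.of_forall_sdiff_eq_zero
    (((inChart_contDiffOn e he hU f).continuousOn.mono hsub).integrableOn_compact hK')
    e.open_target.measurableSet fun y hy => ?_
  have h1 : e.symm y ∈ U := by
    have := e.map_target hy.1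
    rw [hU] at this
    exact this
  rw [inChart_of_mem e f h1]
  exact hf _ fun h => hy.2 ⟨_, h, e.right_inv hy.1⟩

namespace Supermanifold

variable {M : Supermanifold p q M₀} {U : Opens M₀}

/-- All coefficients of the Berezin density `β` vanish outside of `K`. -/
def BerezinDensity.VanishesOff (β : M.BerezinDensity) (K : Set M₀) : Prop :=
  ∀ (U : Opens M₀) (x : M.CoordSystem U) (ν : Finset (Fin q)),
    x.coeff (β.val U x) ν ∈ vanishingIdeal p U K

namespace CoordSystem

/-- The Berezin integral `∫ f_{(1,…,1)} |du₀|` of `β|_U = f |Dx|`. -/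
def berezinIntegral (x : M.CoordSystem U) (β : M.BerezinDensity) : ℝ :=
  ∫ y in x.chart.target, inChart x.chart (x.coeff (β.val U x) Finset.univ) y

/-- A shift keeps the chart, and the two integrands differ by a partial derivative of a function
that vanishes off the compact set `K`. -/
theorem berezinIntegral_shift [T2Space M₀] {β : M.BerezinDensity} {K : Set M₀} (hK : IsCompact K)
    (hKU : K ⊆ U) (hβ : β.VanishesOff K) (x : M.CoordSystem U) (i : Fin p) (m : M.Sec U)
    (hm : m ∈ M.parity U 0) (hm0 : M.body U m = 0) :
    (x.shift i m hm hm0).berezinIntegral β = x.berezinIntegral β := by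
  obtain ⟨h, hh, heq⟩ := exists_coeff_univ_shift β x i m hm hm0 hK.isClosed (hβ U _)
  rw [berezinIntegral, berezinIntegral, heq, inChart_add]
  have h1 := integrableOn_inChart x.chart_mem x.source_eq hK hKU
    (hβ U (x.shift i m hm hm0) Finset.univ)
  have h2 : chartDeriv x.chart x.chart_mem x.source_eq i h ∈ vanishingIdeal p U K :=
    chartDeriv_eq_zero_of_eq_zero x.chart_mem x.source_eq i hK.isClosed hh
  have h3 := integrableOn_inChart x.chart_mem x.source_eq hK hKU h2
  have h4 := integral_add h1 h3
  rw [integral_chartDeriv_eq_zero x.chart x.chart_mem x.source_eq i h K hK hKU hh, add_zero] at h4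
  exact h4.symm

/-- The coordinate system can be changed into one with a prescribed associated retraction without
changing the Berezin integral. -/
theorem exists_isAdapted_berezinIntegral_eq [T2Space M₀] {β : M.BerezinDensity} {K : Set M₀}
    (hK : IsCompact K) (hKU : K ⊆ U) (hβ : β.VanishesOff K) (x : M.CoordSystem U)
    (γ : M.Retraction) : ∃ y : M.CoordSystem U, y.chart = x.chart ∧ y.IsAdapted γ ∧
      y.berezinIntegral β = x.berezinIntegral β := by
  have key : ∀ k ≤ p, ∃ y : M.CoordSystem U, y.chart = x.chart ∧
      (∀ j : Fin p, (j : ℕ) < k →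
        γ.pullback U (chartCoord y.chart y.chart_mem y.source_eq j) = y.even j) ∧
      y.berezinIntegral β = x.berezinIntegral β := by
    intro k
    induction k with
    | zero => exact fun _ => ⟨x, rfl, fun j hj => absurd hj (Nat.not_lt_zero _), rfl⟩
    | succ k ih =>
      intro hk
      obtain ⟨y, hyx, hy, hyI⟩ := ih (Nat.le_of_succ_le hk)
      let i : Fin p := ⟨k, hk⟩
      -- The discrepancy in the `k`-th coordinate. It is even, and it has body zero since both terms
      -- have the same underlying function. The shift by it leaves the coordinates already corrected
      -- unchanged.
      let m : M.Sec U := γ.pullback U (chartCoord y.chart y.chart_mem y.source_eq i) - y.even i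
      have hm : m ∈ M.parity U 0 := sub_mem (γ.pullback_even U _) (y.pullback_even U le_rfl _)
      have hm0 : M.body U m = 0 := by
        rw [map_sub, γ.body_pullback, even, M.body_pullback, sub_self]
      refine ⟨y.shift i m hm hm0, hyx, fun j hj => ?_,
        (berezinIntegral_shift hK hKU hβ y i m hm hm0).trans hyI⟩
      rw [shift_even]
      change γ.pullback U (chartCoord y.chart y.chart_mem y.source_eq j) = _
      split_ifs with hij
      · subst hij
        exact (add_sub_cancel _ _).symm
      · rw [add_zero]
        refine hy j (lt_of_le_of_ne (Nat.lt_succ_iff.1 hj) fun h => hij (Fin.ext h.symm))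
  obtain ⟨y, hyx, hy, hyI⟩ := key p le_rfl
  exact ⟨y, hyx, y.isAdapted_of_even_eq γ fun j => hy j j.2, hyI⟩

end CoordSystem

namespace BerezinDensity

variable {β : M.BerezinDensity} {K : Set M₀} {s : ℕ → ℕ → ℕ} {γ : M.Retraction} {ρ : Density p M₀}

theorem VanishesOff.density (hβ : β.VanishesOff K) (hρ : β.IsFibreIntegral s γ ρ) :
    ρ.VanishesOff K := by
  intro e he o ho hoK
  obtain ⟨V, x, hoV, hx, -, -⟩ := γ.exists_isAdapted he ho
  have h := hρ.val_eq hx he ⟨o, hoV⟩ ho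
  rw [hβ V x Finset.univ ⟨o, hoV⟩ hoK, mul_zero, zero_mul] at h
  exact h

/-- The integral of a Berezin density with compact support in a coordinate neighbourhood does not
depend on the retraction. -/
theorem VanishesOff.hasIntegral [T2Space M₀] (hβ : β.VanishesOff K) (hK : IsCompact K)
    (hKU : K ⊆ U) (x : M.CoordSystem U) (hρ : β.IsFibreIntegral s γ ρ) :
    ρ.HasIntegral ((-1) ^ s p q * x.berezinIntegral β) := by
  -- The fibre integral is read in coordinates adapted to `γ`. Their Berezin integral is that of the
  -- given `x`, so no trace of `γ` remains in the value.
  obtain ⟨y, -, hy, hyI⟩ := x.exists_isAdapted_berezinIntegral_eq hK hKU hβ γ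
  have h1 := (hβ.density hρ).hasIntegral y.chart_mem hK (y.source_eq ▸ hKU)
  have h2 : ∫ z in y.chart.target, ρ.reading y.chart z =
      ∫ z in y.chart.target,
        (-1) ^ s p q * inChart y.chart (y.coeff (β.val U y) Finset.univ) z := by
    refine setIntegral_congr_fun y.chart.open_target.measurableSet fun z hz => ?_
    have hzU : y.chart.symm z ∈ U := by
      have := y.chart.map_target hz
      rw [y.source_eq] at this
      exact this
    change ρ.val y.chart (y.chart.symm z) = _
    rw [inChart_of_mem _ _ hzU]
    exact hρ U y hy ⟨_, hzU⟩
  rwa [h2, integral_const_mul, ← CoordSystem.berezinIntegral, hyI] at h1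

end BerezinDensity

end Supermanifold

end LocalIndependence

/-! ### Independence of the retraction -/

section Globalization

variable {p q : ℕ} {M₀ : Type u} [TopologicalSpace M₀] [ChartedSpace (Model p) M₀]

namespace Supermanifold

variable {M : Supermanifold p q M₀} {U : Opens M₀}

theorem CoordSystem.coeff_apply_eq_zero_of_res (x : M.CoordSystem U) {W : Opens M₀} (h : W ≤ U)
    {f : M.Sec U} (hf : M.res h f = 0) (ν : Finset (Fin q)) (o : U) (ho : (o : M₀) ∈ W) :
    x.coeff f ν o = 0 := by
  have h1 := x.coeff_restrict W h f ν
  rw [hf, ← frame_coeff, map_zero] at h1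
  exact (congrArg (fun g : Smooth p W => g ⟨o, ho⟩) h1).symm

theorem CoordSystem.eq_of_res_eq (x : M.CoordSystem U) {f g : M.Sec U}
    (h : ∀ o ∈ U, ∃ (W : Opens M₀) (hW : W ≤ U), o ∈ W ∧ M.res hW f = M.res hW g) : f = g := by
  refine x.frame.ext_coeff fun ν => ?_
  rw [← sub_eq_zero, ← map_sub, frame_coeff]
  ext o
  obtain ⟨W, hW, ho, hfg⟩ := h o o.2
  exact x.coeff_apply_eq_zero_of_res hW (by rw [map_sub, hfg, sub_self]) ν o ho

namespace BerezinDensity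

theorem exists_vanishesOn {β : M.BerezinDensity} {o : M₀} (ho : o ∉ β.support) :
    ∃ W : Opens M₀, o ∈ W ∧ β.VanishesOn W := by
  by_contra! h
  exact ho h

theorem VanishesOn.res_eq_zero {β : M.BerezinDensity} {W : Opens M₀} (hW : β.VanishesOn W)
    (x : M.CoordSystem U) : M.res (inf_le_left : U ⊓ W ≤ U) (β.val U x) = 0 := by
  rw [← β.val_restrict]
  exact hW _ inf_le_right _

/-- The product of a Berezin density with a smooth function, pulled back along a retraction. -/
def smulPullback (β : M.BerezinDensity) (γ : M.Retraction) (φ : Smooth p (⊤ : Opens M₀)) :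
    M.BerezinDensity where
  val U x := γ.pullback U (smoothRes le_top φ) * β.val U x
  val_restrict h x := by
    rw [β.val_restrict, map_mul, γ.res_pullback]
    rfl
  change x y := by rw [β.change x y, mul_assoc]

theorem smulPullback_vanishesOff (β : M.BerezinDensity) (γ : M.Retraction)
    (φ : Smooth p (⊤ : Opens M₀)) {C : Set M₀} (hC : IsClosed C)
    (hφ : ∀ o : (⊤ : Opens M₀), (o : M₀) ∉ C → φ o = 0) :
    (β.smulPullback γ φ).VanishesOff (C ∩ β.support) := by
  intro U x ν o ho
  by_cases hs : (o : M₀) ∈ β.support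
  · have hoC : (o : M₀) ∉ C := fun h => ho ⟨h, hs⟩
    let W : Opens M₀ := U ⊓ ⟨Cᶜ, hC.isOpen_compl⟩
    refine x.coeff_apply_eq_zero_of_res (W := W) inf_le_left ?_ ν o ⟨o.2, hoC⟩
    have h0 : smoothRes (inf_le_left : W ≤ U) (smoothRes le_top φ : Smooth p U) = 0 := by
      ext z
      exact hφ _ z.2.2
    rw [smulPullback, map_mul, γ.res_pullback, h0, map_zero, zero_mul]
  · obtain ⟨W, hoW, hW⟩ := exists_vanishesOn hs
    refine x.coeff_apply_eq_zero_of_res inf_le_left ?_ ν o ⟨o.2, hoW⟩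
    rw [smulPullback, map_mul, hW.res_eq_zero, mul_zero]

/-- The decomposition of a Berezin density by functions that sum up to `1` near its support. -/
theorem val_eq_sum_smulPullback (β : M.BerezinDensity) (γ : M.Retraction) {ι : Type*}
    (t : Finset ι) (φ : ι → Smooth p (⊤ : Opens M₀)) {N : Set M₀} (hN : IsOpen N)
    (hβN : β.support ⊆ N) (hφ : ∀ o : (⊤ : Opens M₀), (o : M₀) ∈ N → ∑ i ∈ t, φ i o = 1)
    (U : Opens M₀) (x : M.CoordSystem U) :
    β.val U x = ∑ i ∈ t, (β.smulPullback γ (φ i)).val U x := by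
  refine x.eq_of_res_eq fun o ho => ?_
  by_cases hs : o ∈ β.support
  · let W : Opens M₀ := U ⊓ ⟨N, hN⟩
    refine ⟨W, inf_le_left, ⟨ho, hβN hs⟩, ?_⟩
    have h1 : ∑ i ∈ t, smoothRes (inf_le_left : W ≤ U) (smoothRes le_top (φ i) : Smooth p U) =
        1 := by
      ext z
      rw [← evalAt_apply, map_sum]
      exact hφ _ z.2.2
    simp only [smulPullback]
    rw [← Finset.sum_mul, map_mul, map_sum (M.res _)]
    simp only [γ.res_pullback]
    rw [← map_sum (γ.pullback W), h1, map_one, one_mul]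
  · obtain ⟨W, hoW, hW⟩ := exists_vanishesOn hs
    refine ⟨U ⊓ W, inf_le_left, ⟨ho, hoW⟩, ?_⟩
    simp only [smulPullback]
    rw [← Finset.sum_mul, map_mul, hW.res_eq_zero, mul_zero]

/-- The number `I` is built from `γ₀` and a partition of unity before `γ` is chosen. Cutting off
along `γ₀` is legitimate for every `γ`, since fibre integration is additive in the Berezin density
and the integral of each localized summand does not depend on `γ`. -/
theorem exists_isFibreIntegral_and_hasIntegral [T2Space M₀] [SecondCountableTopology M₀]
    [IsManifold (𝓡 p) ∞ M₀] (β : M.BerezinDensity) (hβ : IsCompact β.support) (s : ℕ → ℕ → ℕ)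
    (γ₀ : M.Retraction) :
    ∃ I : ℝ, ∀ (γ : M.Retraction) (ρ : Density p M₀), β.IsFibreIntegral s γ ρ →
      ρ.HasIntegral I := by
  have : LocallyCompactSpace M₀ := ChartedSpace.locallyCompactSpace (Model p) M₀
  choose V x hV _ _ _ using fun o : M₀ =>
    γ₀.exists_isAdapted (IsManifold.chart_mem_maximalAtlas (I := 𝓡 p) (n := ∞) o)
      (mem_chart_source (Model p) o)
  obtain ⟨f, hf⟩ := SmoothPartitionOfUnity.exists_isSubordinate (𝓡 p) (isClosed_univ (X := M₀))
    (fun o => (V o : Set M₀)) (fun o => (V o).isOpen)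
    fun o _ => Set.mem_iUnion.2 ⟨o, hV o⟩
  let φ : M₀ → Smooth p (⊤ : Opens M₀) := fun i =>
    toSmooth (fun o => f i o) ((f i).contMDiff.comp contMDiff_subtype_val)
  have hlf : LocallyFinite fun i => tsupport (f i) := f.locallyFinite.closure
  have hfin := hlf.finite_nonempty_inter_compact hβ
  let t : Finset M₀ := hfin.toFinset
  -- Off the supports of the functions with index outside `t` the finite sum over `t` is `1`. Local
  -- finiteness makes `N` open, and `t` contains every index whose support meets that of `β`.
  let N : Set M₀ := (⋃ i : {i // i ∉ t}, tsupport (f i))ᶜ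
  have hN : IsOpen N := by
    refine IsClosed.isOpen_compl (self := ?_)
    exact (hlf.comp_injective Subtype.val_injective).isClosed_iUnion fun _ => isClosed_closure
  have hβN : β.support ⊆ N := by
    intro o ho h
    obtain ⟨⟨i, hi⟩, hoi⟩ := Set.mem_iUnion.1 h
    exact hi (hfin.mem_toFinset.2 ⟨o, hoi, ho⟩)
  have hφ : ∀ o : (⊤ : Opens M₀), (o : M₀) ∈ N → ∑ i ∈ t, φ i o = 1 := by
    intro o ho
    have h1 := f.sum_eq_one (Set.mem_univ (o : M₀))
    rw [finsum_eq_sum_of_support_subset (s := t)] at h1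
    · exact h1
    · intro i hi
      by_contra hit
      exact ho (Set.mem_iUnion.2 ⟨⟨i, hit⟩, subset_closure hi⟩)
  have hoff : ∀ i, (β.smulPullback γ₀ (φ i)).VanishesOff (tsupport (f i) ∩ β.support) :=
    fun i => β.smulPullback_vanishesOff γ₀ (φ i) isClosed_closure fun o ho =>
      image_eq_zero_of_notMem_tsupport (f := f i) ho
  refine ⟨∑ i ∈ t, (-1) ^ s p q * (x i).berezinIntegral (β.smulPullback γ₀ (φ i)),
    fun γ ρ hρ => ?_⟩
  choose τ hτ using fun i => (β.smulPullback γ₀ (φ i)).exists_isFibreIntegral s γ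
  refine Density.hasIntegral_of_eq_sum t (τ := τ) (fun i _ => ?_) fun e he o ho => ?_
  · exact (hoff i).hasIntegral (hβ.inter_left isClosed_closure)
      (Set.inter_subset_left.trans (hf i)) (x i) (hτ i)
  · exact hρ.val_eq_sum hτ (β.val_eq_sum_smulPullback γ₀ t φ hN hβN hφ) he ho

theorem HasIntegral.integral_eq {β : M.BerezinDensity} {s : ℕ → ℕ → ℕ} {γ : M.Retraction} {I : ℝ}
    (h : β.HasIntegral s γ I) (huniq : ∀ J, β.HasIntegral s γ J → J = I) :
    β.integral s γ = I := by
  have hi : β.IsIntegrable s γ := ⟨I, h⟩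
  rw [integral, dif_pos hi]
  exact huniq _ hi.choose_spec

end BerezinDensity

end Supermanifold

end Globalization

end Supergeometry

end

/-! ### The theorem -/

theorem mainTheorem8 {p q : ℕ} {M₀ : Type u} [TopologicalSpace M₀] [T2Space M₀]
    [SecondCountableTopology M₀] [ChartedSpace (Supergeometry.Model p) M₀]
    [IsManifold (𝓡 p) ∞ M₀] (M : Supergeometry.Supermanifold p q M₀)
    (s : ℕ → ℕ → ℕ) (γ γ' : M.Retraction) (β : M.BerezinDensity)
    (hβ : IsCompact β.support) :
    β.IsIntegrable s γ ∧ β.IsIntegrable s γ' ∧ β.integral s γ = β.integral s γ' := by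
  obtain ⟨I, hI⟩ := β.exists_isFibreIntegral_and_hasIntegral hβ s γ
  have h : ∀ δ : M.Retraction, β.HasIntegral s δ I := fun δ => by
    obtain ⟨ρ, hρ⟩ := β.exists_isFibreIntegral s δ
    exact ⟨ρ, hρ, hI δ ρ hρ⟩
  -- `integral` is a chosen value and the density in `HasIntegral` is only asserted to exist, so
  -- every admissible value has to be identified with `I`.
  have huniq : ∀ (δ : M.Retraction) (J : ℝ), β.HasIntegral s δ J → J = I := by
    rintro δ J ⟨ρ, hρ, hJ⟩
    exact hJ.unique (hI δ ρ hρ)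
  exact ⟨⟨I, h γ⟩, ⟨I, h γ'⟩,
    ((h γ).integral_eq (huniq γ)).trans ((h γ').integral_eq (huniq γ')).symm⟩
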